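/- **Setting.** Let $n,m,M$ be positive integers with $m<M$. Let $V_1,\dots,V_M$ be coordinate subspaces of $\mathbb R^n$ (spans of subsets of the standard basis $e_1,\dots,e_n$), $K_j=V_j^\perp$, and let $L_j:\mathbb R^n\to V_j$ be the orthogonal projections. On $\mathbb H^n=\mathbb R^n\times\mathbb R^n\times\mathbb R$ with Lebesgue measure put $$\pi_j(x,y,t)=(L_jx,\,y,\,t+\tfrac12x\cdot y)\ (1\le j\le m),\qquad \pi_j(x,y,t)=(x,\,L_jy,\,t-\tfrac12x\cdot y)\ (m<j\le M).$$ Let $p_1,\dots,p_M\in[1,\infty)\cap\mathbb Q$ satisfy $$n+1=\sum_{j\le m}\frac{\dim V_j+1}{p_j}+\sum_{j>m}\frac{n+1}{p_j},\qquad \dim V+1<\sum_{j\le m}\frac{\dim (V_j\cap V)+1}{p_j}+\sum_{j>m}\frac{\dim V+1}{p_j}$$ for every proper coordinate subspace $V$, and $\sum_{j\le m}\frac{\dim (K_j\cap V)}{p_j}=\sum_{j>m}\frac{\dim (K_j\cap V)}{p_j}$ for every coordinate subspace $V\le\mathbb R^n$. Write $p_j^{-1}=q_j/q$ with positive integers $q_j,q$,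 $\gcd(q_1,\dots,q_M,q)=1$, and $N=\sum_jq_j-q$ (which is positive). Let $Q_i=\sum_{j\le m,\ e_i\in K_j}q_j$, let $\lambda_1>\dots>\lambda_{\tilde m}$ be the distinct values of $Q_1,\dots,Q_n$, put $\lambda_{\tilde m+1}=0$, $\tilde q_j=\lambda_j-\lambda_{j+1}$, $\tilde K_j=\operatorname{span}\{e_i:Q_i\ge\lambda_j\}$, let $P_j$ be the orthogonal projection onto $\tilde K_j^\perp$, and put $$\tilde\pi_j(x,y,t)=(P_jx,\,y,\,t+\tfrac12x\cdot y),\qquad \tilde\pi_j^*(x,y,t)=(x,\,P_jy,\,t-\tfrac12x\cdot y),\qquad 1\le j\le\tilde m.$$ For $s\in\mathbb R^n$ let $e^{s\cdot\mathbf X}(x,y,t)=(x+s,y,t-\frac12s\cdot y)$ and $e^{s\cdot\mathbf Y}(x,y,t)=(x,y+s,t+\frac12x\cdot s)$. For $\Omega\subset\mathbb H^n$ and $z\in\mathbb H^n$ let $$T^\Omega(z)=\{s\in\mathbb R^n:e^{s\cdot\mathbf X}(z)\in\Omega\},\qquad T^\Omega_*(z)=\{s\in\mathbb R^n:e^{s\cdot\mathbf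 Y}(z)\in\Omega\},$$ $$\tilde T_j^\Omega(z)=\{s\in\tilde K_j:e^{s\cdot\mathbf X}(z)\in\Omega\},\qquad (\tilde T_j^*)^{\Omega}(z)=\{s\in\tilde K_j:e^{s\cdot\mathbf Y}(z)\in\Omega\}.$$ Here $|\cdot|$ is Lebesgue measure of the appropriate dimension (counting measure in dimension $0$; outer measure for sets that are not measurable). Put $$\alpha_j=\frac{|\Omega|}{|\pi_j(\Omega)|},\qquad \beta_j=\frac{|\Omega|}{|\tilde\pi_j(\Omega)|},\qquad \beta_j^*=\frac{|\Omega|}{|\tilde\pi_j^*(\Omega)|}.$$ A bounded Lebesgue measurable set $\Omega\subset\mathbb H^n$ is *$\sigma$-semiregular with respect to $\pi$* if $|\Omega|>0$ and $|\tilde T_j^\Omega(z)|\le2\sigma^{-1}\beta_j$ for all $z\in\Omega$ and $1\le j\le\tilde m$. It is *$\varepsilon$-quasiextremal* if $|\Omega|\ge\varepsilon\prod_{j=1}^M|\pi_j(\Omega)|^{1/p_j}$. For an integer $A\ge1$ and $c>0$, a *refined flow scheme of $(\Omega,\pi,A)$ with constant $c$* consists of measurable sets $\Omega_1\subset\dots\subset\Omega_A\subset\Omega$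 with $|\Omega_l|\ge c|\Omega|$, a point $z_0\in\mathbb H^n$, and the sets $S_l\subset(\mathbb R^n)^l$, $1\le l\le A$, given by $S_1=T^{\Omega_1}(z_0)$ and $$S_{l+1}=\{(s',s)\in S_l\times\mathbb R^n: s\in T_*^{\Omega_{l+1}}(\Phi_l(s'))\}\ (l\text{ odd}),\qquad S_{l+1}=\{(s',s)\in S_l\times\mathbb R^n: s\in T^{\Omega_{l+1}}(\Phi_l(s'))\}\ (l\text{ even}),$$ where $\Phi_1(s)=e^{s\cdot\mathbf X}(z_0)$, $\Phi_{l+1}(s',s)=e^{s\cdot\mathbf Y}(\Phi_l(s'))$ for $l$ odd and $\Phi_{l+1}(s',s)=e^{s\cdot\mathbf X}(\Phi_l(s'))$ for $l$ even. With $\mathcal F_l(s)=\{u:(s,u)\in S_{2l}\}$ for $s\in S_{2l-1}$ ($2l\le A$) and $\mathcal G_l(s)=\{v:(s,v)\in S_{2l+1}\}$ for $s\in S_{2l}$ ($2l+1\le A$), it is required that $$\frac{|S_1|}{|L_j(S_1)|}\ge c\alpha_j,\quad \frac{|\mathcal G_l(s)|}{|L_j(\mathcal G_l(s))|}\ge c\alpha_j\quad(j\le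 m),\qquad \frac{|\mathcal F_l(s)|}{|L_j(\mathcal F_l(s))|}\ge c\alpha_j\quad(j>m)$$ for all these $l,s$, and that for $1\le l\le A$, $1\le j\le\tilde m$ and all $z\in\Omega_l$ one has $|\tilde T_j^{\Omega_l}(z)|\ge c\beta_j$ if $l$ is odd and $|(\tilde T_j^*)^{\Omega_l}(z)|\ge c\beta_j^*$ if $l$ is even. The *maximal partition* of $\mathbb R^n$ given by $\{L_j\}_{j>m}$ is a decomposition $\mathbb R^n=\bigoplus_aU_a$ into coordinate subspaces such that, for all $a$ and all $j>m$, $U_a\le\ker L_j$ or $U_a\le L_j(\mathbb R^n)$, and such that every subspace $W\le\mathbb R^n$ which for each $j>m$ satisfies $W\le\ker L_j$ or $W\le L_j(\mathbb R^n)$ is contained in some $U_a$. An origin-centered ellipsoid in $\mathbb R^n$ is *adapted to $\{L_j\}_{j>m}$* if its principal axes are along an orthonormal basis of $\mathbb R^n$ that is a union of bases of the $U_a$. **Proposition.** There are constants $C,K>0$, depending only on $n$, the $\pi_j$ and the $p_j$, such that the following hold. 1. For every $\sigma\in(0,1)$ and every $\Omega\subset\mathbb H^n$ that is $\sigma$-semiregular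 with respect to $\pi$, $$|\Omega|^N\ge K^{-1}\sigma^C\Big(\prod_{j=1}^{\tilde m}\beta_j^{\tilde q_j}\Big)\Big(\prod_{j=m+1}^M\alpha_j^{q_j}\Big),\qquad \Big(\prod_{j=1}^{\tilde m}\beta_j^{\tilde q_j}\Big)\Big(\prod_{j=m+1}^M\alpha_j^{q_j}\Big)\ge K^{-1}\sigma^C\prod_{j=1}^M\alpha_j^{q_j},$$ and in particular $$|\Omega|\le K\sigma^{-C}\prod_{j=1}^M|\pi_j(\Omega)|^{1/p_j}.$$ 2. For every integer $A\ge3$ there is $c>0$, depending only on $n$, the $\pi_j$, the $p_j$ and $A$, such that whenever $0<\varepsilon\le\sigma<1$ and $\Omega$ is $\sigma$-semiregular with respect to $\pi$ and $\varepsilon$-quasiextremal, there is a refined flow scheme of $(\Omega,\pi,A)$ with constant $c$ such that for each $s\in S_1$ there is an origin-centered ellipsoid $\mathcal C(s)\subset\mathbb R^n$ adapted to $\{L_j\}_{j=m+1}^M$ with $$\mathcal F_1(s)\subset\mathcal C(s),\qquad |\mathcal C(s)|\le K\varepsilon^{-C}|\mathcal F_1(s)|.$$ -/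

import Mathlib

open MeasureTheory Finset

noncomputable section

namespace HeisFinner

/-- Vectors of `ℝⁿ`; the volume is Lebesgue measure. Euclidean notions are
expressed through the dot product `⬝ᵥ`. -/
abbrev Vec (n : ℕ) := Fin n → ℝ

/-- The underlying space `ℝⁿ × ℝⁿ × ℝ` of the Heisenberg group, points `(x, y, t)`. Its Haar measure
is the product Lebesgue measure. -/
abbrev Heis (n : ℕ) := Vec n × Vec n × ℝ

/-! ### Coordinate projections and vertical projections

A coordinate subspace of `ℝⁿ` is the span of the standard basis vectors `e_i`, `i ∈ s`, and is
encoded by the index set `s`. Its dimension is `#s`, its orthogonal complement is encoded by `sᶜ`,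
intersections are encoded by intersections. -/

/-- The orthogonal projection of `ℝⁿ` onto the coordinate subspace encoded by `s`, which is
identified with `ℝ^s`, so that the volume on the target is the `#s`-dimensional Lebesgue measure
(the counting measure if `s = ∅`). -/
def coordProj {n : ℕ} (s : Finset (Fin n)) (x : Vec n) : s → ℝ := fun i => x i

/-- The inclusion of the coordinate subspace encoded by `s` into `ℝⁿ` (extension by zero). -/
def coordIncl {n : ℕ} (s : Finset (Fin n)) (u : s → ℝ) : Vec n :=
  fun i => if h : i ∈ s then u ⟨i, h⟩ else 0

/-- `(x, y, t) ↦ (L x, y, t + x·y/2)`, where `L` is the coordinate projection given by `s`. -/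
def projX {n : ℕ} (s : Finset (Fin n)) (z : Heis n) : (s → ℝ) × Vec n × ℝ :=
  (coordProj s z.1, z.2.1, z.2.2 + 1 / 2 * (z.1 ⬝ᵥ z.2.1))

/-- `(x, y, t) ↦ (x, L y, t - x·y/2)`, where `L` is the coordinate projection given by `s`. -/
def projY {n : ℕ} (s : Finset (Fin n)) (z : Heis n) : Vec n × (s → ℝ) × ℝ :=
  (z.1, coordProj s z.2.1, z.2.2 - 1 / 2 * (z.1 ⬝ᵥ z.2.1))

/-- The first `m` of the `M` indices, those of the maps `π_j` that project the `x` variable.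
(Indices start from `0`.) -/
def idxX (M m : ℕ) : Finset (Fin M) := univ.filter fun j => (j : ℕ) < m

/-- The last `M - m` of the `M` indices, those of the maps `π_j` that project the `y` variable. -/
def idxY (M m : ℕ) : Finset (Fin M) := univ.filter fun j => m ≤ (j : ℕ)

/-- `|π_j(Ω)|`, where `π_j = projX (V j)` for the first `m` indices and `π_j = projY (V j)` for the
other ones. -/
def piSize {n M : ℕ} (m : ℕ) (V : Fin M → Finset (Fin n)) (j : Fin M) (Ω : Set (Heis n)) : ℝ :=
  if (j : ℕ) < m then volume.real (projX (V j) '' Ω) else volume.real (projY (V j) '' Ω)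

/-- `α_j = |Ω| / |π_j(Ω)|`. -/
def alpha {n M : ℕ} (m : ℕ) (V : Fin M → Finset (Fin n)) (Ω : Set (Heis n)) (j : Fin M) : ℝ :=
  volume.real Ω / piSize m V j Ω

/-! ### The auxiliary maps with nested kernels

The exponents are written `1 / p_j = e_j / q` with positive integers `e_j`, `q`. -/

/-- `N = (∑ e_j) - q`. -/
def bigN {M : ℕ} (e : Fin M → ℕ) (q : ℕ) : ℕ := (∑ j, e j) - q

/-- `Q_i`, the sum of `e_j` over the first `m` indices `j` with `e_i ∈ K_j = V_jᗮ`. -/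
def bigQ {n M : ℕ} (m : ℕ) (V : Fin M → Finset (Fin n)) (e : Fin M → ℕ) (i : Fin n) : ℕ :=
  ∑ j ∈ (idxX M m).filter (fun j => i ∉ V j), e j

/-- The number of distinct values of `Q_1, …, Q_n`. -/
def numLevels {n : ℕ} (Q : Fin n → ℕ) : ℕ := #(univ.image Q)

/-- The distinct values of `Q_1, …, Q_n` in decreasing order: `level Q 0 > level Q 1 > …`, followed
by zeros from the index `numLevels Q` on. -/
def level {n : ℕ} (Q : Fin n → ℕ) (j : ℕ) : ℕ :=
  ((univ.image Q).sort (· ≥ ·)).getD j 0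

/-- The index set of the kernel of the `j`-th auxiliary coordinate projection `P_j`. If
`Q_1 ≥ … ≥ Q_n`, then it consists of the first `k̃_j` indices, the ones up to the end of the `j`-th
block on which `Q` is constant. -/
def auxKer {n : ℕ} (Q : Fin n → ℕ) (j : ℕ) : Finset (Fin n) := {i | level Q j ≤ Q i}

/-- The difference of two consecutive values of `Q`; the last value itself if `j` is the last
index. -/
def auxExp {n : ℕ} (Q : Fin n → ℕ) (j : ℕ) : ℕ := level Q j - level Q (j + 1)

/-- `β_j = |Ω| / |π̃_j(Ω)|` with `π̃_j(x, y, t) = (P_j x, y, t + x·y/2)`. -/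
def beta {n : ℕ} (Q : Fin n → ℕ) (Ω : Set (Heis n)) (j : ℕ) : ℝ :=
  volume.real Ω / volume.real (projX (auxKer Q j)ᶜ '' Ω)

/-- `β_j^* = |Ω| / |π̃_j^*(Ω)|` with `π̃_j^*(x, y, t) = (x, P_j y, t - x·y/2)`. -/
def betaStar {n : ℕ} (Q : Fin n → ℕ) (Ω : Set (Heis n)) (j : ℕ) : ℝ :=
  volume.real Ω / volume.real (projY (auxKer Q j)ᶜ '' Ω)

/-! ### Flows and fibers -/

/-- The exponential flow `e^{s·X}` of the left-invariant fields
`X_i = ∂/∂x_i - (y_i/2) ∂/∂t`. -/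
def expX {n : ℕ} (s : Vec n) (z : Heis n) : Heis n :=
  (z.1 + s, z.2.1, z.2.2 - 1 / 2 * (s ⬝ᵥ z.2.1))

/-- The exponential flow `e^{s·Y}` of the left-invariant fields
`Y_i = ∂/∂y_i + (x_i/2) ∂/∂t`. -/
def expY {n : ℕ} (s : Vec n) (z : Heis n) : Heis n :=
  (z.1, z.2.1 + s, z.2.2 + 1 / 2 * (z.1 ⬝ᵥ s))

/-- `T^Ω(z)`. -/
def fibX {n : ℕ} (Ω : Set (Heis n)) (z : Heis n) : Set (Vec n) := {s | expX s z ∈ Ω}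

/-- `T^Ω_*(z)`. -/
def fibY {n : ℕ} (Ω : Set (Heis n)) (z : Heis n) : Set (Vec n) := {s | expY s z ∈ Ω}

/-- `T̃^Ω_j(z)`, the fiber of `π̃_j` in `Ω` through `z`. -/
def auxFibX {n : ℕ} (Q : Fin n → ℕ) (j : ℕ) (Ω : Set (Heis n)) (z : Heis n) :
    Set (auxKer Q j → ℝ) :=
  {u | expX (coordIncl (auxKer Q j) u) z ∈ Ω}

/-- `(T̃^*_j)^Ω(z)`, the fiber of `π̃_j^*` in `Ω` through `z`. -/
def auxFibY {n : ℕ} (Q : Fin n → ℕ) (j : ℕ) (Ω : Set (Heis n)) (z : Heis n) :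
    Set (auxKer Q j → ℝ) :=
  {u | expY (coordIncl (auxKer Q j) u) z ∈ Ω}

/-! ### Semiregular and quasiextremal sets -/

/-- `σ`-semiregularity with respect to `π`: a bounded (Lebesgue) measurable set of positive measure
whose `π̃_j` fibers have size at most `2 σ⁻¹` times their average size. -/
structure IsSemiregular {n : ℕ} (Q : Fin n → ℕ) (σ : ℝ) (Ω : Set (Heis n)) : Prop where
  bounded : Bornology.IsBounded Ω
  measurable : NullMeasurableSet Ω volume
  pos : 0 < volume Ω
  fiber_le : ∀ z ∈ Ω, ∀ j < numLevels Q,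
    volume.real (auxFibX Q j Ω z) ≤
      2 * σ⁻¹ * (volume.real Ω / volume.real (projX (auxKer Q j)ᶜ '' Ω))

/-- `ε`-quasiextremality: `|Ω| ≥ ε ∏ |π_j(Ω)|^{1/p_j}` for a bounded measurable set. -/
structure IsQuasiextremal {n M : ℕ} (m : ℕ) (V : Fin M → Finset (Fin n)) (p : Fin M → ℚ)
    (ε : ℝ) (Ω : Set (Heis n)) : Prop where
  bounded : Bornology.IsBounded Ω
  measurable : NullMeasurableSet Ω volume
  le : ε * ∏ j, piSize m V j Ω ^ (1 / (p j : ℝ)) ≤ volume.real Ω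

/-! ### Refined flow schemes -/

/-- The compound flow `Φ_l(s)(z)`: it flows alternately along `X` and `Y`, starting with `X`. -/
def compFlow {n : ℕ} (z : Heis n) : (l : ℕ) → (Fin l → Vec n) → Heis n
  | 0, _ => z
  | l + 1, s =>
    if Even l then expX (s (Fin.last l)) (compFlow z l (Fin.init s))
    else expY (s (Fin.last l)) (compFlow z l (Fin.init s))

/-- The set `S_l ⊆ (ℝⁿ)^l` built from the sets `Ω_1, Ω_2, …` and the base point `z`:
`S_1 = T^{Ω_1}(z)`, and `(s', s) ∈ S_{l+1}` iff `s' ∈ S_l` and `s` lies in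
`T_*^{Ω_{l+1}}(Φ_l(s')(z))` for odd `l`, in `T^{Ω_{l+1}}(Φ_l(s')(z))` for even `l`. -/
def flowSet {n : ℕ} (Ωs : ℕ → Set (Heis n)) (z : Heis n) : (l : ℕ) → Set (Fin l → Vec n)
  | 0 => Set.univ
  | l + 1 => {s | Fin.init s ∈ flowSet Ωs z l ∧
      s (Fin.last l) ∈
        if Even l then fibX (Ωs (l + 1)) (compFlow z l (Fin.init s))
        else fibY (Ωs (l + 1)) (compFlow z l (Fin.init s))}

/-- The section `{u | (s, u) ∈ S_{l+1}}` over `s ∈ S_l`. It is `𝓕_k(s)` for `l = 2 k - 1`, and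
`𝓖_k(s)` for `l = 2 k`, `k ≥ 1`; for `l = 0` it is `S_1` as a subset of `ℝⁿ`. -/
def flowFiber {n : ℕ} (Ωs : ℕ → Set (Heis n)) (z : Heis n) (l : ℕ) (s : Fin l → Vec n) :
    Set (Vec n) :=
  {u | (Fin.snoc s u : Fin (l + 1) → Vec n) ∈ flowSet Ωs z (l + 1)}

/-- The chain `Ω_1 ⊆ … ⊆ Ω_A ⊆ Ω` and the point `z` give a refined flow scheme
`(z, S_1, 𝓕_l, 𝓖_l)` of `(Ω, π, A)` with constant `c`. -/
structure IsRefinedFlowScheme {n M : ℕ} (m : ℕ) (V : Fin M → Finset (Fin n)) (e : Fin M → ℕ)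
    (Ω : Set (Heis n)) (A : ℕ) (c : ℝ) (Ωs : ℕ → Set (Heis n)) (z : Heis n) : Prop where
  measurable : ∀ l, 1 ≤ l → l ≤ A → MeasurableSet (Ωs l)
  chain : ∀ l, 1 ≤ l → l < A → Ωs l ⊆ Ωs (l + 1)
  subset : ∀ l, 1 ≤ l → l ≤ A → Ωs l ⊆ Ω
  /-- every `Ω_l` is a refinement of `Ω` -/
  large : ∀ l, 1 ≤ l → l ≤ A → c * volume.real Ω ≤ volume.real (Ωs l)
  /-- the bounds on `S_1` (`l = 0`) and on `𝓖_k(s)` (`l = 2 k`) -/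
  even_fiber : ∀ l < A, Even l → ∀ s ∈ flowSet Ωs z l, ∀ j ∈ idxX M m,
    c * alpha m V Ω j ≤
      volume.real (flowFiber Ωs z l s) / volume.real (coordProj (V j) '' flowFiber Ωs z l s)
  /-- the bounds on `𝓕_k(s)` (`l = 2 k - 1`) -/
  odd_fiber : ∀ l < A, Odd l → ∀ s ∈ flowSet Ωs z l, ∀ j ∈ idxY M m,
    c * alpha m V Ω j ≤
      volume.real (flowFiber Ωs z l s) / volume.real (coordProj (V j) '' flowFiber Ωs z l s)
  odd_aux : ∀ l, 1 ≤ l → l ≤ A → Odd l → ∀ w ∈ Ωs l, ∀ j < numLevels (bigQ m V e),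
    c * beta (bigQ m V e) Ω j ≤ volume.real (auxFibX (bigQ m V e) j (Ωs l) w)
  even_aux : ∀ l, 1 ≤ l → l ≤ A → Even l → ∀ w ∈ Ωs l, ∀ j < numLevels (bigQ m V e),
    c * betaStar (bigQ m V e) Ω j ≤ volume.real (auxFibY (bigQ m V e) j (Ωs l) w)

/-! ### Adapted ellipsoids -/

/-- The coordinate subspace encoded by `s`, as a subspace of `ℝⁿ`. -/
def coordSubspace {n : ℕ} (s : Finset (Fin n)) : Submodule ℝ (Vec n) :=
  Submodule.span ℝ ((fun i => Pi.single i (1 : ℝ)) '' (s : Set (Fin n)))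

/-- A subspace is split by the coordinate projections onto the `V_j` if it lies in the kernel or in
the range of each of them. -/
def IsSplitBy {n : ℕ} {ι : Type*} (V : ι → Finset (Fin n)) (W : Submodule ℝ (Vec n)) : Prop :=
  ∀ j, W ≤ coordSubspace (V j)ᶜ ∨ W ≤ coordSubspace (V j)

/-- `{U_a}` is a maximal partition of `ℝⁿ` given by the coordinate projections onto the `V_j`. -/
structure IsMaximalPartition {n d : ℕ} {ι : Type*} (V : ι → Finset (Fin n))
    (U : Fin d → Submodule ℝ (Vec n)) : Prop where
  coord : ∀ a, ∃ s, U a = coordSubspace s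
  directSum : DirectSum.IsInternal U
  split : ∀ a, IsSplitBy V (U a)
  maximal : ∀ W : Submodule ℝ (Vec n), IsSplitBy V W → ∃ a, W ≤ U a

/-- `E` is an origin-centered ellipsoid adapted to the coordinate projections onto the `V_j`: its
principal axes are along an orthonormal basis of `ℝⁿ` each of whose members lies in one of the
spaces `U_a` of the maximal partition (so that the members in `U_a` form a basis of `U_a`). -/
def IsAdaptedEllipsoid {n : ℕ} {ι : Type*} (V : ι → Finset (Fin n)) (E : Set (Vec n)) : Prop :=
  ∃ (d : ℕ) (U : Fin d → Submodule ℝ (Vec n)) (b : Fin n → Vec n) (r : Fin n → ℝ),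
    IsMaximalPartition V U ∧
    (∀ i k, b i ⬝ᵥ b k = if i = k then 1 else 0) ∧
    (∀ i, ∃ a, b i ∈ U a) ∧
    (∀ i, 0 < r i) ∧
    E = {x | ∑ i, ((b i ⬝ᵥ x) / r i) ^ 2 ≤ 1}

end HeisFinner

end

open HeisFinner

noncomputable section

namespace HeisFinner

open scoped ENNReal Topology Matrix

section

theorem coordIncl_add {n : ℕ} (s : Finset (Fin n)) (u v : s → ℝ) :
    coordIncl s (u + v) = coordIncl s u + coordIncl s v := by
  ext i; by_cases h : i ∈ s <;> simp [coordIncl, h]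

theorem measurable_coordIncl {n : ℕ} (s : Finset (Fin n)) : Measurable (coordIncl s) := by
  refine measurable_pi_lambda _ fun i => ?_
  by_cases h : i ∈ s <;> simp only [coordIncl, h, dite_true, dite_false] <;> fun_prop

theorem measurable_coordProj {n : ℕ} (s : Finset (Fin n)) : Measurable (coordProj s) := by
  unfold coordProj; fun_prop

theorem coordProj_incl_add {n : ℕ} {s k : Finset (Fin n)} (h : s = kᶜ) (a : s → ℝ) (u : k → ℝ) :
    coordProj s (coordIncl s a + coordIncl k u) = a := by
  subst h
  ext ⟨i, hi⟩
  have : i ∉ k := by simpa using hi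
  simp [coordProj, coordIncl, this]

theorem coordIncl_proj_add {n : ℕ} {s k : Finset (Fin n)} (h : s = kᶜ) (x : Vec n) :
    coordIncl s (coordProj s x) + coordIncl k (coordProj k x) = x := by
  subst h
  ext i
  by_cases hi : i ∈ k <;> simp [coordProj, coordIncl, hi]

/-- Fubini on `ℝⁿ` for complementary coordinate subspaces. -/
theorem lintegral_coord {n : ℕ} {s k : Finset (Fin n)} (h : s = kᶜ) {f : Vec n → ℝ≥0∞}
    (hf : Measurable f) :
    ∫⁻ x, f x = ∫⁻ a : s → ℝ, ∫⁻ u : k → ℝ, f (coordIncl s a + coordIncl k u) := by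
  subst h
  have h1 := lintegral_eq_lmarginal_univ (μ := fun _ : Fin n => (volume : Measure ℝ)) (f := f) 0
  have h2 : (univ : Finset (Fin n)) = kᶜ ∪ k := by
    ext i; by_cases hi : i ∈ k <;> simp [hi]
  rw [h2, lmarginal_union _ _ hf (Finset.disjoint_left.2 fun i hi => by simpa using hi)] at h1
  have h3 : ∀ (a : ↥(kᶜ) → ℝ) (u : k → ℝ),
      Function.updateFinset (Function.updateFinset (0 : Vec n) kᶜ a) k u =
        coordIncl kᶜ a + coordIncl k u := by
    intro a u
    ext i
    by_cases hi : i ∈ k <;> simp [Function.updateFinset, coordIncl, hi]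
  calc ∫⁻ x, f x = _ := h1
    _ = _ := by simp only [lmarginal, h3]; rfl

/-- Volume bound by the fibers of a coordinate projection, pointwise lower bound version. -/
theorem mul_volume_coordProj_le {n : ℕ} {s k : Finset (Fin n)} (h : s = kᶜ) {T : Set (Vec n)}
    (hT : MeasurableSet T) {τ : ℝ≥0∞}
    (hτ : ∀ x ∈ T, τ ≤ volume {u : k → ℝ | x + coordIncl k u ∈ T}) :
    τ * volume (coordProj s '' T) ≤ volume T := by
  set g : (s → ℝ) → ℝ≥0∞ := fun a => volume {u : k → ℝ | coordIncl s a + coordIncl k u ∈ T} with hg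
  have hmeas : Measurable fun p : (s → ℝ) × (k → ℝ) => coordIncl s p.1 + coordIncl k p.2 :=
    ((measurable_coordIncl s).comp measurable_fst).add ((measurable_coordIncl k).comp measurable_snd)
  have hgm : Measurable g := measurable_measure_prodMk_left (hmeas hT)
  have hvol : volume T = ∫⁻ a, g a := by
    have := lintegral_coord h (f := T.indicator 1) (measurable_one.indicator hT)
    rw [lintegral_indicator_one hT] at this
    rw [this]
    refine lintegral_congr fun a => ?_
    rw [hg]
    simp only
    rw [← lintegral_indicator_one]
    · rfl
    · exact (hmeas.comp measurable_prodMk_left) hT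
  have hsub : coordProj s '' T ⊆ {a | τ ≤ g a} := by
    rintro _ ⟨x, hx, rfl⟩
    have h1 := hτ x hx
    have h2 := coordIncl_proj_add h x
    have h3 : {u : k → ℝ | x + coordIncl k u ∈ T} =
        (fun u => coordProj k x + u) ⁻¹'
          {u | coordIncl s (coordProj s x) + coordIncl k u ∈ T} := by
      ext u
      simp only [Set.mem_ofPred_eq, Set.mem_preimage, coordIncl_add]
      rw [← add_assoc, h2]
    rw [h3, measure_preimage_add] at h1
    exact h1
  calc τ * volume (coordProj s '' T) ≤ τ * volume {a | τ ≤ g a} := by gcongr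
    _ ≤ ∫⁻ a, g a := mul_meas_ge_le_lintegral hgm τ
    _ = volume T := hvol.symm

theorem volume_le_mul_coordProj {n : ℕ} {s k : Finset (Fin n)} (h : s = kᶜ) {T : Set (Vec n)}
    (hT : MeasurableSet T) {τ : ℝ≥0∞}
    (hτ : ∀ x ∈ T, volume {u : k → ℝ | x + coordIncl k u ∈ T} ≤ τ) :
    volume T ≤ τ * volume (coordProj s '' T) := by
  have hmeas : Measurable fun p : (s → ℝ) × (k → ℝ) => coordIncl s p.1 + coordIncl k p.2 :=
    ((measurable_coordIncl s).comp measurable_fst).add ((measurable_coordIncl k).comp measurable_snd)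
  have hvol : volume T = ∫⁻ a : s → ℝ, volume {u : k → ℝ | coordIncl s a + coordIncl k u ∈ T} := by
    have := lintegral_coord h (f := T.indicator 1) (measurable_one.indicator hT)
    rw [lintegral_indicator_one hT] at this
    rw [this]
    refine lintegral_congr fun a => ?_
    rw [← lintegral_indicator_one]
    · rfl
    · exact (hmeas.comp measurable_prodMk_left) hT
  rw [hvol, ← measure_toMeasurable (coordProj s '' T), ← lintegral_indicator_const
    (measurableSet_toMeasurable _ _)]
  refine lintegral_mono fun a => ?_
  rcases Set.eq_empty_or_nonempty {u : k → ℝ | coordIncl s a + coordIncl k u ∈ T} with h0 | ⟨u, hu⟩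
  · rw [h0]; simp
  · have ha : a ∈ toMeasurable volume (coordProj s '' T) :=
      subset_toMeasurable _ _ ⟨_, hu, coordProj_incl_add h a u⟩
    simp only [Set.indicator_of_mem ha]
    have h1 := hτ _ hu
    have h3 : {v : k → ℝ | coordIncl s a + coordIncl k u + coordIncl k v ∈ T} =
        (fun v => u + v) ⁻¹' {u | coordIncl s a + coordIncl k u ∈ T} := by
      ext v
      simp only [Set.mem_ofPred_eq, Set.mem_preimage, coordIncl_add, add_assoc]
    rwa [h3, measure_preimage_add] at h1

/-! ### Flows -/

theorem expX_expX {n : ℕ} (a b : Vec n) (z : Heis n) : expX a (expX b z) = expX (b + a) z := by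
  simp only [expX, add_dotProduct, Prod.mk.injEq, add_assoc, true_and]
  ring

theorem expY_expY {n : ℕ} (a b : Vec n) (z : Heis n) : expY a (expY b z) = expY (b + a) z := by
  simp only [expY, dotProduct_add, Prod.mk.injEq, add_assoc, true_and]
  ring

theorem expY_zero {n : ℕ} (z : Heis n) : expY 0 z = z := by simp [expY]

theorem measurable_dotProduct {n : ℕ} {α : Type*} [MeasurableSpace α] {f g : α → Vec n}
    (hf : Measurable f) (hg : Measurable g) : Measurable fun a => f a ⬝ᵥ g a := by
  unfold dotProduct; fun_prop

theorem measurable_expX {n : ℕ} : Measurable fun p : Vec n × Heis n => expX p.1 p.2 := by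
  unfold expX
  have : Measurable fun p : Vec n × Heis n => p.1 ⬝ᵥ p.2.2.1 :=
    measurable_dotProduct (by fun_prop) (by fun_prop)
  fun_prop

theorem measurable_expY {n : ℕ} : Measurable fun p : Vec n × Heis n => expY p.1 p.2 := by
  unfold expY
  have : Measurable fun p : Vec n × Heis n => p.2.1 ⬝ᵥ p.1 :=
    measurable_dotProduct (by fun_prop) (by fun_prop)
  fun_prop

/-- A section of `projX s`. -/
def liftX {n : ℕ} (s : Finset (Fin n)) (b : (s → ℝ) × Vec n × ℝ) : Heis n :=
  (coordIncl s b.1, b.2.1, b.2.2 - 1 / 2 * (coordIncl s b.1 ⬝ᵥ b.2.1))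

theorem measurable_liftX {n : ℕ} (s : Finset (Fin n)) : Measurable (liftX s) := by
  unfold liftX
  have h := (measurable_coordIncl s)
  have : Measurable fun p : (s → ℝ) × Vec n × ℝ => coordIncl s p.1 ⬝ᵥ p.2.1 :=
    measurable_dotProduct (by fun_prop) (by fun_prop)
  fun_prop

theorem projX_expX_liftX {n : ℕ} {s k : Finset (Fin n)} (h : s = kᶜ) (b : (s → ℝ) × Vec n × ℝ)
    (u : k → ℝ) : projX s (expX (coordIncl k u) (liftX s b)) = b := by
  obtain ⟨a, y, t⟩ := b
  simp only [projX, expX, liftX, coordProj_incl_add h, add_dotProduct, Prod.mk.injEq, true_and]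
  ring

theorem expX_liftX_projX {n : ℕ} {s k : Finset (Fin n)} (h : s = kᶜ) (z : Heis n) :
    expX (coordIncl k (coordProj k z.1)) (liftX s (projX s z)) = z := by
  obtain ⟨x, y, t⟩ := z
  have h1 := coordIncl_proj_add h x
  simp only [projX, expX, liftX, h1, Prod.mk.injEq, true_and]
  conv_lhs => enter [1, 1, 2, 2, 1]; rw [← h1]
  rw [add_dotProduct]
  ring

/-- The fiber of `projX kᶜ` through `z`. -/
def sliceX {n : ℕ} (k : Finset (Fin n)) (A : Set (Heis n)) (z : Heis n) : Set (k → ℝ) :=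
  {u | expX (coordIncl k u) z ∈ A}

/-- The fiber of `projY kᶜ` through `z`. -/
def sliceY {n : ℕ} (k : Finset (Fin n)) (A : Set (Heis n)) (z : Heis n) : Set (k → ℝ) :=
  {u | expY (coordIncl k u) z ∈ A}

theorem measurable_expX_incl {n : ℕ} (k : Finset (Fin n)) :
    Measurable fun p : Heis n × (k → ℝ) => expX (coordIncl k p.2) p.1 :=
  measurable_expX.comp (((measurable_coordIncl k).comp measurable_snd).prodMk measurable_fst)

theorem measurable_volume_sliceX {n : ℕ} (k : Finset (Fin n)) {A : Set (Heis n)}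
    (hA : MeasurableSet A) : Measurable fun z => volume (sliceX k A z) :=
  measurable_measure_prodMk_left (measurable_expX_incl k hA)

theorem measurableSet_sliceX {n : ℕ} (k : Finset (Fin n)) {A : Set (Heis n)}
    (hA : MeasurableSet A) (z : Heis n) : MeasurableSet (sliceX k A z) :=
  ((measurable_expX_incl k).comp measurable_prodMk_left) hA

theorem volume_sliceX_expX {n : ℕ} (k : Finset (Fin n)) (A : Set (Heis n)) (z : Heis n)
    (u : k → ℝ) : volume (sliceX k A (expX (coordIncl k u) z)) = volume (sliceX k A z) := by
  have : sliceX k A (expX (coordIncl k u) z) = (fun v => u + v) ⁻¹' sliceX k A z := by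
    ext v
    simp only [sliceX, Set.mem_ofPred_eq, Set.mem_preimage, expX_expX, coordIncl_add]
  rw [this, measure_preimage_add]

theorem lintegral_shear {n : ℕ} {f : Heis n → ℝ≥0∞} (hf : Measurable f) :
    ∫⁻ z, f z = ∫⁻ x : Vec n, ∫⁻ p : Vec n × ℝ, f (x, p.1, p.2 - 1 / 2 * (x ⬝ᵥ p.1)) := by
  rw [Measure.volume_eq_prod, lintegral_prod _ hf.aemeasurable]
  refine lintegral_congr fun x => ?_
  have hm : Measurable fun p : Vec n × ℝ => f (x, p.1, p.2 - 1 / 2 * (x ⬝ᵥ p.1)) := by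
    have : Measurable fun p : Vec n × ℝ => x ⬝ᵥ p.1 :=
      measurable_dotProduct (by fun_prop) (by fun_prop)
    fun_prop
  have hm' : Measurable fun p : Vec n × ℝ => f (x, p) := by fun_prop
  rw [Measure.volume_eq_prod, lintegral_prod _ hm.aemeasurable,
    lintegral_prod _ hm'.aemeasurable]
  refine lintegral_congr fun y => ?_
  exact (lintegral_sub_right_eq_self (fun t => f (x, y, t)) (1 / 2 * (x ⬝ᵥ y))).symm

/-- Fubini on `ℍⁿ` along the fibers of `projX s`. -/
theorem lintegral_projX {n : ℕ} {s k : Finset (Fin n)} (h : s = kᶜ) {f : Heis n → ℝ≥0∞}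
    (hf : Measurable f) :
    ∫⁻ z, f z = ∫⁻ b, ∫⁻ u : k → ℝ, f (expX (coordIncl k u) (liftX s b)) := by
  have hI : Measurable fun p : (s → ℝ) × (k → ℝ) => coordIncl s p.1 + coordIncl k p.2 :=
    ((measurable_coordIncl s).comp measurable_fst).add ((measurable_coordIncl k).comp measurable_snd)
  have hm : Measurable fun q : Vec n × Vec n × ℝ =>
      f (q.1, q.2.1, q.2.2 - 1 / 2 * (q.1 ⬝ᵥ q.2.1)) := by
    have : Measurable fun q : Vec n × Vec n × ℝ => q.1 ⬝ᵥ q.2.1 :=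
      measurable_dotProduct (by fun_prop) (by fun_prop)
    fun_prop
  rw [lintegral_shear hf, lintegral_coord h hm.lintegral_prod_right']
  have hF : Measurable fun r : ((s → ℝ) × Vec n × ℝ) × (k → ℝ) =>
      f (expX (coordIncl k r.2) (liftX s r.1)) :=
    hf.comp ((measurable_expX_incl k).comp
      (((measurable_liftX s).comp measurable_fst).prodMk measurable_snd))
  rw [Measure.volume_eq_prod ((s → ℝ)), lintegral_prod _ hF.lintegral_prod_right'.aemeasurable]
  refine lintegral_congr fun a => ?_
  rw [lintegral_lintegral_swap]
  · refine lintegral_congr fun p => lintegral_congr fun u => ?_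
    congr 1
    simp only [expX, liftX, add_dotProduct, Prod.mk.injEq, true_and]
    ring
  · exact (hm.comp ((hI.comp (measurable_const.prodMk measurable_fst)).prodMk
      measurable_snd)).aemeasurable

theorem volume_eq_lintegral_sliceX {n : ℕ} {s k : Finset (Fin n)} (h : s = kᶜ) {A : Set (Heis n)}
    (hA : MeasurableSet A) : volume A = ∫⁻ b, volume (sliceX k A (liftX s b)) := by
  rw [← lintegral_indicator_one hA, lintegral_projX h (measurable_one.indicator hA)]
  refine lintegral_congr fun b => ?_
  rw [← lintegral_indicator_one (measurableSet_sliceX k hA _)]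
  rfl

theorem setLIntegral_le_mul_projX {n : ℕ} {s k : Finset (Fin n)} (h : s = kᶜ) {A : Set (Heis n)}
    (hA : MeasurableSet A) {f : Heis n → ℝ≥0∞} (hf : Measurable f) {τ : ℝ≥0∞}
    (hτ : ∀ z ∈ A, ∫⁻ u in sliceX k A z, f (expX (coordIncl k u) z) ≤ τ) :
    ∫⁻ z in A, f z ≤ τ * volume (projX s '' A) := by
  rw [← lintegral_indicator hA, lintegral_projX h (hf.indicator hA),
    ← measure_toMeasurable (projX s '' A), ← lintegral_indicator_const
      (measurableSet_toMeasurable _ _)]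
  refine lintegral_mono fun b => ?_
  have e : ∫⁻ u : k → ℝ, A.indicator f (expX (coordIncl k u) (liftX s b)) =
      ∫⁻ u in sliceX k A (liftX s b), f (expX (coordIncl k u) (liftX s b)) := by
    rw [← lintegral_indicator (measurableSet_sliceX k hA _)]
    rfl
  simp only [e]
  rcases Set.eq_empty_or_nonempty (sliceX k A (liftX s b)) with h0 | ⟨u, hu⟩
  · rw [h0]; simp
  · have hb : b ∈ toMeasurable volume (projX s '' A) :=
      subset_toMeasurable _ _ ⟨_, hu, projX_expX_liftX h b u⟩
    rw [Set.indicator_of_mem hb]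
    refine le_trans (le_of_eq ?_) (hτ _ hu)
    rw [← lintegral_indicator (measurableSet_sliceX k hA _),
      ← lintegral_indicator (measurableSet_sliceX k hA _),
      ← lintegral_add_left_eq_self _ u]
    refine lintegral_congr fun v => ?_
    have hiff : u + v ∈ sliceX k A (liftX s b) ↔
        v ∈ sliceX k A (expX (coordIncl k u) (liftX s b)) := by
      simp only [sliceX, Set.mem_ofPred_eq, expX_expX, coordIncl_add]
    by_cases hv : u + v ∈ sliceX k A (liftX s b)
    · rw [Set.indicator_of_mem hv, Set.indicator_of_mem (hiff.1 hv), expX_expX, coordIncl_add]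
    · rw [Set.indicator_of_notMem hv, Set.indicator_of_notMem (mt hiff.2 hv)]

theorem volume_le_mul_projX {n : ℕ} {s k : Finset (Fin n)} (h : s = kᶜ) {A : Set (Heis n)}
    (hA : MeasurableSet A) {τ : ℝ≥0∞} (hτ : ∀ z ∈ A, volume (sliceX k A z) ≤ τ) :
    volume A ≤ τ * volume (projX s '' A) := by
  have := setLIntegral_le_mul_projX h hA (f := fun _ => 1) measurable_const (τ := τ)
    (fun z hz => by simpa using hτ z hz)
  simpa using this

/-! ### Exchanging the roles of the two flows -/

/-- The map `(x, y, t) ↦ (y, x, -t)`. -/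
def swapH {n : ℕ} (z : Heis n) : Heis n := (z.2.1, z.1, -z.2.2)

theorem swapH_swapH {n : ℕ} (z : Heis n) : swapH (swapH z) = z := by simp [swapH]

theorem swapH_expY {n : ℕ} (s : Vec n) (z : Heis n) : swapH (expY s z) = expX s (swapH z) := by
  simp only [swapH, expY, expX, Prod.mk.injEq, true_and, dotProduct_comm s]
  ring

theorem swapH_expX {n : ℕ} (s : Vec n) (z : Heis n) : swapH (expX s z) = expY s (swapH z) := by
  rw [← swapH_swapH (expY s (swapH z)), swapH_expY, swapH_swapH]

theorem measurePreserving_swapH {n : ℕ} : MeasurePreserving (swapH (n := n)) volume volume := by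
  have h1 : MeasurePreserving (fun t : ℝ => -t) volume volume := Measure.measurePreserving_neg _
  have h2 : MeasurePreserving (MeasurableEquiv.prodAssoc : (Vec n × Vec n) × ℝ ≃ᵐ _)
      volume volume := volume_preserving_prodAssoc
  have h3 : MeasurePreserving (Prod.swap : Vec n × Vec n → _) volume volume :=
    Measure.measurePreserving_swap
  exact h2.comp ((h3.prod h1).comp h2.symm)

theorem sliceY_eq {n : ℕ} (k : Finset (Fin n)) (A : Set (Heis n)) (z : Heis n) :
    sliceY k A z = sliceX k (swapH ⁻¹' A) (swapH z) := by
  ext u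
  simp only [sliceY, sliceX, Set.mem_ofPred_eq, Set.mem_preimage, swapH_expX, swapH_swapH]

theorem volume_swapH_preimage {n : ℕ} {A : Set (Heis n)} (hA : MeasurableSet A) :
    volume (swapH ⁻¹' A) = volume A :=
  measurePreserving_swapH.measure_preimage hA.nullMeasurableSet

theorem volume_image_projY {n : ℕ} (s : Finset (Fin n)) (A : Set (Heis n)) :
    volume (projY s '' A) = volume (projX s '' (swapH ⁻¹' A)) := by
  have h1 : MeasurePreserving (fun t : ℝ => -t) volume volume := Measure.measurePreserving_neg _
  have h2 : MeasurePreserving (MeasurableEquiv.prodAssoc : ((s → ℝ) × Vec n) × ℝ ≃ᵐ _)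
      volume volume := volume_preserving_prodAssoc
  have h2' : MeasurePreserving (MeasurableEquiv.prodAssoc : (Vec n × (s → ℝ)) × ℝ ≃ᵐ _)
      volume volume := volume_preserving_prodAssoc
  have h3 : MeasurePreserving (Prod.swap : (s → ℝ) × Vec n → _) volume volume :=
    Measure.measurePreserving_swap
  let e : ((s → ℝ) × Vec n × ℝ) ≃ᵐ (Vec n × (s → ℝ) × ℝ) :=
    (MeasurableEquiv.prodAssoc.symm.trans
      ((MeasurableEquiv.prodComm (α := s → ℝ) (β := Vec n)).prodCongr
        (MeasurableEquiv.neg ℝ))).trans MeasurableEquiv.prodAssoc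
  have he : MeasurePreserving e volume volume :=
    h2'.comp ((h3.prod h1).comp h2.symm)
  rw [← he.measure_preimage_equiv (projY s '' A)]
  congr 1
  ext b
  simp only [Set.mem_preimage, Set.mem_image]
  have hp : ∀ w : Heis n, e (projX s (swapH w)) = projY s w := by
    intro w
    simp only [e, projX, projY, swapH]
    simp only [MeasurableEquiv.trans_apply]
    change (w.1, coordProj s w.2.1, -(-w.2.2 + 1 / 2 * (w.2.1 ⬝ᵥ w.1))) = _
    rw [dotProduct_comm w.2.1 w.1]
    simp only [Prod.mk.injEq, true_and]
    ring
  constructor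
  · rintro ⟨w, hw, hwb⟩
    refine ⟨swapH w, by simpa [swapH_swapH] using hw, ?_⟩
    apply e.injective
    rw [hp, hwb]
  · rintro ⟨w, hw, rfl⟩
    refine ⟨swapH w, hw, ?_⟩
    rw [← hp, swapH_swapH]

end

section

theorem sliceX_mono {n : ℕ} (k : Finset (Fin n)) {A B : Set (Heis n)} (h : A ⊆ B) (z : Heis n) :
    sliceX k A z ⊆ sliceX k B z := fun _ hu => h hu

theorem sliceY_mono {n : ℕ} (k : Finset (Fin n)) {A B : Set (Heis n)} (h : A ⊆ B) (z : Heis n) :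
    sliceY k A z ⊆ sliceY k B z := fun _ hu => h hu

theorem isBounded_sliceX {n : ℕ} (k : Finset (Fin n)) {A : Set (Heis n)}
    (hA : Bornology.IsBounded A) (z : Heis n) : Bornology.IsBounded (sliceX k A z) := by
  obtain ⟨R, hR⟩ := hA.exists_norm_le
  refine (isBounded_iff_forall_norm_le).2 ⟨R + ‖z.1‖, fun u hu => ?_⟩
  have h1 : ‖(expX (coordIncl k u) z).1‖ ≤ R := (norm_fst_le _).trans (hR _ hu)
  have h2 : ‖coordIncl k u‖ ≤ R + ‖z.1‖ := by
    have : coordIncl k u = (expX (coordIncl k u) z).1 - z.1 := by simp [expX]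
    rw [this]
    exact (norm_sub_le _ _).trans (by gcongr)
  have h0 : 0 ≤ R + ‖z.1‖ := (norm_nonneg _).trans h2
  refine (pi_norm_le_iff_of_nonneg h0).2 fun i => ?_
  have := (norm_le_pi_norm (coordIncl k u) i).trans h2
  simpa [coordIncl] using this

theorem volume_sliceX_ne_top {n : ℕ} (k : Finset (Fin n)) {A : Set (Heis n)}
    (hA : Bornology.IsBounded A) (z : Heis n) : volume (sliceX k A z) ≠ ∞ :=
  (isBounded_sliceX k hA z).measure_lt_top.ne

/-- A set is refined so that all its fibers along finitely many projections are large. -/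
theorem exists_refinement_sliceX {n : ℕ} {ι : Type*} [Fintype ι] (k : ι → Finset (Fin n))
    {A : Set (Heis n)} (hA : MeasurableSet A) (hb : Bornology.IsBounded A)
    (τ : ι → Heis n → ℝ≥0∞) (hτ : ∀ i, Measurable (τ i))
    (hinv : ∀ i z u, τ i (expX (coordIncl (k i) u) z) = τ i z) (η : ι → ℝ≥0∞)
    (hη : ∀ i D, MeasurableSet D → D ⊆ A → (∀ z ∈ D, volume (sliceX (k i) D z) ≤ τ i z) →
      volume D ≤ η i) :
    ∃ B ⊆ A, MeasurableSet B ∧ (∀ i, ∀ z ∈ B, τ i z ≤ volume (sliceX (k i) B z)) ∧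
      volume A ≤ volume B + ∑ i, η i := by
  let S : ℕ → Set (Heis n) := fun l => Nat.rec A
    (fun _ T => T ∩ {z | ∀ i, τ i z ≤ volume (sliceX (k i) T z)}) l
  have hS : ∀ l, S (l + 1) = S l ∩ {z | ∀ i, τ i z ≤ volume (sliceX (k i) (S l) z)} :=
    fun l => rfl
  have hSm : ∀ l, MeasurableSet (S l) := by
    intro l
    induction l with
    | zero => exact hA
    | succ l ih =>
      rw [hS]
      refine ih.inter ?_
      have : {z | ∀ i, τ i z ≤ volume (sliceX (k i) (S l) z)} =
          ⋂ i, {z | τ i z ≤ volume (sliceX (k i) (S l) z)} := by ext; simp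
      rw [this]
      exact MeasurableSet.iInter fun i =>
        measurableSet_le (hτ i) (measurable_volume_sliceX (k i) ih)
  have hanti : Antitone S := antitone_nat_of_succ_le fun l => by
    rw [hS]; exact Set.inter_subset_left
  have hSA : ∀ l, S l ⊆ A := fun l => hanti (Nat.zero_le l)
  let D : ι → Set (Heis n) := fun i => ⋃ l, S l ∩ {z | volume (sliceX (k i) (S l) z) < τ i z}
  have hDm : ∀ i, MeasurableSet (D i) := fun i => MeasurableSet.iUnion fun l =>
    (hSm l).inter (measurableSet_lt (measurable_volume_sliceX (k i) (hSm l)) (hτ i))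
  have hDA : ∀ i, D i ⊆ A := fun i => Set.iUnion_subset fun l => Set.inter_subset_left.trans (hSA l)
  have hDs : ∀ i, ∀ z ∈ D i, volume (sliceX (k i) (D i) z) ≤ τ i z := by
    classical
    intro i z hz
    obtain ⟨l0, hl0⟩ := Set.mem_iUnion.1 hz
    have hex : ∃ l, volume (sliceX (k i) (S l) z) < τ i z := ⟨l0, hl0.2⟩
    refine le_trans (measure_mono ?_) (Nat.find_spec hex).le
    intro u hu
    obtain ⟨l, hl1, hl2⟩ := Set.mem_iUnion.1 (show expX (coordIncl (k i) u) z ∈ D i from hu)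
    simp only [Set.mem_ofPred_eq] at hl2
    rw [volume_sliceX_expX, hinv] at hl2
    exact hanti (Nat.find_min' hex hl2) hl1
  have hsub : A ⊆ (⋂ l, S l) ∪ ⋃ i, D i := by
    intro z hz
    by_contra hcon
    simp only [Set.mem_union, not_or, Set.mem_iInter, not_forall] at hcon
    obtain ⟨⟨l, hl⟩, hD⟩ := hcon
    have : ∀ l, z ∈ S l := by
      intro l
      induction l with
      | zero => exact hz
      | succ l ih =>
        rw [hS]
        refine ⟨ih, fun i => ?_⟩
        by_contra hlt
        exact hD (Set.mem_iUnion.2 ⟨i, Set.mem_iUnion.2 ⟨l, ih, not_le.1 hlt⟩⟩)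
    exact hl (this l)
  refine ⟨⋂ l, S l, Set.iInter_subset_of_subset 0 (hSA 0), MeasurableSet.iInter hSm, ?_, ?_⟩
  · intro i z hz
    have e : sliceX (k i) (⋂ l, S l) z = ⋂ l, sliceX (k i) (S l) z := by
      ext u; simp [sliceX]
    rw [e, Antitone.measure_iInter (fun a b hab => sliceX_mono _ (hanti hab) z)
      (fun l => (measurableSet_sliceX _ (hSm l) z).nullMeasurableSet)
      ⟨0, volume_sliceX_ne_top _ (hb.subset (hSA 0)) z⟩]
    refine le_iInf fun l => ?_
    have h1 : z ∈ S (l + 1) := Set.mem_iInter.1 hz (l + 1)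
    rw [hS] at h1
    exact h1.2 i
  · calc volume A ≤ volume ((⋂ l, S l) ∪ ⋃ i, D i) := measure_mono hsub
      _ ≤ volume (⋂ l, S l) + volume (⋃ i, D i) := measure_union_le _ _
      _ ≤ volume (⋂ l, S l) + ∑ i, η i := by
        gcongr
        refine (measure_iUnion_fintype_le _ _).trans (Finset.sum_le_sum fun i _ => ?_)
        exact hη i _ (hDm i) (hDA i) (hDs i)

theorem volume_le_mul_of_sliceX_le {n : ℕ} (k : Finset (Fin n)) {A D : Set (Heis n)}
    (hA : MeasurableSet A) (hD : MeasurableSet D) (c : ℝ≥0∞)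
    (h : ∀ z ∈ D, volume (sliceX k D z) ≤ c * volume (sliceX k A z)) :
    volume D ≤ c * volume A := by
  rw [volume_eq_lintegral_sliceX (s := kᶜ) rfl hA, volume_eq_lintegral_sliceX (s := kᶜ) rfl hD,
    ← lintegral_const_mul c (f := fun b => volume (sliceX k A (liftX kᶜ b)))
      ((measurable_volume_sliceX k hA).comp (measurable_liftX _))]
  refine lintegral_mono fun b => ?_
  rcases Set.eq_empty_or_nonempty (sliceX k D (liftX kᶜ b)) with h0 | ⟨u, hu⟩
  · rw [h0]; simp
  · have := h _ hu
    rwa [volume_sliceX_expX, volume_sliceX_expX] at this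

/-! ### Versions for the other flow -/

theorem measurable_swapH {n : ℕ} : Measurable (swapH (n := n)) := measurePreserving_swapH.measurable

theorem isBounded_swapH_preimage {n : ℕ} {A : Set (Heis n)} (hA : Bornology.IsBounded A) :
    Bornology.IsBounded (swapH ⁻¹' A) := by
  obtain ⟨R, hR⟩ := hA.exists_norm_le
  refine (isBounded_iff_forall_norm_le).2 ⟨R, fun z hz => ?_⟩
  have := hR _ hz
  simp only [swapH, Prod.norm_def, norm_neg] at this ⊢
  rwa [max_left_comm] at this

theorem isBounded_sliceY {n : ℕ} (k : Finset (Fin n)) {A : Set (Heis n)}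
    (hA : Bornology.IsBounded A) (z : Heis n) : Bornology.IsBounded (sliceY k A z) := by
  rw [sliceY_eq]; exact isBounded_sliceX k (isBounded_swapH_preimage hA) _

theorem volume_sliceY_ne_top {n : ℕ} (k : Finset (Fin n)) {A : Set (Heis n)}
    (hA : Bornology.IsBounded A) (z : Heis n) : volume (sliceY k A z) ≠ ∞ :=
  (isBounded_sliceY k hA z).measure_lt_top.ne

theorem measurable_volume_sliceY {n : ℕ} (k : Finset (Fin n)) {A : Set (Heis n)}
    (hA : MeasurableSet A) : Measurable fun z => volume (sliceY k A z) := by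
  simp only [sliceY_eq]
  exact (measurable_volume_sliceX k (measurable_swapH hA)).comp measurable_swapH

theorem volume_le_mul_of_sliceY_le {n : ℕ} (k : Finset (Fin n)) {A D : Set (Heis n)}
    (hA : MeasurableSet A) (hD : MeasurableSet D) (c : ℝ≥0∞)
    (h : ∀ z ∈ D, volume (sliceY k D z) ≤ c * volume (sliceY k A z)) :
    volume D ≤ c * volume A := by
  rw [← volume_swapH_preimage hA, ← volume_swapH_preimage hD]
  refine volume_le_mul_of_sliceX_le k (measurable_swapH hA) (measurable_swapH hD) c fun z hz => ?_
  have := h _ hz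
  rwa [sliceY_eq, sliceY_eq, swapH_swapH] at this

/-! ### Full fibers -/

theorem lintegral_coordIncl_univ {n : ℕ} {k : Finset (Fin n)} (hk : k = univ) {f : Vec n → ℝ≥0∞}
    (hf : Measurable f) : ∫⁻ u : k → ℝ, f (coordIncl k u) = ∫⁻ x, f x := by
  subst hk
  rw [lintegral_coord (s := ∅) (k := univ) (by simp) hf]
  have h0 : ∀ a : (∅ : Finset (Fin n)) → ℝ, coordIncl ∅ a = 0 := by
    intro a; ext i; simp [coordIncl]
  simp only [h0, zero_add, lintegral_const]
  have : (volume : Measure ((∅ : Finset (Fin n)) → ℝ)) Set.univ = 1 := by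
    rw [volume_pi, ← Set.pi_univ Set.univ, Measure.pi_pi]
    simp
  rw [this, mul_one]

theorem volume_sliceX_of_eq_univ {n : ℕ} {k : Finset (Fin n)} (hk : k = univ) {A : Set (Heis n)}
    (hA : MeasurableSet A) (z : Heis n) : volume (sliceX k A z) = volume (fibX A z) := by
  have hm : MeasurableSet (fibX A z) :=
    (measurable_expX.comp (measurable_id.prodMk measurable_const)) hA
  rw [← lintegral_indicator_one (measurableSet_sliceX k hA z), ← lintegral_indicator_one hm,
    ← lintegral_coordIncl_univ hk (measurable_one.indicator hm)]
  rfl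

theorem measurableSet_fibX {n : ℕ} {A : Set (Heis n)} (hA : MeasurableSet A) (z : Heis n) :
    MeasurableSet (fibX A z) := (measurable_expX.comp (measurable_id.prodMk measurable_const)) hA

theorem measurableSet_fibY {n : ℕ} {A : Set (Heis n)} (hA : MeasurableSet A) (z : Heis n) :
    MeasurableSet (fibY A z) := (measurable_expY.comp (measurable_id.prodMk measurable_const)) hA

theorem fibY_eq {n : ℕ} (A : Set (Heis n)) (z : Heis n) :
    fibY A z = fibX (swapH ⁻¹' A) (swapH z) := by
  ext u
  simp only [fibY, fibX, Set.mem_ofPred_eq, Set.mem_preimage, swapH_expX, swapH_swapH]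

theorem volume_sliceY_of_eq_univ {n : ℕ} {k : Finset (Fin n)} (hk : k = univ) {A : Set (Heis n)}
    (hA : MeasurableSet A) (z : Heis n) : volume (sliceY k A z) = volume (fibY A z) := by
  rw [sliceY_eq, fibY_eq, volume_sliceX_of_eq_univ hk (measurable_swapH hA)]

theorem isBounded_fibX {n : ℕ} {A : Set (Heis n)}
    (hA : Bornology.IsBounded A) (z : Heis n) : Bornology.IsBounded (fibX A z) := by
  obtain ⟨R, hR⟩ := hA.exists_norm_le
  refine (isBounded_iff_forall_norm_le).2 ⟨R + ‖z.1‖, fun u hu => ?_⟩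
  have h1 : ‖(expX u z).1‖ ≤ R := (norm_fst_le _).trans (hR _ hu)
  have : u = (expX u z).1 - z.1 := by simp [expX]
  rw [this]
  exact (norm_sub_le _ _).trans (by gcongr)

theorem isBounded_fibY {n : ℕ} {A : Set (Heis n)}
    (hA : Bornology.IsBounded A) (z : Heis n) : Bornology.IsBounded (fibY A z) := by
  rw [fibY_eq]; exact isBounded_fibX (isBounded_swapH_preimage hA) _

/-- The fibers of `coordProj` in a fiber of `Ω` are fibers of `Ω`. -/
theorem setOf_add_mem_fibX {n : ℕ} (k : Finset (Fin n)) (A : Set (Heis n)) (z : Heis n)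
    (x : Vec n) : {u : k → ℝ | x + coordIncl k u ∈ fibX A z} = sliceX k A (expX x z) := by
  ext u; simp only [fibX, sliceX, Set.mem_ofPred_eq, expX_expX]

theorem setOf_add_mem_fibY {n : ℕ} (k : Finset (Fin n)) (A : Set (Heis n)) (z : Heis n)
    (x : Vec n) : {u : k → ℝ | x + coordIncl k u ∈ fibY A z} = sliceY k A (expY x z) := by
  ext u; simp only [fibY, sliceY, Set.mem_ofPred_eq, expY_expY]

end

section

theorem lmarginal_update_of_dependsOn {n : ℕ} {W s : Finset (Fin n)} {g : Vec n → ℝ≥0∞}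
    (hg : ∀ x y : Vec n, (∀ i ∈ W, x i = y i) → g x = g y) {a : Fin n} (ha : a ∉ W)
    (x : Vec n) (y : ℝ) :
    (∫⋯∫⁻_s, g) (Function.update x a y) = (∫⋯∫⁻_s, g) x := by
  unfold lmarginal
  refine lintegral_congr fun u => hg _ _ fun i hi => ?_
  have : i ≠ a := fun h => ha (h ▸ hi)
  by_cases his : i ∈ s <;> simp [Function.updateFinset, his, this]

theorem exists_ne_zero_of_lmarginal_ne_zero {n : ℕ} {s : Finset (Fin n)} {f : Vec n → ℝ≥0∞}
    {x : Vec n} (h : (∫⋯∫⁻_s, f) x ≠ 0) : ∃ v, f v ≠ 0 ∧ ∀ i ∉ s, v i = x i := by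
  by_contra hcon
  push Not at hcon
  apply h
  unfold lmarginal
  rw [← lintegral_zero (μ := Measure.pi fun i : s => (volume : Measure ℝ))]
  refine lintegral_congr fun u => ?_
  by_contra hne
  obtain ⟨i, hi, hi'⟩ := hcon _ hne
  simp [Function.updateFinset, hi] at hi'

theorem volume_setOf_add_coordIncl {n : ℕ} (k : Finset (Fin n)) {A : Set (Vec n)}
    (hA : MeasurableSet A) (x : Vec n) :
    volume {u : k → ℝ | x + coordIncl k u ∈ A} = (∫⋯∫⁻_k, A.indicator 1) x := by
  have e : {u : k → ℝ | x + coordIncl k u ∈ A} =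
      (fun u => coordProj k x + u) ⁻¹' {u | Function.updateFinset x k u ∈ A} := by
    ext u
    simp only [Set.mem_ofPred_eq, Set.mem_preimage]
    have : x + coordIncl k u = Function.updateFinset x k (coordProj k x + u) := by
      ext i; by_cases hi : i ∈ k <;> simp [Function.updateFinset, coordIncl, coordProj, hi]
    rw [this]
  have hm : Measurable fun u : k → ℝ => Function.updateFinset x k u := measurable_updateFinset
  have hA' : MeasurableSet {u : k → ℝ | Function.updateFinset x k u ∈ A} := hm hA
  rw [e, measure_preimage_add, ← lintegral_indicator_one hA']
  rfl

theorem volume_le_of_edist_le {B : Set ℝ} {L : ℝ≥0∞} (h : ∀ a ∈ B, ∀ b ∈ B, edist a b ≤ L) :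
    volume B ≤ L := (Real.volume_le_diam B).trans (Metric.ediam_le h)

/-- The volume of the coordinate sections of a set whose coordinates, in some order, are
determined up to bounded errors by the preceding ones. -/
theorem lmarginal_indicator_le_prod {n : ℕ} (rk : Fin n → ℕ) {A : Set (Vec n)}
    (hA : MeasurableSet A) (L : Fin n → ℝ≥0∞) (s : Finset (Fin n))
    (h : ∀ v ∈ A, ∀ v' ∈ A, ∀ i ∈ s, (∀ j ∉ s, v j = v' j) →
      (∀ j ∈ s, rk j < rk i → v j = v' j) → edist (v i) (v' i) ≤ L i) (x : Vec n) :
    (∫⋯∫⁻_s, A.indicator 1) x ≤ ∏ i ∈ s, L i := by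
  have hm : Measurable (A.indicator (1 : Vec n → ℝ≥0∞)) := measurable_one.indicator hA
  induction s using Finset.induction_on_min_value rk generalizing x with
  | empty =>
    simp only [lmarginal_empty, prod_empty]
    exact Set.indicator_le_self' (fun _ _ => zero_le) x
  | insert a s has hmin ih =>
    rw [lmarginal_insert _ hm has, Finset.prod_insert has]
    have ih' := ih (fun v hv v' hv' i hi h1 h2 => h v hv v' hv' i (mem_insert_of_mem hi)
      (fun j hj => h1 j fun hjs => hj (mem_insert_of_mem hjs)) (fun j hj hlt => by
        rcases mem_insert.1 hj with rfl | hj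
        · exact h1 j has
        · exact h2 j hj hlt))
    set B : Set ℝ := {y | (∫⋯∫⁻_s, A.indicator 1) (Function.update x a y) ≠ 0} with hB
    have hBL : volume B ≤ L a := by
      refine volume_le_of_edist_le fun y hy y' hy' => ?_
      obtain ⟨v, hv, hvx⟩ := exists_ne_zero_of_lmarginal_ne_zero hy
      obtain ⟨v', hv', hvx'⟩ := exists_ne_zero_of_lmarginal_ne_zero hy'
      have := h v (by by_contra hc; simp [hc] at hv) v' (by by_contra hc; simp [hc] at hv') a
        (mem_insert_self _ _) (fun j hj => by
          rw [mem_insert, not_or] at hj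
          rw [hvx j hj.2, hvx' j hj.2]; simp [hj.1]) (fun j hj hlt => by
          rcases mem_insert.1 hj with rfl | hj
          · exact absurd hlt (lt_irrefl _)
          · exact absurd hlt (not_lt.2 (hmin j hj)))
      rw [hvx a has, hvx' a has] at this
      simpa using this
    calc ∫⁻ y, (∫⋯∫⁻_s, A.indicator 1) (Function.update x a y)
        ≤ ∫⁻ y, (toMeasurable volume B).indicator (fun _ => ∏ i ∈ s, L i) y := by
          refine lintegral_mono fun y => ?_
          by_cases hy : y ∈ B
          · rw [Set.indicator_of_mem (subset_toMeasurable _ _ hy)]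
            exact ih' _
          · have : (∫⋯∫⁻_s, A.indicator 1) (Function.update x a y) = 0 := by
              simpa [hB] using hy
            rw [this]; exact zero_le
      _ = (∏ i ∈ s, L i) * volume B := by
          rw [lintegral_indicator_const (measurableSet_toMeasurable _ _), measure_toMeasurable]
      _ ≤ L a * ∏ i ∈ s, L i := by rw [mul_comm]; gcongr

/-- Finner's inequality with weights `p j` on the coordinate projections onto `W j` and `r i` on
slabs that bound the `i`-th coordinate in terms of the preceding ones. -/
theorem lmarginal_le_prod_rpow {n : ℕ} {ι : Type*} [Fintype ι] (rk : Fin n → ℕ)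
    (hrk : Function.Injective rk)
    (W : ι → Finset (Fin n)) (g : ι → Vec n → ℝ≥0∞) (hgm : ∀ j, Measurable (g j))
    (hg : ∀ j, ∀ x y : Vec n, (∀ i ∈ W j, x i = y i) → g j x = g j y)
    (p : ι → ℝ) (hp : ∀ j, 0 ≤ p j) (r : Fin n → ℝ) (hr : ∀ i, 0 ≤ r i)
    (P : Fin n → Set (Vec n)) (L : Fin n → ℝ≥0∞)
    (hP : ∀ i, ∀ v ∈ P i, ∀ v', (∀ j, rk j ≤ rk i → v j = v' j) → v' ∈ P i)
    (hL : ∀ i, ∀ v ∈ P i, ∀ v' ∈ P i, (∀ j, j ≠ i → v j = v' j) → edist (v i) (v' i) ≤ L i)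
    {f : Vec n → ℝ≥0∞} (hf : Measurable f) (hfg : ∀ v, f v ≤ ∏ j, g j v ^ p j)
    (s : Finset (Fin n)) (hfP : ∀ i ∈ s, ∀ v, f v ≠ 0 → v ∈ P i)
    (hsum : ∀ i ∈ s, r i + ∑ j with i ∈ W j, p j = 1) (x : Vec n) :
    (∫⋯∫⁻_s, f) x ≤ (∏ i ∈ s, L i ^ r i) * ∏ j, ((∫⋯∫⁻_(s ∩ W j), g j) x) ^ p j := by
  induction s using Finset.induction_on_min_value rk generalizing x with
  | empty => simpa using hfg x
  | insert a s has hmin ih =>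
    have ih' := ih (fun i hi => hfP i (mem_insert_of_mem hi))
      (fun i hi => hsum i (mem_insert_of_mem hi))
    rw [lmarginal_insert _ hf has, Finset.prod_insert has]
    set G : ι → Vec n → ℝ≥0∞ := fun j => ∫⋯∫⁻_(s ∩ W j), g j with hG
    have hGm : ∀ j, Measurable (G j) := fun j => (hgm j).lmarginal _
    set B : Set ℝ := {y | Function.update x a y ∈ P a} with hB
    set B' := toMeasurable volume B
    have hBL : volume B' ≤ L a := by
      rw [measure_toMeasurable]
      refine volume_le_of_edist_le fun y hy y' hy' => ?_
      have := hL a _ hy _ hy' (fun j hj => by simp [hj])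
      simpa using this
    have hstep1 : ∀ y, (∫⋯∫⁻_s, f) (Function.update x a y) ≤
        (∏ i ∈ s, L i ^ r i) * ((∏ j with a ∉ W j, G j x ^ p j) *
          ((B'.indicator 1 y) ^ r a * ∏ j with a ∈ W j, G j (Function.update x a y) ^ p j)) := by
      intro y
      by_cases hy : (∫⋯∫⁻_s, f) (Function.update x a y) = 0
      · rw [hy]; exact zero_le
      · obtain ⟨v, hv, hvx⟩ := exists_ne_zero_of_lmarginal_ne_zero hy
        have hyB : y ∈ B := by
          refine hP a v (hfP a (mem_insert_self _ _) v hv) _ fun j hj => hvx j fun hjs => ?_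
          have := hrk (le_antisymm hj (hmin j hjs))
          exact has (this ▸ hjs)
        rw [Set.indicator_of_mem (subset_toMeasurable _ _ hyB)]
        refine (ih' _).trans (le_of_eq ?_)
        rw [← Finset.prod_filter_not_mul_prod_filter univ (fun j => a ∈ W j)]
        simp only [Pi.one_apply, ENNReal.one_rpow, one_mul]
        congr 2
        refine Finset.prod_congr rfl fun j hj => ?_
        rw [hG]
        simp only
        rw [lmarginal_update_of_dependsOn (hg j) (by simpa using hj)]
    have hin : ∀ j, a ∉ W j → insert a s ∩ W j = s ∩ W j := fun j hj =>
      Finset.insert_inter_of_notMem hj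
    have hin' : ∀ j, a ∈ W j → insert a s ∩ W j = insert a (s ∩ W j) := fun j hj =>
      Finset.insert_inter_of_mem hj
    have hupd : Measurable fun y => Function.update x a y := measurable_update x
    have hmB : Measurable (B'.indicator (1 : ℝ → ℝ≥0∞)) :=
      measurable_one.indicator (measurableSet_toMeasurable _ _)
    have hholder : ∫⁻ y, (B'.indicator 1 y) ^ r a *
        ∏ j with a ∈ W j, G j (Function.update x a y) ^ p j ≤
        (volume B') ^ r a * ∏ j with a ∈ W j, (∫⁻ y, G j (Function.update x a y)) ^ p j := by
      have := ENNReal.lintegral_prod_norm_pow_le (μ := (volume : Measure ℝ))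
        (Finset.insertNone (univ.filter fun j => a ∈ W j))
        (f := fun o y => o.elim (B'.indicator 1 y) fun j => G j (Function.update x a y))
        (p := fun o => o.elim (r a) p) (fun o _ => by
          cases o with
          | none => exact hmB.aemeasurable
          | some j => exact ((hGm j).comp hupd).aemeasurable)
        (by rw [Finset.sum_insertNone]; exact hsum a (mem_insert_self _ _))
        (fun o _ => by cases o with
          | none => exact hr a
          | some j => exact hp j)
      simp only [Finset.prod_insertNone, Option.elim] at this
      rwa [lintegral_indicator_one (measurableSet_toMeasurable _ _)] at this
    have hmm : Measurable fun y => (B'.indicator 1 y) ^ r a *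
        ∏ j with a ∈ W j, G j (Function.update x a y) ^ p j :=
      (hmB.pow_const _).mul (Finset.measurable_prod _ fun j _ =>
        ((hGm j).comp hupd).pow_const _)
    calc ∫⁻ y, (∫⋯∫⁻_s, f) (Function.update x a y) ≤ _ := lintegral_mono hstep1
      _ = (∏ i ∈ s, L i ^ r i) * ((∏ j with a ∉ W j, G j x ^ p j) *
          ∫⁻ y, ((B'.indicator 1 y) ^ r a *
            ∏ j with a ∈ W j, G j (Function.update x a y) ^ p j)) := by
        rw [lintegral_const_mul _ (hmm.const_mul _), lintegral_const_mul _ hmm]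
      _ ≤ (∏ i ∈ s, L i ^ r i) * ((∏ j with a ∉ W j, G j x ^ p j) *
          (L a ^ r a * ∏ j with a ∈ W j, (∫⁻ y, G j (Function.update x a y)) ^ p j)) := by
        gcongr
        refine hholder.trans ?_
        gcongr
        exact hr a
      _ = _ := by
        rw [← Finset.prod_filter_not_mul_prod_filter univ (fun j => a ∈ W j)
          (fun j => ((∫⋯∫⁻_(insert a s ∩ W j), g j) x) ^ p j)]
        have e1 : ∏ j with a ∉ W j, ((∫⋯∫⁻_(insert a s ∩ W j), g j) x) ^ p j =
            ∏ j with a ∉ W j, G j x ^ p j :=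
          Finset.prod_congr rfl fun j hj => by rw [hin j (by simpa using hj)]
        have e2 : ∏ j with a ∈ W j, ((∫⋯∫⁻_(insert a s ∩ W j), g j) x) ^ p j =
            ∏ j with a ∈ W j, (∫⁻ y, G j (Function.update x a y)) ^ p j :=
          Finset.prod_congr rfl fun j hj => by
            rw [hin' j (by simpa using hj), lmarginal_insert _ (hgm j) (by simp [has])]
        rw [e1, e2]
        ring

end

section

/-- A linear form whose leading coefficient, with respect to the order given by `rk`, is the `i`-th
one, which is normalized to `1`. -/
def triForm {n : ℕ} (rk : Fin n → ℕ) (c : Fin n → ℝ) (i : Fin n) (v : Vec n) : ℝ :=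
  v i - ∑ j with rk j < rk i, c j * v j

theorem triForm_sub {n : ℕ} (rk : Fin n → ℕ) (c : Fin n → ℝ) (i : Fin n) (v w : Vec n) :
    triForm rk c i (v - w) = triForm rk c i v - triForm rk c i w := by
  simp only [triForm, Pi.sub_apply, mul_sub, Finset.sum_sub_distrib]; ring

theorem continuous_triForm {n : ℕ} (rk : Fin n → ℕ) (c : Fin n → ℝ) (i : Fin n) :
    Continuous (triForm rk c i) := by
  unfold triForm; fun_prop

theorem triForm_eq_of_forall_lt {n : ℕ} {rk : Fin n → ℕ} {c : Fin n → ℝ} {i : Fin n} {v : Vec n}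
    (h : ∀ j, rk j < rk i → v j = 0) : triForm rk c i v = v i := by
  rw [triForm, Finset.sum_eq_zero, sub_zero]
  intro j hj
  rw [h j (by simpa using hj), mul_zero]

theorem volume_slab_le {n : ℕ} (rk : Fin n → ℕ) (c : Fin n → ℝ) (i : Fin n) {F : Set (Vec n)}
    (hF : MeasurableSet F) {R : ℝ} (hR : ∀ v ∈ F, ‖v‖ ≤ R) (h : ℝ) :
    volume (F ∩ {v | |triForm rk c i v| ≤ h}) ≤
      ENNReal.ofReal (2 * h) * ENNReal.ofReal (2 * R) ^ (n - 1) := by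
  have hm : MeasurableSet (F ∩ {v | |triForm rk c i v| ≤ h}) :=
    hF.inter (measurableSet_le (continuous_triForm rk c i).abs.measurable measurable_const)
  have := lmarginal_indicator_le_prod rk hm
    (fun j => if j = i then ENNReal.ofReal (2 * h) else ENNReal.ofReal (2 * R)) univ
    (fun v hv v' hv' j _ _ hlt => by
      by_cases hj : j = i
      · subst hj
        simp only [if_true]
        rw [edist_dist, Real.dist_eq]
        refine ENNReal.ofReal_le_ofReal ?_
        have e : v j - v' j = triForm rk c j v - triForm rk c j v' := by
          rw [← triForm_sub, triForm_eq_of_forall_lt]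
          · rfl
          · intro l hl; simp [hlt l (mem_univ _) hl]
        rw [e]
        have h1 : |triForm rk c j v| ≤ h := hv.2
        have h2 : |triForm rk c j v'| ≤ h := hv'.2
        rw [abs_le] at *
        constructor <;> linarith
      · simp only [hj, if_false]
        rw [edist_dist, Real.dist_eq]
        refine ENNReal.ofReal_le_ofReal ?_
        have h1 := (norm_le_pi_norm v j).trans (hR v hv.1)
        have h2 := (norm_le_pi_norm v' j).trans (hR v' hv'.1)
        rw [Real.norm_eq_abs, abs_le] at h1 h2
        rw [abs_le]
        constructor <;> linarith) 0
  rw [lmarginal_univ, lintegral_indicator_one hm] at this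
  refine this.trans (le_of_eq ?_)
  rw [← Finset.mul_prod_erase _ _ (mem_univ i), if_pos rfl, Finset.prod_congr rfl
    (g := fun _ => ENNReal.ofReal (2 * R)) (fun j hj => if_neg (Finset.ne_of_mem_erase hj)),
    Finset.prod_const, Finset.card_erase_of_mem (mem_univ i), Finset.card_univ, Fintype.card_fin]

/-- For some threshold `h`, some normalized form is `O(h)` on most of `F`, and all have average
`≳ h` on `F`. -/
theorem exists_triForm_threshold {n : ℕ} (rk : Fin n → ℕ) (i : Fin n) {F : Set (Vec n)}
    (hF : MeasurableSet F) (hb : Bornology.IsBounded F) (h0 : volume F ≠ 0) {η : ℝ≥0∞}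
    (hη : η < 1) :
    ∃ (h : ℝ) (c : Fin n → ℝ), 0 < h ∧
      volume (F ∩ {v | 4 * h < |triForm rk c i v|}) ≤ η * volume F ∧
      ∀ c', ENNReal.ofReal h * (η * volume F) ≤
        ∫⁻ v in F, ENNReal.ofReal |triForm rk c' i v| := by
  obtain ⟨R, hR⟩ := hb.exists_norm_le
  have hFt : volume F ≠ ∞ := hb.measure_lt_top.ne
  have hηt : η ≠ ∞ := hη.ne_top
  let S : Set ℝ := {h | 0 < h ∧ ∃ c, volume (F ∩ {v | h < |triForm rk c i v|}) ≤ η * volume F}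
  have hmeas : ∀ c h, MeasurableSet {v | h < |triForm rk c i v|} := fun c h =>
    measurableSet_lt measurable_const (continuous_triForm rk c i).abs.measurable
  have hne : S.Nonempty := by
    refine ⟨|R| + 1, by positivity, 0, ?_⟩
    have : F ∩ {v | |R| + 1 < |triForm rk 0 i v|} = ∅ := by
      ext v
      simp only [Set.mem_inter_iff, Set.mem_ofPred_eq, Set.mem_empty_iff_false, iff_false, not_and,
        not_lt]
      intro hv
      have h1 := (norm_le_pi_norm v i).trans (hR v hv)
      rw [Real.norm_eq_abs] at h1
      simp only [triForm, Pi.zero_apply, zero_mul, Finset.sum_const_zero, sub_zero]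
      linarith [le_abs_self R]
    rw [this]; simp
  obtain ⟨δ, hδ, hδS⟩ : ∃ δ : ℝ, 0 < δ ∧ ∀ h ∈ S, δ ≤ h := by
    have hcont : Filter.Tendsto (fun h : ℝ => ENNReal.ofReal (2 * h) *
        ENNReal.ofReal (2 * R) ^ (n - 1)) (nhds 0) (nhds 0) := by
      have : Filter.Tendsto (fun h : ℝ => ENNReal.ofReal (2 * h)) (nhds 0) (nhds 0) := by
        have := ENNReal.tendsto_ofReal (Filter.Tendsto.const_mul (2 : ℝ)
          (Filter.tendsto_id (α := ℝ) (x := nhds 0)))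
        simpa using this
      have h2 := ENNReal.Tendsto.mul_const (b := ENNReal.ofReal (2 * R) ^ (n - 1)) this
        (Or.inr (by finiteness))
      simpa using h2
    have hpos : 0 < (1 - η) * volume F :=
      ENNReal.mul_pos (tsub_pos_iff_lt.2 hη).ne' h0
    obtain ⟨δ, hδ, hδ'⟩ := Metric.eventually_nhds_iff.1 (hcont.eventually_lt_const hpos)
    refine ⟨δ, hδ, fun h hh => ?_⟩
    by_contra hlt
    push Not at hlt
    obtain ⟨hh0, c, hc⟩ := hh
    have h1 := hδ' (y := h) (by rw [Real.dist_eq, sub_zero, abs_of_pos hh0]; exact hlt)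
    have h2 := (volume_slab_le rk c i hF hR h).trans_lt h1
    have h3 : volume F ≤ volume (F ∩ {v | |triForm rk c i v| ≤ h}) +
        volume (F ∩ {v | h < |triForm rk c i v|}) := by
      refine (measure_mono ?_).trans (measure_union_le _ _)
      intro v hv
      rcases le_or_gt |triForm rk c i v| h with hle | hgt
      · exact Or.inl ⟨hv, hle⟩
      · exact Or.inr ⟨hv, hgt⟩
    have h4 : volume F < (1 - η) * volume F + η * volume F :=
      h3.trans_lt (ENNReal.add_lt_add_of_lt_of_le (by finiteness) h2 hc)
    rw [← add_mul, tsub_add_cancel_of_le hη.le, one_mul] at h4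
    exact lt_irrefl _ h4
  have hbdd : BddBelow S := ⟨δ, fun h hh => hδS h hh⟩
  have hinf : δ ≤ sInf S := le_csInf hne hδS
  have hip : 0 < sInf S := hδ.trans_le hinf
  obtain ⟨h', ⟨hh', c, hc⟩, hlt⟩ := exists_lt_of_csInf_lt hne (show sInf S < 2 * sInf S by linarith)
  refine ⟨sInf S / 2, c, by positivity, ?_, fun c' => ?_⟩
  · refine le_trans (measure_mono ?_) hc
    gcongr
    linarith
  · have hnot : sInf S / 2 ∉ S := fun hmem => by linarith [csInf_le hbdd hmem]
    have hgt : η * volume F < volume (F ∩ {v | sInf S / 2 < |triForm rk c' i v|}) := by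
      by_contra hle
      exact hnot ⟨by positivity, c', not_lt.1 hle⟩
    calc ENNReal.ofReal (sInf S / 2) * (η * volume F)
        ≤ ENNReal.ofReal (sInf S / 2) * volume (F ∩ {v | sInf S / 2 < |triForm rk c' i v|}) := by
          gcongr
      _ = ∫⁻ v in F ∩ {v | sInf S / 2 < |triForm rk c' i v|}, ENNReal.ofReal (sInf S / 2) := by
          rw [setLIntegral_const]
      _ ≤ ∫⁻ v in F ∩ {v | sInf S / 2 < |triForm rk c' i v|},
            ENNReal.ofReal |triForm rk c' i v| := by
          refine setLIntegral_mono' (hF.inter (hmeas c' _)) fun v hv => ?_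
          exact ENNReal.ofReal_le_ofReal (le_of_lt hv.2)
      _ ≤ _ := lintegral_mono_set Set.inter_subset_left

/-- The determinant of the coordinates `o 0, …, o (k - 1)` of `k` vectors. -/
def detCoord {n : ℕ} (o : ℕ → Fin n) (k : ℕ) (v : Fin k → Vec n) : ℝ :=
  Matrix.det (Matrix.of fun a b : Fin k => v a (o b))

theorem continuous_detCoord {n : ℕ} (o : ℕ → Fin n) (k : ℕ) : Continuous (detCoord o k) := by
  unfold detCoord
  refine Continuous.matrix_det ?_
  exact continuous_matrix fun a b => by simp only [Matrix.of_apply]; fun_prop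

/-- The integral of the absolute value of `detCoord` over `F ^ k`. -/
def detIntegral {n : ℕ} (o : ℕ → Fin n) (k : ℕ) (F : Set (Vec n)) : ℝ≥0∞ :=
  ∫⁻ v : Fin k → Vec n, (∏ a, F.indicator 1 (v a)) * ENNReal.ofReal |detCoord o k v|

theorem detCoord_snoc {n : ℕ} (rk : Fin n → ℕ) (o : ℕ → Fin n)
    (hrk : Function.Injective rk) (ho : ∀ b < n, rk (o b) = b) {k : ℕ} (hk : k < n)
    (v : Fin k → Vec n) (hv : detCoord o k v ≠ 0) :
    ∃ c, ∀ w, detCoord o (k + 1) (Fin.snoc v w : Fin (k + 1) → Vec n) =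
      detCoord o k v * triForm rk c (o k) w := by
  classical
  have hminor : ∀ (w : Vec n) (b : Fin (k + 1)),
      ((Matrix.of fun a b : Fin (k + 1) => (Fin.snoc v w : Fin (k + 1) → Vec n) a (o b)).submatrix
        (Fin.last k).succAbove b.succAbove) =
      Matrix.of fun (a : Fin k) (l : Fin k) => v a (o (b.succAbove l)) := by
    intro w b
    ext a l
    simp only [Matrix.submatrix_apply, Matrix.of_apply, Fin.succAbove_last, Fin.snoc_castSucc]
  set mn : ℕ → ℝ := fun b => if h : b < k + 1 then
    (Matrix.of fun (a : Fin k) (l : Fin k) => v a (o ((⟨b, h⟩ : Fin (k + 1)).succAbove l))).det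
    else 0 with hmn
  refine ⟨fun j => -((-1) ^ (k + rk j) * mn (rk j) / detCoord o k v), fun w => ?_⟩
  rw [detCoord, Matrix.det_succ_row _ (Fin.last k), Fin.sum_univ_castSucc]
  simp only [hminor]
  have hlast : (Matrix.of fun (a : Fin k) (l : Fin k) =>
      v a (o ((Fin.last k).succAbove l))).det = detCoord o k v := by
    simp only [Fin.succAbove_last, Fin.val_castSucc, detCoord]
  rw [hlast, triForm, ho k hk]
  have hsum : ∑ j with rk j < k, -((-1) ^ (k + rk j) * mn (rk j) / detCoord o k v) * w j =
      ∑ b : Fin k, -((-1) ^ (k + b.1) * mn b / detCoord o k v) * w (o b) := by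
    symm
    refine Finset.sum_bij (fun b _ => o b) (fun b _ => ?_) (fun b _ b' _ h => ?_)
      (fun j hj => ?_) (fun b _ => ?_)
    · simp [ho b (b.2.trans hk)]
    · have := congrArg rk h
      rw [ho b (b.2.trans hk), ho b' (b'.2.trans hk)] at this
      exact Fin.ext this
    · have hj' : rk j < k := by simpa using hj
      exact ⟨⟨rk j, hj'⟩, mem_univ _, hrk (ho _ (hj'.trans hk))⟩
    · rw [ho b (b.2.trans hk)]
  rw [hsum, mul_sub, Finset.mul_sum, sub_eq_add_neg, ← Finset.sum_neg_distrib, add_comm]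
  congr 1
  · simp only [Matrix.of_apply, Fin.snoc_last, Fin.val_last]
    rw [← two_mul, pow_mul]; simp; ring
  · refine Finset.sum_congr rfl fun b _ => ?_
    have hb : (b : ℕ) < k + 1 := b.2.trans (Nat.lt_succ_self k)
    simp only [Matrix.of_apply, Fin.snoc_last, Fin.val_last, Fin.val_castSucc, hmn, hb, dite_true]
    field_simp
    rfl

theorem measurable_prod_indicator {n k : ℕ} {F : Set (Vec n)} (hF : MeasurableSet F) :
    Measurable fun v : Fin k → Vec n => ∏ a, F.indicator (1 : Vec n → ℝ≥0∞) (v a) :=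
  Finset.measurable_prod _ fun a _ => (measurable_one.indicator hF).comp (measurable_pi_apply a)

theorem mul_detIntegral_le {n : ℕ} (rk : Fin n → ℕ) (o : ℕ → Fin n)
    (hrk : Function.Injective rk) (ho : ∀ b < n, rk (o b) = b) {k : ℕ} (hk : k < n)
    {F : Set (Vec n)} (hF : MeasurableSet F) {τ : ℝ≥0∞}
    (hτ : ∀ c, τ ≤ ∫⁻ v in F, ENNReal.ofReal |triForm rk c (o k) v|) :
    detIntegral o k F * τ ≤ detIntegral o (k + 1) F := by
  have hm : Measurable fun v : Fin (k + 1) → Vec n => (∏ a, F.indicator 1 (v a)) *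
      ENNReal.ofReal |detCoord o (k + 1) v| :=
    (measurable_prod_indicator hF).mul
      (continuous_detCoord o (k + 1)).abs.measurable.ennreal_ofReal
  have hm' : Measurable fun v : Fin k → Vec n => (∏ a, F.indicator 1 (v a)) *
      ENNReal.ofReal |detCoord o k v| :=
    (measurable_prod_indicator hF).mul (continuous_detCoord o k).abs.measurable.ennreal_ofReal
  have e := (volume_preserving_piFinSuccAbove (fun _ : Fin (k + 1) => Vec n) (Fin.last k)).symm
    |>.lintegral_comp hm
  have e2 := lintegral_prod_symm' (μ := (volume : Measure (Vec n)))
    (ν := (volume : Measure (Fin k → Vec n)))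
    (fun p => (fun v : Fin (k + 1) → Vec n => (∏ a, F.indicator (1 : Vec n → ℝ≥0∞) (v a)) *
      ENNReal.ofReal |detCoord o (k + 1) v|)
      ((MeasurableEquiv.piFinSuccAbove (fun _ : Fin (k + 1) => Vec n) (Fin.last k)).symm p))
    (hm.comp (MeasurableEquiv.measurable _))
  rw [detIntegral, detIntegral, ← e, ← lintegral_mul_const _ hm', Measure.volume_eq_prod, e2]
  refine lintegral_mono fun v => ?_
  have hs : ∀ w : Vec n, (MeasurableEquiv.piFinSuccAbove (fun _ : Fin (k + 1) => Vec n)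
      (Fin.last k)).symm (w, v) = (Fin.snoc v w : Fin (k + 1) → Vec n) := by
    intro w
    exact Fin.insertNth_last' w v
  simp only [hs, Fin.prod_univ_castSucc, Fin.snoc_castSucc, Fin.snoc_last]
  by_cases hv : detCoord o k v = 0
  · simp [hv]
  obtain ⟨c, hc⟩ := detCoord_snoc rk o hrk ho hk v hv
  simp only [hc, abs_mul]
  calc (∏ a, F.indicator 1 (v a)) * ENNReal.ofReal |detCoord o k v| * τ
      ≤ (∏ a, F.indicator 1 (v a)) * ENNReal.ofReal |detCoord o k v| *
          ∫⁻ w in F, ENNReal.ofReal |triForm rk c (o k) w| := by gcongr; exact hτ c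
    _ = ∫⁻ w, (∏ a, F.indicator 1 (v a)) * ENNReal.ofReal |detCoord o k v| *
          F.indicator (fun w => ENNReal.ofReal |triForm rk c (o k) w|) w := by
        rw [lintegral_const_mul, lintegral_indicator hF]
        exact ((continuous_triForm rk c _).abs.measurable.ennreal_ofReal).indicator hF
    _ ≤ _ := by
        refine lintegral_mono fun w => ?_
        by_cases hw : w ∈ F
        · simp only [Set.indicator_of_mem hw, Pi.one_apply, mul_one]
          rw [ENNReal.ofReal_mul (abs_nonneg _), mul_assoc]
        · simp [Set.indicator_of_notMem hw]

/-- Most of `F` lies in a triangular box whose side lengths bound the averages of `detCoord`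
over `F` from below. -/
theorem exists_triangular_box {n : ℕ} (rk : Fin n → ℕ) (o : ℕ → Fin n)
    (hrk : Function.Injective rk) (ho : ∀ b < n, rk (o b) = b)
    {F : Set (Vec n)} (hF : MeasurableSet F) (hb : Bornology.IsBounded F) (h0 : volume F ≠ 0)
    {η : ℝ≥0∞} (hη : η < 1) :
    ∃ (h : Fin n → ℝ) (c : Fin n → Fin n → ℝ), (∀ i, 0 < h i) ∧
      volume F ≤ volume (F ∩ {v | ∀ i, |triForm rk (c i) i v| ≤ 4 * h i}) + n * (η * volume F) ∧
      ∀ k ≤ n, ∏ b ∈ range k, (ENNReal.ofReal (h (o b)) * (η * volume F)) ≤ detIntegral o k F := by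
  choose h c hh hc hc' using fun i => exists_triForm_threshold rk i hF hb h0 hη
  refine ⟨h, c, hh, ?_, fun k => ?_⟩
  · have hsub : F ⊆ (F ∩ {v | ∀ i, |triForm rk (c i) i v| ≤ 4 * h i}) ∪
        ⋃ i, F ∩ {v | 4 * h i < |triForm rk (c i) i v|} := by
      intro v hv
      by_cases hall : ∀ i, |triForm rk (c i) i v| ≤ 4 * h i
      · exact Or.inl ⟨hv, hall⟩
      · push Not at hall
        obtain ⟨i, hi⟩ := hall
        exact Or.inr (Set.mem_iUnion.2 ⟨i, hv, hi⟩)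
    refine (measure_mono hsub).trans ((measure_union_le _ _).trans ?_)
    gcongr
    refine (measure_iUnion_fintype_le _ _).trans ((Finset.sum_le_sum fun i _ => hc i).trans ?_)
    simp
  · induction k with
    | zero =>
      intro _
      simp [detIntegral, detCoord, lintegral_unique, volume_pi]
    | succ k ih =>
      intro hk
      rw [Finset.prod_range_succ]
      refine (mul_le_mul_left (ih (by omega)) _).trans ?_
      exact mul_detIntegral_le rk o hrk ho (by omega) hF (hc' _)

end

section

theorem lintegral_prod_comp_eq_pow {α : Type*} [MeasureSpace α]
    [SigmaFinite (volume : Measure α)] {φ : α → ℝ≥0∞} (hφ : Measurable φ) (k : ℕ) :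
    ∫⁻ v : Fin k → α, ∏ a, φ (v a) = (∫⁻ w, φ w) ^ k := by
  induction k with
  | zero => simp [volume_pi]
  | succ k ih =>
    have hm : ∀ k, Measurable fun v : Fin k → α => ∏ a, φ (v a) := fun k =>
      Finset.measurable_prod _ fun a _ => hφ.comp (measurable_pi_apply a)
    have e := (volume_preserving_piFinSuccAbove (fun _ : Fin (k + 1) => α) 0).symm
      |>.lintegral_comp (hm (k + 1))
    have e2 : ∀ p : α × (Fin k → α), ∏ a, φ ((MeasurableEquiv.piFinSuccAbove
        (fun _ : Fin (k + 1) => α) 0).symm p a) = φ p.1 * ∏ a, φ (p.2 a) := by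
      intro p
      rw [Fin.prod_univ_succ]
      rfl
    rw [← e]
    simp only [e2]
    rw [Measure.volume_eq_prod, lintegral_prod_mul hφ.aemeasurable (hm k).aemeasurable, ih,
      pow_succ, mul_comm]

theorem measurable_expY_comp {n : ℕ} {α : Type*} [MeasurableSpace α] {f : α → Vec n}
    {g : α → Heis n} (hf : Measurable f) (hg : Measurable g) :
    Measurable fun a => expY (f a) (g a) := measurable_expY.comp (hf.prodMk hg)

theorem measurable_detIntegral_fibY {n : ℕ} (o : ℕ → Fin n) (k : ℕ) {A : Set (Heis n)}
    (hA : MeasurableSet A) : Measurable fun z => detIntegral o k (fibY A z) := by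
  have : Measurable fun p : Heis n × (Fin k → Vec n) =>
      (∏ a, A.indicator (1 : Heis n → ℝ≥0∞) (expY (p.2 a) p.1)) *
        ENNReal.ofReal |detCoord o k p.2| := by
    refine Measurable.mul (Finset.measurable_prod _ fun a _ =>
      (measurable_one.indicator hA).comp (measurable_expY_comp
        ((measurable_pi_apply a).comp measurable_snd) measurable_fst)) ?_
    exact (((continuous_detCoord o k).abs.measurable).comp measurable_snd).ennreal_ofReal
  exact this.lintegral_prod_right'

theorem coordIncl_dotProduct {n k : ℕ} {K : Finset (Fin n)} {o : ℕ → Fin n} (e : Fin k ≃ K)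
    (he : ∀ b, (e b : Fin n) = o b) (w : Fin k → ℝ) (v : Vec n) :
    coordIncl K (fun i => w (e.symm i)) ⬝ᵥ v = ∑ b : Fin k, v (o b) * w b := by
  rw [dotProduct, ← Finset.sum_subset (Finset.subset_univ K)]
  · rw [← Finset.sum_coe_sort K, ← e.sum_comp]
    refine Finset.sum_congr rfl fun b _ => ?_
    have h1 : coordIncl K (fun i => w (e.symm i)) (e b) = w b := by simp [coordIncl]
    rw [h1, he, mul_comm]
  · intro i _ hi
    simp [coordIncl, hi]

/-- The set of `u` for which all the `expY (v a)` flows of `expX u z` end in `A` is small, since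
the conserved quantities of the `X` flow through the end points are restricted to sections of
the projection of `A`. -/
theorem lintegral_detIntegral_le {n k : ℕ} {K : Finset (Fin n)} {o : ℕ → Fin n} (e : Fin k ≃ K)
    (he : ∀ b, (e b : Fin n) = o b) {A : Set (Heis n)} (hA : MeasurableSet A) (z : Heis n) :
    ∫⁻ u : K → ℝ, detIntegral o k (fibY A (expX (coordIncl K u) z)) ≤
      volume (projX (∅ : Finset (Fin n)) '' A) ^ k := by
  set P := toMeasurable volume (projX (∅ : Finset (Fin n)) '' A) with hP
  have hPm : MeasurableSet P := measurableSet_toMeasurable _ _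
  let e0 : (∅ : Finset (Fin n)) → ℝ := 0
  have hsub : ∀ e' : (∅ : Finset (Fin n)) → ℝ, e' = e0 := fun e' => by
    ext ⟨i, hi⟩; simp at hi
  set ψ : Vec n → ℝ≥0∞ := fun y => volume {r : ℝ | (e0, y, r) ∈ P} with hψ
  have hψm : Measurable ψ := by
    have : MeasurableSet {p : Vec n × ℝ | (e0, p.1, p.2) ∈ P} :=
      (measurable_const.prodMk measurable_id) hPm
    exact measurable_measure_prodMk_left this
  have hψi : ∫⁻ y, ψ y = volume (projX (∅ : Finset (Fin n)) '' A) := by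
    rw [← measure_toMeasurable, ← hP, Measure.volume_eq_prod, Measure.prod_apply hPm]
    have h1 : ∀ e', volume (Prod.mk e' ⁻¹' P) = ∫⁻ y, ψ y := by
      intro e'
      rw [hsub e', Measure.volume_eq_prod, Measure.prod_apply (measurable_prodMk_left hPm)]
      rfl
    simp only [h1, lintegral_const]
    have : (volume : Measure ((∅ : Finset (Fin n)) → ℝ)) Set.univ = 1 := by
      rw [volume_pi, ← Set.pi_univ Set.univ, Measure.pi_pi]
      simp
    rw [this, mul_one]
  have hswap : ∫⁻ u : K → ℝ, detIntegral o k (fibY A (expX (coordIncl K u) z)) =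
      ∫⁻ v : Fin k → Vec n, ∫⁻ u : K → ℝ,
        (∏ a, A.indicator (1 : Heis n → ℝ≥0∞) (expY (v a) (expX (coordIncl K u) z))) *
          ENNReal.ofReal |detCoord o k v| := by
    rw [lintegral_lintegral_swap]
    · rfl
    · refine Measurable.aemeasurable (Measurable.mul (Finset.measurable_prod _ fun a _ =>
        (measurable_one.indicator hA).comp (measurable_expY_comp
          ((measurable_pi_apply a).comp measurable_fst)
            ((measurable_expX_incl K).comp (measurable_const.prodMk measurable_snd)))) ?_)
      exact (((continuous_detCoord o k).abs.measurable).comp measurable_fst).ennreal_ofReal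
  rw [hswap, ← hψi, ← lintegral_add_left_eq_self ψ z.2.1,
    ← lintegral_prod_comp_eq_pow (φ := fun y => ψ (z.2.1 + y))
      (hψm.comp (measurable_const_add _)) k]
  refine lintegral_mono fun v => ?_
  set G : Set (K → ℝ) := {u | ∀ a, expY (v a) (expX (coordIncl K u) z) ∈ A} with hG
  have hGm : MeasurableSet G := by
    have : G = ⋂ a, {u | expY (v a) (expX (coordIncl K u) z) ∈ A} := by ext; simp [hG]
    rw [this]
    exact MeasurableSet.iInter fun a => (measurable_expY_comp measurable_const
      ((measurable_expX_incl K).comp (measurable_const.prodMk measurable_id))) hA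
  have hind : ∀ u, ∏ a, A.indicator (1 : Heis n → ℝ≥0∞) (expY (v a) (expX (coordIncl K u) z)) =
      G.indicator 1 u := by
    intro u
    by_cases hu : u ∈ G
    · rw [Set.indicator_of_mem hu]
      exact Finset.prod_eq_one fun a _ => by rw [Set.indicator_of_mem (hu a)]; rfl
    · rw [Set.indicator_of_notMem hu]
      simp only [hG, Set.mem_ofPred_eq, not_forall] at hu
      obtain ⟨a, ha⟩ := hu
      exact Finset.prod_eq_zero (mem_univ a) (Set.indicator_of_notMem ha _)
  simp only [hind]
  rw [lintegral_mul_const _ (measurable_one.indicator hGm), lintegral_indicator_one hGm]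
  let T : (Fin k → ℝ) →ₗ[ℝ] (Fin k → ℝ) := Matrix.toLin' (Matrix.of fun a b : Fin k => v a (o b))
  let G' : Set (Fin k → ℝ) := {w | (fun i => w (e.symm i)) ∈ G}
  have hG' : volume G' = volume G := by
    have hp := volume_measurePreserving_piCongrLeft (fun _ : K => ℝ) e
    rw [← hp.measure_preimage hGm.nullMeasurableSet]
    congr 1
    ext w
    have : MeasurableEquiv.piCongrLeft (fun _ : K => ℝ) e w = fun i => w (e.symm i) := by
      ext i
      obtain ⟨b, rfl⟩ := e.surjective i
      rw [MeasurableEquiv.piCongrLeft_apply_apply, e.symm_apply_apply]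
    simp only [Set.mem_preimage, this]
    rfl
  have hTdet : LinearMap.det T = detCoord o k v := LinearMap.det_toLin' _
  have himg : T '' G' ⊆ Set.pi Set.univ fun a => {r : ℝ | (e0, z.2.1 + v a,
      (z.2.2 + 1 / 2 * (z.1 ⬝ᵥ z.2.1) + z.1 ⬝ᵥ v a) + r) ∈ P} := by
    rintro _ ⟨w, hw, rfl⟩ a _
    have h1 : expY (v a) (expX (coordIncl K fun i => w (e.symm i)) z) ∈ A := hw a
    have h2 : projX ∅ (expY (v a) (expX (coordIncl K fun i => w (e.symm i)) z)) ∈ P :=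
      subset_toMeasurable _ _ ⟨_, h1, rfl⟩
    have h3 : T w a = coordIncl K (fun i => w (e.symm i)) ⬝ᵥ v a := by
      rw [coordIncl_dotProduct e he]
      simp [T, Matrix.mulVec, dotProduct]
    have h4 : projX ∅ (expY (v a) (expX (coordIncl K fun i => w (e.symm i)) z)) =
        (e0, z.2.1 + v a, (z.2.2 + 1 / 2 * (z.1 ⬝ᵥ z.2.1) + z.1 ⬝ᵥ v a) + T w a) := by
      rw [h3]
      simp only [projX, expY, expX, Prod.mk.injEq, hsub, true_and, add_dotProduct, dotProduct_add]
      ring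
    rw [h4] at h2
    exact h2
  calc volume G * ENNReal.ofReal |detCoord o k v| = volume (T '' G') := by
        rw [Measure.addHaar_image_linearMap, hTdet, hG', mul_comm]
    _ ≤ _ := measure_mono himg
    _ = ∏ a, ψ (z.2.1 + v a) := by
        rw [volume_pi, Measure.pi_pi]
        refine Finset.prod_congr rfl fun a _ => ?_
        exact measure_preimage_add volume (z.2.2 + 1 / 2 * (z.1 ⬝ᵥ z.2.1) + z.1 ⬝ᵥ v a)
          {r : ℝ | (e0, z.2.1 + v a, r) ∈ P}

theorem setLIntegral_detIntegral_le {n k : ℕ} {K : Finset (Fin n)} {o : ℕ → Fin n}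
    (e : Fin k ≃ K) (he : ∀ b, (e b : Fin n) = o b) {A : Set (Heis n)} (hA : MeasurableSet A) :
    ∫⁻ z in A, detIntegral o k (fibY A z) ≤
      volume (projX (∅ : Finset (Fin n)) '' A) ^ k * volume (projX Kᶜ '' A) :=
  setLIntegral_le_mul_projX rfl hA (measurable_detIntegral_fibY o k hA) fun z _ =>
    (setLIntegral_le_lintegral _ _).trans (lintegral_detIntegral_le e he hA z)

end

section

/-! ### Levels -/

section Levels

variable {n : ℕ} {Q : Fin n → ℕ}

theorem level_lt {j j' : ℕ} (h : j < j') (h' : j' < numLevels Q) : level Q j' < level Q j := by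
  have hl : ((univ.image Q).sort (· ≥ ·)).length = numLevels Q := Finset.length_sort _
  rw [level, level, List.getD_eq_getElem _ _ (by omega), List.getD_eq_getElem _ _ (by omega)]
  exact List.pairwise_iff_getElem.1 (Finset.sortedGT_sort (univ.image Q)).pairwise j j' _ _ h

theorem level_of_le {j : ℕ} (h : numLevels Q ≤ j) : level Q j = 0 := by
  have hl : ((univ.image Q).sort (· ≥ ·)).length = numLevels Q := Finset.length_sort _
  rw [level, List.getD_eq_default _ _ (by omega)]

theorem exists_level_eq (i : Fin n) : ∃ j < numLevels Q, level Q j = Q i := by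
  have hl : ((univ.image Q).sort (· ≥ ·)).length = numLevels Q := Finset.length_sort _
  have : Q i ∈ (univ.image Q).sort (· ≥ ·) := (Finset.mem_sort _).2 (by simp)
  obtain ⟨j, hj, hji⟩ := List.mem_iff_getElem.1 this
  exact ⟨j, by omega, by rw [level, List.getD_eq_getElem _ _ hj, hji]⟩

theorem antitone_level : Antitone (level Q) := by
  intro j j' h
  rcases h.eq_or_lt with rfl | h
  · exact le_rfl
  · by_cases h' : j' < numLevels Q
    · exact (level_lt h h').le
    · rw [level_of_le (not_lt.1 h')]; exact Nat.zero_le _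

theorem mem_auxKer {i : Fin n} {j : ℕ} : i ∈ auxKer Q j ↔ level Q j ≤ Q i := by simp [auxKer]

theorem auxKer_mono : Monotone (auxKer Q) := fun _ _ h _ hi =>
  mem_auxKer.2 ((antitone_level h).trans (mem_auxKer.1 hi))

theorem mem_auxKer_iff_le {i : Fin n} {j p : ℕ} (hp : p < numLevels Q)
    (hpi : level Q p = Q i) : i ∈ auxKer Q j ↔ p ≤ j := by
  rw [mem_auxKer, ← hpi]
  constructor
  · intro h
    by_contra hlt
    exact absurd (level_lt (not_le.1 hlt) hp) (not_lt.2 h)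
  · exact fun h => antitone_level h

theorem sum_auxExp (i : Fin n) :
    ∑ j ∈ range (numLevels Q) with i ∈ auxKer Q j, auxExp Q j = Q i := by
  obtain ⟨p, hp, hpi⟩ := exists_level_eq (Q := Q) i
  have hf : (range (numLevels Q)).filter (fun j => i ∈ auxKer Q j) =
      Finset.Ico p (numLevels Q) := by
    ext j
    simp only [Finset.mem_filter, Finset.mem_range, Finset.mem_Ico]
    constructor
    · rintro ⟨hj, h⟩; exact ⟨(mem_auxKer_iff_le hp hpi).1 h, hj⟩
    · rintro ⟨h, hj⟩; exact ⟨hj, (mem_auxKer_iff_le hp hpi).2 h⟩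
  rw [hf]
  have key : ∀ q, p ≤ q → ∑ j ∈ Finset.Ico p q, auxExp Q j + level Q q = level Q p := by
    intro q hq
    induction q, hq using Nat.le_induction with
    | base => simp
    | succ q hq ih =>
      rw [Finset.sum_Ico_succ_top hq]
      have := antitone_level (Q := Q) (Nat.le_add_right q 1)
      simp only [auxExp] at *
      omega
  have := key _ hp.le
  rw [level_of_le le_rfl] at this
  omega

theorem auxKer_eq_univ {j : ℕ} (hj : j + 1 = numLevels Q) : auxKer Q j = univ := by
  ext i
  obtain ⟨p, hp, hpi⟩ := exists_level_eq (Q := Q) i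
  simp only [mem_univ, iff_true]
  exact (mem_auxKer_iff_le hp hpi).2 (by omega)

theorem eq_level_of_mem_auxKer_succ {i : Fin n} {j : ℕ} (h : i ∈ auxKer Q (j + 1))
    (h' : i ∉ auxKer Q j) : Q i = level Q (j + 1) := by
  obtain ⟨p, hp, hpi⟩ := exists_level_eq (Q := Q) i
  rw [mem_auxKer_iff_le hp hpi] at h
  rw [mem_auxKer_iff_le hp hpi] at h'
  rw [← hpi]; congr 1; omega

theorem eq_level_of_mem_auxKer_zero {i : Fin n} (h : i ∈ auxKer Q 0) : Q i = level Q 0 := by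
  obtain ⟨p, hp, hpi⟩ := exists_level_eq (Q := Q) i
  rw [mem_auxKer_iff_le hp hpi] at h
  rw [← hpi]; congr 1; omega

theorem numLevels_pos (hn : 0 < n) : 0 < numLevels Q := by
  have : Nonempty (Fin n) := ⟨⟨0, hn⟩⟩
  rw [numLevels, Finset.card_pos]
  exact Finset.univ_nonempty.image Q

end Levels

/-! ### A Finner inequality with bounds on nested sections -/

theorem dependsOn_lmarginal {n : ℕ} {W T : Finset (Fin n)} {g : Vec n → ℝ≥0∞}
    (hg : ∀ x y : Vec n, (∀ i ∈ W, x i = y i) → g x = g y) (x y : Vec n)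
    (h : ∀ i ∈ W, x i = y i) : (∫⋯∫⁻_T, g) x = (∫⋯∫⁻_T, g) y := by
  unfold lmarginal
  refine lintegral_congr fun u => hg _ _ fun i hi => ?_
  by_cases hiT : i ∈ T
  · simp [Function.updateFinset, hiT]
  · simp [Function.updateFinset, hiT, h i hi]

theorem lmarginal_finner_step {n : ℕ} {ι : Type*} [Fintype ι] (W : ι → Finset (Fin n))
    (e : ι → ℕ) (g : ι → Vec n → ℝ≥0∞) (hgm : ∀ j, Measurable (g j))
    (hg : ∀ j, ∀ x y : Vec n, (∀ i ∈ W j, x i = y i) → g j x = g j y)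
    {f : Vec n → ℝ≥0∞} (hf : Measurable f) {s : ℕ} (hs : 0 < s) {c : ℝ≥0∞} {T T' : Finset (Fin n)}
    (hT : T ⊆ T') (hsum : ∀ i ∈ T' \ T, ∑ j with i ∈ W j, e j = s)
    (hF : ∀ x, ((∫⋯∫⁻_T, f) x) ^ s ≤ c * ∏ j, ((∫⋯∫⁻_(T ∩ W j), g j) x) ^ e j) (x : Vec n) :
    ((∫⋯∫⁻_T', f) x) ^ s ≤ c * ∏ j, ((∫⋯∫⁻_(T' ∩ W j), g j) x) ^ e j := by
  have hs' : (s : ℝ) ≠ 0 := by positivity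
  let W' : Option ι → Finset (Fin n) := fun o => o.elim ∅ W
  let g' : Option ι → Vec n → ℝ≥0∞ := fun o =>
    o.elim (fun _ => c ^ (1 / s : ℝ)) fun j => (∫⋯∫⁻_(T ∩ W j), g j)
  let p' : Option ι → ℝ := fun o => o.elim 1 fun j => e j / s
  have key := lmarginal_le_prod_rpow (fun i : Fin n => (i : ℕ)) Fin.val_injective W' g'
    (fun o => by
      cases o with
      | none => exact measurable_const
      | some j => exact (hgm j).lmarginal fun _ => volume)
    (fun o => by
      cases o with
      | none => exact fun _ _ _ => rfl
      | some j => exact dependsOn_lmarginal (hg j))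
    p' (fun o => by
      cases o with
      | none => exact zero_le_one
      | some j => simp only [p', Option.elim]; positivity)
    (fun _ => 0) (fun _ => le_rfl) (fun _ => Set.univ) (fun _ => ∞) (fun _ _ _ _ _ => trivial)
    (fun _ _ _ _ _ _ => le_top) (hf.lmarginal (fun _ => volume) (s := T)) (fun v => by
      rw [Fintype.prod_option]
      simp only [g', p', Option.elim, ENNReal.rpow_one]
      have h1 := ENNReal.rpow_le_rpow (hF v) (show (0 : ℝ) ≤ 1 / s by positivity)
      rw [← ENNReal.rpow_natCast, ← ENNReal.rpow_mul, mul_one_div_cancel hs', ENNReal.rpow_one,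
        ENNReal.mul_rpow_of_nonneg _ _ (by positivity),
        ← ENNReal.prod_rpow_of_nonneg (by positivity)] at h1
      refine h1.trans (le_of_eq ?_)
      congr 1
      refine Finset.prod_congr rfl fun j _ => ?_
      rw [← ENNReal.rpow_natCast, ← ENNReal.rpow_mul]
      congr 1
      ring)
    (T' \ T) (fun _ _ _ _ => trivial) (fun i hi => by
      rw [zero_add, Finset.sum_filter, Fintype.sum_option]
      change (if i ∈ (∅ : Finset (Fin n)) then (1 : ℝ) else 0) +
        ∑ j, (if i ∈ W j then (e j / s : ℝ) else 0) = 1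
      rw [if_neg (Finset.notMem_empty i), zero_add, ← Finset.sum_filter, ← Finset.sum_div,
        ← Nat.cast_sum, hsum i hi]
      exact div_self hs') x
  rw [Fintype.prod_option] at key
  simp only [W', g', p', Option.elim, ENNReal.rpow_zero, Finset.prod_const_one, one_mul,
    ENNReal.rpow_one,
    Finset.inter_empty, lmarginal_empty] at key
  have e1 : (∫⋯∫⁻_(T' \ T), ∫⋯∫⁻_T, f) = ∫⋯∫⁻_T', f := by
    rw [← lmarginal_union _ _ hf Finset.sdiff_disjoint, Finset.sdiff_union_of_subset hT]
  have e2 : ∀ j, (∫⋯∫⁻_(T' \ T ∩ W j), ∫⋯∫⁻_(T ∩ W j), g j) = ∫⋯∫⁻_(T' ∩ W j), g j := by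
    intro j
    rw [← lmarginal_union _ _ (hgm j) (Finset.sdiff_disjoint.mono Finset.inter_subset_left
      Finset.inter_subset_left), ← Finset.union_inter_distrib_right,
      Finset.sdiff_union_of_subset hT]
  rw [e1] at key
  simp only [e2] at key
  calc ((∫⋯∫⁻_T', f) x) ^ s ≤ (c ^ (1 / s : ℝ) *
        ∏ j, ((∫⋯∫⁻_(T' ∩ W j), g j) x) ^ (e j / s : ℝ)) ^ s := by gcongr
    _ = _ := by
      rw [mul_pow, ← Finset.prod_pow, ← ENNReal.rpow_natCast, ← ENNReal.rpow_mul,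
        one_div_mul_cancel hs', ENNReal.rpow_one]
      congr 1
      refine Finset.prod_congr rfl fun j _ => ?_
      rw [← ENNReal.rpow_natCast, ← ENNReal.rpow_natCast, ← ENNReal.rpow_mul,
        div_mul_cancel₀ _ hs']

theorem lintegral_pow_le_of_nested {n : ℕ} (hn : 0 < n) {ι : Type*} [Fintype ι]
    (W : ι → Finset (Fin n))
    (e : ι → ℕ) (Q : Fin n → ℕ) (hQ : ∀ i, ∑ j with i ∈ W j, e j + Q i = ∑ j, e j)
    (hpos : ∀ i, Q i < ∑ j, e j)
    (g : ι → Vec n → ℝ≥0∞) (hgm : ∀ j, Measurable (g j))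
    (hg : ∀ j, ∀ x y : Vec n, (∀ i ∈ W j, x i = y i) → g j x = g j y)
    {f : Vec n → ℝ≥0∞} (hf : Measurable f) (hfg : ∀ x, f x ≠ 0 → f x ≤ 1 ∧ ∀ j, 1 ≤ g j x)
    (B : ℕ → ℝ≥0∞) (hB : ∀ j < numLevels Q, ∀ x, (∫⋯∫⁻_(auxKer Q j), f) x ≤ B j) (x : Vec n) :
    (∫⁻ x, f x) ^ (∑ j, e j) ≤ (∏ j ∈ range (numLevels Q), B j ^ auxExp Q j) *
      ∏ j, ((∫⋯∫⁻_(W j), g j) x) ^ e j := by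
  set E := ∑ j, e j with hE
  have hlevel : ∀ j, level Q j < E := by
    intro j
    by_cases hj : j < numLevels Q
    · have hmem : level Q j ∈ (univ.image Q).sort (· ≥ ·) := by
        have hl : ((univ.image Q).sort (· ≥ ·)).length = numLevels Q := Finset.length_sort _
        rw [level, List.getD_eq_getElem _ _ (by omega)]
        exact List.getElem_mem _
      rw [Finset.mem_sort] at hmem
      obtain ⟨i, -, hi⟩ := Finset.mem_image.1 hmem
      rw [← hi]; exact hpos i
    · rw [level_of_le (not_lt.1 hj)]
      exact (Nat.zero_le _).trans_lt (hpos ⟨0, hn⟩)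
  let T : ℕ → Finset (Fin n) := fun j => if j = 0 then ∅ else auxKer Q (j - 1)
  have main : ∀ j ≤ numLevels Q, ∀ x, ((∫⋯∫⁻_(T j), f) x) ^ (E - level Q j) ≤
      (∏ l ∈ range j, B l ^ auxExp Q l) * ∏ i, ((∫⋯∫⁻_(T j ∩ W i), g i) x) ^ e i := by
    intro j
    induction j with
    | zero =>
      intro _ x
      simp only [T, if_true, lmarginal_empty, Finset.empty_inter, Finset.range_zero,
        Finset.prod_empty, one_mul]
      by_cases h0 : f x = 0
      · rw [h0, zero_pow (by have := hlevel 0; omega)]; exact zero_le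
      · exact (pow_le_one' (hfg x h0).1 _).trans
          (Finset.one_le_prod' fun i _ => one_le_pow_of_one_le' ((hfg x h0).2 i) _)
    | succ j ih =>
      intro hj x
      have hTj : T (j + 1) = auxKer Q j := by simp [T]
      have hsub : T j ⊆ auxKer Q j := by
        by_cases h0 : j = 0
        · simp [T, h0]
        · simp only [T, h0, if_false]; exact auxKer_mono (by omega)
      have hstep := lmarginal_finner_step W e g hgm hg hf (s := E - level Q j)
        (by have := hlevel j; omega) hsub (fun i hi => by
          rw [Finset.mem_sdiff] at hi
          have hQi : Q i = level Q j := by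
            by_cases h0 : j = 0
            · subst h0; exact eq_level_of_mem_auxKer_zero hi.1
            · obtain ⟨l, rfl⟩ := Nat.exists_eq_succ_of_ne_zero h0
              exact eq_level_of_mem_auxKer_succ hi.1 (by simpa [T] using hi.2)
          have := hQ i
          omega) (ih (by omega)) x
      rw [hTj, Finset.prod_range_succ]
      have hexp : E - level Q (j + 1) = (E - level Q j) + auxExp Q j := by
        have := antitone_level (Q := Q) (Nat.le_add_right j 1)
        have := hlevel j
        simp only [auxExp] at *
        omega
      rw [hexp, pow_add]
      calc _ ≤ ((∏ l ∈ range j, B l ^ auxExp Q l) *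
            ∏ i, ((∫⋯∫⁻_(auxKer Q j ∩ W i), g i) x) ^ e i) * B j ^ auxExp Q j := by
            gcongr
            exact hB j (by omega) x
        _ = _ := by ring
  have hlast := main (numLevels Q) le_rfl x
  obtain ⟨l, hl⟩ := Nat.exists_eq_succ_of_ne_zero (numLevels_pos (Q := Q) hn).ne'
  have hT : T (numLevels Q) = univ := by
    simp only [T, hl, Nat.succ_ne_zero, if_false, Nat.succ_sub_one]
    exact auxKer_eq_univ hl.symm
  rw [hT, level_of_le le_rfl, Nat.sub_zero, lmarginal_univ] at hlast
  simp only [Finset.univ_inter] at hlast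
  exact hlast

/-- The measures of the projections of `A` control its measure, if the sections of `A` by the
nested kernels are bounded. -/
theorem volume_pow_le_of_nested {n : ℕ} (hn : 0 < n) {ι : Type*} [Fintype ι]
    (W : ι → Finset (Fin n))
    (e : ι → ℕ) (Q : Fin n → ℕ) (hQ : ∀ i, ∑ j with i ∈ W j, e j + Q i = ∑ j, e j)
    (hpos : ∀ i, Q i < ∑ j, e j) {A : Set (Heis n)} (hA : MeasurableSet A) (B : ℕ → ℝ≥0∞)
    (hB : ∀ j < numLevels Q, ∀ z ∈ A, volume (sliceX (auxKer Q j) A z) ≤ B j) :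
    volume A ^ (∑ j, e j) ≤ (∏ j ∈ range (numLevels Q), B j ^ auxExp Q j) *
      ∏ j, volume (projX (W j) '' A) ^ e j := by
  set E := ∑ j, e j with hE
  have hE0 : 0 < E := (Nat.zero_le _).trans_lt (hpos ⟨0, hn⟩)
  have hE' : (E : ℝ) ≠ 0 := by positivity
  set c := ∏ j ∈ range (numLevels Q), B j ^ auxExp Q j with hc
  let G : ∀ j, Set ((W j → ℝ) × Vec n × ℝ) := fun j => toMeasurable volume (projX (W j) '' A)
  have hGm : ∀ j, MeasurableSet (G j) := fun j => measurableSet_toMeasurable _ _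
  let f : Vec n × ℝ → Vec n → ℝ≥0∞ := fun p x =>
    A.indicator 1 (x, p.1, p.2 - 1 / 2 * (x ⬝ᵥ p.1))
  have hsh : Measurable fun q : (Vec n × ℝ) × Vec n =>
      ((q.2, q.1.1, q.1.2 - 1 / 2 * (q.2 ⬝ᵥ q.1.1)) : Heis n) := by
    have : Measurable fun q : (Vec n × ℝ) × Vec n => q.2 ⬝ᵥ q.1.1 :=
      measurable_dotProduct (by fun_prop) (by fun_prop)
    fun_prop
  have hfm2 : Measurable fun q : (Vec n × ℝ) × Vec n => f q.1 q.2 :=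
    (measurable_one.indicator hA).comp hsh
  have hfm : ∀ p, Measurable (f p) := fun p => hfm2.comp measurable_prodMk_left
  let g : Vec n × ℝ → ∀ j, Vec n → ℝ≥0∞ := fun p j x => (G j).indicator 1 (coordProj (W j) x, p)
  have hgm : ∀ p j, Measurable (g p j) := fun p j =>
    (measurable_one.indicator (hGm j)).comp ((measurable_coordProj _).prodMk measurable_const)
  have hvA : volume A = ∫⁻ p, ∫⁻ x, f p x := by
    rw [← lintegral_indicator_one hA, lintegral_shear (measurable_one.indicator hA),
      lintegral_lintegral_swap]
    exact (hfm2.comp measurable_swap).aemeasurable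
  have hφ : ∀ p j x, (∫⋯∫⁻_(W j), g p j) x = volume {a : W j → ℝ | (a, p) ∈ G j} := by
    intro p j x
    have hm : MeasurableSet {a : W j → ℝ | (a, p) ∈ G j} := measurable_prodMk_right (hGm j)
    rw [← lintegral_indicator_one hm]
    unfold lmarginal
    refine lintegral_congr fun u => ?_
    have : coordProj (W j) (Function.updateFinset x (W j) u) = u := by
      ext ⟨i, hi⟩; simp [coordProj, Function.updateFinset, hi]
    simp only [g, this]
    rfl
  have hφi : ∀ j, ∫⁻ p, volume {a : W j → ℝ | (a, p) ∈ G j} = volume (projX (W j) '' A) := by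
    intro j
    rw [← measure_toMeasurable (projX (W j) '' A)]
    change _ = volume (G j)
    rw [Measure.volume_eq_prod (W j → ℝ), Measure.prod_apply_symm (hGm j)]
    rfl
  have hfib : ∀ p, (∫⁻ x, f p x) ^ E ≤ c * ∏ j, volume {a : W j → ℝ | (a, p) ∈ G j} ^ e j := by
    intro p
    have := lintegral_pow_le_of_nested hn W e Q hQ hpos (g p) (hgm p)
      (fun j x y h => by
        have : coordProj (W j) x = coordProj (W j) y := by
          ext ⟨i, hi⟩; exact h i hi
        simp only [g, this]) (hfm p) (fun x hx => by
        have hxA : (x, p.1, p.2 - 1 / 2 * (x ⬝ᵥ p.1)) ∈ A := Set.mem_of_indicator_ne_zero hx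
        refine ⟨Set.indicator_le_self' (fun _ _ => zero_le) _, fun j => ?_⟩
        have : (coordProj (W j) x, p) ∈ G j := by
          refine subset_toMeasurable _ _ ⟨_, hxA, ?_⟩
          simp [projX]
        simp only [g, Set.indicator_of_mem this]
        exact le_rfl) B (fun j hj x => by
        by_cases h0 : (∫⋯∫⁻_(auxKer Q j), f p) x = 0
        · rw [h0]; exact zero_le
        obtain ⟨v, hv, hvx⟩ := exists_ne_zero_of_lmarginal_ne_zero h0
        have hvA : (v, p.1, p.2 - 1 / 2 * (v ⬝ᵥ p.1)) ∈ A := Set.mem_of_indicator_ne_zero hv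
        have hSm : MeasurableSet {x | (x, p.1, p.2 - 1 / 2 * (x ⬝ᵥ p.1)) ∈ A} :=
          (hsh.comp measurable_prodMk_left) hA
        refine le_trans (le_of_eq ?_) (hB j hj _ hvA)
        rw [lmarginal_congr (fun _ => volume) (f p) (y := v) fun i hi => (hvx i hi).symm]
        have e1 := volume_setOf_add_coordIncl (auxKer Q j) hSm v
        rw [show f p = {x | (x, p.1, p.2 - 1 / 2 * (x ⬝ᵥ p.1)) ∈ A}.indicator 1 from rfl, ← e1]
        congr 1
        ext u
        simp only [sliceX, expX, Set.mem_ofPred_eq, add_dotProduct, mul_add, sub_sub]) 0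
    simpa only [hφ] using this
  clear_value c
  have hφm : ∀ j, Measurable fun p : Vec n × ℝ => volume {a : W j → ℝ | (a, p) ∈ G j} :=
    fun j => measurable_measure_prodMk_right (hGm j)
  have hpt : ∀ p, ∫⁻ x, f p x ≤ c ^ (1 / E : ℝ) *
      ∏ j, volume {a : W j → ℝ | (a, p) ∈ G j} ^ (e j / E : ℝ) := by
    intro p
    have h1 := ENNReal.rpow_le_rpow (hfib p) (show (0 : ℝ) ≤ 1 / E by positivity)
    rw [← ENNReal.rpow_natCast, ← ENNReal.rpow_mul, mul_one_div_cancel hE', ENNReal.rpow_one,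
      ENNReal.mul_rpow_of_nonneg _ _ (by positivity),
      ← ENNReal.prod_rpow_of_nonneg (by positivity)] at h1
    refine h1.trans (le_of_eq ?_)
    congr 1
    refine Finset.prod_congr rfl fun j _ => ?_
    rw [← ENNReal.rpow_natCast, ← ENNReal.rpow_mul]
    congr 1
    ring
  have hint : volume A ≤ c ^ (1 / E : ℝ) * ∏ j, volume (projX (W j) '' A) ^ (e j / E : ℝ) := by
    rw [hvA]
    refine (lintegral_mono hpt).trans ?_
    rw [lintegral_const_mul _ (Finset.measurable_prod _ fun j _ => (hφm j).pow_const _)]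
    gcongr
    have := ENNReal.lintegral_prod_norm_pow_le (μ := (volume : Measure (Vec n × ℝ))) univ
      (f := fun j p => volume {a : W j → ℝ | (a, p) ∈ G j}) (p := fun j => (e j / E : ℝ))
      (fun j _ => (hφm j).aemeasurable) (by
        rw [← Finset.sum_div, ← Nat.cast_sum, ← hE, div_self hE'])
      (fun j _ => by positivity)
    simpa only [hφi] using this
  calc volume A ^ E ≤ _ := pow_le_pow_left' hint E
    _ = _ := by
      rw [mul_pow, ← Finset.prod_pow, ← ENNReal.rpow_natCast, ← ENNReal.rpow_mul,
        one_div_mul_cancel hE', ENNReal.rpow_one]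
      congr 1
      refine Finset.prod_congr rfl fun j _ => ?_
      rw [← ENNReal.rpow_natCast, ← ENNReal.rpow_natCast, ← ENNReal.rpow_mul,
        div_mul_cancel₀ _ hE']

end

section

/-- The triangular box of half side lengths `4 h i`. -/
def triBox {n : ℕ} (rk : Fin n → ℕ) (c : Fin n → Fin n → ℝ) (h : Fin n → ℝ) : Set (Vec n) :=
  {v | ∀ i, |triForm rk (c i) i v| ≤ 4 * h i}

theorem isClosed_triBox {n : ℕ} (rk : Fin n → ℕ) (c : Fin n → Fin n → ℝ) (h : Fin n → ℝ) :
    IsClosed (triBox rk c h) := by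
  have : triBox rk c h = ⋂ i, {v | |triForm rk (c i) i v| ≤ 4 * h i} := by ext; simp [triBox]
  rw [this]
  exact isClosed_iInter fun i => isClosed_le (continuous_triForm rk (c i) i).abs continuous_const

theorem abs_triForm_sub_le {n : ℕ} {rk : Fin n → ℕ} {c : Fin n → Fin n → ℝ} {h : Fin n → ℝ}
    {v v' : Vec n} (hv : v ∈ triBox rk c h) (hv' : v' ∈ triBox rk c h) (i : Fin n) :
    |triForm rk (c i) i (v - v')| ≤ 8 * h i := by
  rw [triForm_sub]
  have h1 := hv i
  have h2 := hv' i
  rw [abs_le] at *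
  constructor <;> linarith

theorem triForm_congr {n : ℕ} {rk : Fin n → ℕ} {c : Fin n → ℝ} {i : Fin n} {v v' : Vec n}
    (h : ∀ j, rk j ≤ rk i → v j = v' j) : triForm rk c i v = triForm rk c i v' := by
  rw [triForm, triForm, h i le_rfl]
  congr 1
  exact Finset.sum_congr rfl fun j hj => by
    rw [h j (le_of_lt (by simpa using hj))]

section Fiber

variable {n : ℕ} {ι : Type*} [Fintype ι] {V : ι → Finset (Fin n)} {e : ι → ℕ} {Q : Fin n → ℕ}
  {rk : Fin n → ℕ} {c : Fin n → Fin n → ℝ} {h : Fin n → ℝ}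

/-- Finner's inequality for subsets of a triangular box. -/
theorem volume_pow_le_of_subset_triBox (hrk : Function.Injective rk)
    (hQ : ∀ i, Q i = ∑ j with i ∉ V j, e j) {T : Set (Vec n)} (hT : MeasurableSet T)
    (hTc : T ⊆ triBox rk c h) {N : ℕ} (hN : ∀ i, N ≤ Q i) (hNe : N ≤ ∑ j, e j) :
    volume T ^ (∑ j, e j - N + 1) ≤ (∏ i, ENNReal.ofReal (8 * h i) ^ (Q i - N)) *
      (∏ j, volume (coordProj (V j) '' T) ^ e j) * volume T := by
  set w := ∑ j, e j - N + 1 with hw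
  have hw0 : (w : ℝ) ≠ 0 := by rw [hw]; positivity
  let G : ∀ j, Set (V j → ℝ) := fun j => toMeasurable volume (coordProj (V j) '' T)
  have hGm : ∀ j, MeasurableSet (G j) := fun j => measurableSet_toMeasurable _ _
  let W' : Option ι → Finset (Fin n) := fun o => o.elim univ V
  let g' : Option ι → Vec n → ℝ≥0∞ := fun o =>
    o.elim (T.indicator 1) fun j x => (G j).indicator 1 (coordProj (V j) x)
  let p' : Option ι → ℝ := fun o => o.elim (1 / w) fun j => e j / w
  have key := lmarginal_le_prod_rpow rk hrk W' g'
    (fun o => by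
      cases o with
      | none => exact measurable_one.indicator hT
      | some j => exact (measurable_one.indicator (hGm j)).comp (measurable_coordProj _))
    (fun o => by
      cases o with
      | none => exact fun x y hxy => by rw [show x = y from funext fun i => hxy i (mem_univ i)]
      | some j =>
        intro x y hxy
        have : coordProj (V j) x = coordProj (V j) y := by
          ext ⟨i, hi⟩
          exact hxy i hi
        simp only [g', Option.elim, this])
    p' (fun o => by
      cases o with
      | none => simp only [p', Option.elim]; positivity
      | some j => simp only [p', Option.elim]; positivity)
    (fun i => ((Q i - N : ℕ) : ℝ) / w) (fun i => by positivity)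
    (fun i => {v | |triForm rk (c i) i v| ≤ 4 * h i}) (fun i => ENNReal.ofReal (8 * h i))
    (fun i v hv v' hvv' => by
      change |triForm rk (c i) i v'| ≤ 4 * h i
      rw [← triForm_congr hvv']
      exact hv)
    (fun i v hv v' hv' hvv' => by
      rw [edist_dist, Real.dist_eq]
      refine ENNReal.ofReal_le_ofReal ?_
      have e1 : v i - v' i = triForm rk (c i) i v - triForm rk (c i) i v' := by
        rw [← triForm_sub, triForm_eq_of_forall_lt]
        · rfl
        · intro l hl
          have hli : l ≠ i := fun hli => by rw [hli] at hl; exact lt_irrefl _ hl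
          simp [hvv' l hli]
      have h1 : |triForm rk (c i) i v| ≤ 4 * h i := hv
      have h2 : |triForm rk (c i) i v'| ≤ 4 * h i := hv'
      rw [e1]
      rw [abs_le] at *
      constructor <;> linarith)
    (f := T.indicator 1) (measurable_one.indicator hT) (fun v => by
      by_cases hv : v ∈ T
      · rw [Set.indicator_of_mem hv]
        refine le_of_eq (Finset.prod_eq_one fun o _ => ?_).symm
        cases o with
        | none => simp [g', hv]
        | some j =>
          have : coordProj (V j) v ∈ G j := subset_toMeasurable _ _ ⟨v, hv, rfl⟩
          simp [g', this]
      · rw [Set.indicator_of_notMem hv]; exact zero_le)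
    univ (fun i _ v hv => hTc (Set.mem_of_indicator_ne_zero hv) i) (fun i _ => by
      rw [Finset.sum_filter, Fintype.sum_option]
      change ((Q i - N : ℕ) : ℝ) / w + ((if i ∈ univ then (1 / w : ℝ) else 0) +
        ∑ j, (if i ∈ V j then (e j / w : ℝ) else 0)) = 1
      rw [if_pos (mem_univ i), ← Finset.sum_filter, ← Finset.sum_div, ← add_div, ← add_div,
        div_eq_one_iff_eq hw0, hw]
      have h1 := Finset.sum_filter_add_sum_filter_not univ (fun j => i ∈ V j) e
      have h2 := hQ i
      have h3 := hN i
      have : Q i - N + (1 + ∑ j with i ∈ V j, e j) = ∑ j, e j - N + 1 := by omega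
      exact_mod_cast this) 0
  rw [Fintype.prod_option, lmarginal_univ] at key
  simp only [W', g', p', Option.elim, Finset.univ_inter, lmarginal_univ] at key
  have hφ : ∀ j, (∫⋯∫⁻_(V j), fun x => (G j).indicator 1 (coordProj (V j) x)) (0 : Vec n) =
      volume (coordProj (V j) '' T) := by
    intro j
    rw [← measure_toMeasurable (coordProj (V j) '' T), ← lintegral_indicator_one (hGm j)]
    unfold lmarginal
    refine lintegral_congr fun u => ?_
    have : coordProj (V j) (Function.updateFinset (0 : Vec n) (V j) u) = u := by
      ext ⟨i, hi⟩; simp [coordProj, Function.updateFinset, hi]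
    simp only [this]
  simp only [hφ] at key
  rw [lintegral_indicator_one hT] at key
  change volume T ≤ _ * ((volume T) ^ (1 / w : ℝ) * _) at key
  calc volume T ^ w ≤ _ := pow_le_pow_left' key w
    _ = _ := by
      rw [mul_pow, mul_pow, ← Finset.prod_pow, ← Finset.prod_pow, ← ENNReal.rpow_natCast _ w,
        ← ENNReal.rpow_mul, one_div_mul_cancel hw0, ENNReal.rpow_one, mul_assoc,
        mul_comm (volume T)]
      congr 1
      · refine Finset.prod_congr rfl fun i _ => ?_
        rw [← ENNReal.rpow_natCast, ← ENNReal.rpow_natCast, ← ENNReal.rpow_mul,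
          div_mul_cancel₀ _ hw0]
      · congr 1
        refine Finset.prod_congr rfl fun j _ => ?_
        rw [← ENNReal.rpow_natCast, ← ENNReal.rpow_natCast, ← ENNReal.rpow_mul,
          div_mul_cancel₀ _ hw0]

/-- Upper bounds for the fibers of coordinate projections by the sizes of sections. -/
theorem le_prod_of_sections {s : Finset (Fin n)} {F T : Set (Vec n)} (hT : MeasurableSet T)
    (hTF : T ⊆ F) (hb : Bornology.IsBounded F) (hT0 : volume T ≠ 0)
    (hFT : volume F ≤ 2 * volume T) {a : ℝ≥0∞} (ha : a * volume (coordProj s '' F) ≤ volume F)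
    (L : Fin n → ℝ≥0∞)
    (hL : ∀ v ∈ T, ∀ v' ∈ T, ∀ i ∉ s, (∀ j ∈ s, v j = v' j) →
      (∀ j ∉ s, rk j < rk i → v j = v' j) → edist (v i) (v' i) ≤ L i) :
    a ≤ 2 * ∏ i ∈ sᶜ, L i := by
  have h1 : volume T ≤ (∏ i ∈ sᶜ, L i) * volume (coordProj s '' T) := by
    refine volume_le_mul_coordProj (compl_compl s).symm hT fun x _ => ?_
    rw [volume_setOf_add_coordIncl _ hT]
    refine lmarginal_indicator_le_prod rk hT L _ (fun v hv v' hv' i hi h1 h2 => ?_) x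
    exact hL v hv v' hv' i (by simpa using hi) (fun j hj => h1 j (by simpa using hj))
      (fun j hj => h2 j (by simpa using hj))
  have hpt : volume (coordProj s '' F) ≠ ∞ := by
    obtain ⟨R, hR⟩ := hb.exists_norm_le
    have : Bornology.IsBounded (coordProj s '' F) := by
      refine isBounded_iff_forall_norm_le.2 ⟨|R|, ?_⟩
      rintro _ ⟨v, hv, rfl⟩
      refine (pi_norm_le_iff_of_nonneg (abs_nonneg _)).2 fun i => ?_
      exact (norm_le_pi_norm v i).trans ((hR v hv).trans (le_abs_self R))
    exact this.measure_lt_top.ne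
  have hp0 : volume (coordProj s '' F) ≠ 0 := by
    intro h0
    have : volume (coordProj s '' T) = 0 :=
      le_antisymm ((measure_mono (Set.image_mono hTF)).trans h0.le) zero_le
    rw [this, mul_zero] at h1
    exact hT0 (le_antisymm h1 zero_le)
  have h2 : a * volume (coordProj s '' F) ≤
      (2 * ∏ i ∈ sᶜ, L i) * volume (coordProj s '' F) := by
    refine ha.trans (hFT.trans ?_)
    rw [mul_assoc]
    gcongr
    exact h1.trans (by gcongr)
  exact (ENNReal.mul_le_mul_iff_left hp0 hpt).1 h2

/-- A sum of coordinates over an initial segment in terms of the triangular forms. -/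
theorem exists_sum_triForm (hrk : Function.Injective rk) (c : Fin n → Fin n → ℝ)
    (S : Finset (Fin n)) (hS : ∀ i ∈ S, ∀ j, rk j < rk i → j ∈ S) (a : Fin n → ℝ) :
    ∃ t : Fin n → ℝ, ∀ v : Vec n, ∑ i ∈ S, a i * v i = ∑ i ∈ S, t i * triForm rk (c i) i v := by
  induction S using Finset.induction_on_max_value rk generalizing a with
  | empty => exact ⟨0, by simp⟩
  | insert b s hbs hmax ih =>
    have hlow : ∀ i ∈ s, ∀ j, rk j < rk i → j ∈ s := fun i hi j hj => by
      rcases Finset.mem_insert.1 (hS i (mem_insert_of_mem hi) j hj) with rfl | hjs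
      · exact absurd hj (not_lt.2 (hmax i hi))
      · exact hjs
    have hset : (univ.filter fun j => rk j < rk b) = s := by
      ext j
      simp only [Finset.mem_filter, mem_univ, true_and]
      constructor
      · intro hj
        rcases Finset.mem_insert.1 (hS b (mem_insert_self _ _) j hj) with rfl | hjs
        · exact absurd hj (lt_irrefl _)
        · exact hjs
      · intro hj
        exact lt_of_le_of_ne (hmax j hj) fun heq => hbs (hrk heq ▸ hj)
    obtain ⟨t, ht⟩ := ih hlow fun i => a i + a b * c b i
    refine ⟨fun i => if i = b then a b else t i, fun v => ?_⟩
    rw [Finset.sum_insert hbs, Finset.sum_insert hbs]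
    beta_reduce
    rw [if_pos rfl]
    have e1 : ∑ i ∈ s, (if i = b then a b else t i) * triForm rk (c i) i v =
        ∑ i ∈ s, t i * triForm rk (c i) i v := Finset.sum_congr rfl fun i hi => by
      rw [if_neg fun hib : i = b => hbs (hib ▸ hi)]
    rw [e1, ← ht, triForm, hset, mul_sub, Finset.mul_sum]
    simp only [add_mul, Finset.sum_add_distrib, mul_assoc]
    ring

theorem add_sum_le_pow (rk : Fin n → ℕ) (x : Fin n → ℝ) {D a : ℝ} (hD : 0 ≤ D)
    (S : Finset (Fin n))
    (hx : ∀ i ∈ S, x i ≤ D * (a + ∑ j ∈ S with rk i < rk j, x j)) (hx0 : ∀ i, 0 ≤ x i) :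
    a + ∑ i ∈ S, x i ≤ (1 + D) ^ #S * a := by
  induction S using Finset.induction_on_min_value rk with
  | empty => simp
  | insert b s hbs hmin ih =>
    have hb : x b ≤ D * (a + ∑ j ∈ s, x j) := by
      refine (hx b (mem_insert_self _ _)).trans ?_
      refine mul_le_mul_of_nonneg_left (add_le_add_right ?_ _) hD
      refine Finset.sum_le_sum_of_subset_of_nonneg ?_ fun i _ _ => hx0 i
      · intro j hj
        obtain ⟨hj1, hj2⟩ := Finset.mem_filter.1 hj
        rcases Finset.mem_insert.1 hj1 with rfl | hjs
        · exact absurd hj2 (lt_irrefl _)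
        · exact hjs
    have hs := ih fun i hi => by
      refine (hx i (mem_insert_of_mem hi)).trans ?_
      refine mul_le_mul_of_nonneg_left (add_le_add_right ?_ _) hD
      refine Finset.sum_le_sum_of_subset_of_nonneg ?_ fun i _ _ => hx0 i
      · intro j hj
        obtain ⟨hj1, hj2⟩ := Finset.mem_filter.1 hj
        rcases Finset.mem_insert.1 hj1 with rfl | hjs
        · exact absurd hj2 (not_lt.2 (hmin i hi))
        · exact Finset.mem_filter.2 ⟨hjs, hj2⟩
    rw [Finset.sum_insert hbs, Finset.card_insert_of_notMem hbs, pow_succ]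
    calc a + (x b + ∑ i ∈ s, x i) ≤ (1 + D) * (a + ∑ j ∈ s, x j) := by linarith
      _ ≤ (1 + D) * ((1 + D) ^ #s * a) := by gcongr
      _ = _ := by ring

end Fiber

end

section

section FiberReal

variable {n : ℕ} {ι : Type*} [Fintype ι] {V : ι → Finset (Fin n)} {e : ι → ℕ} {Q : Fin n → ℕ}
  {rk : Fin n → ℕ} {c : Fin n → Fin n → ℝ} {h : Fin n → ℝ} {a : ι → ℝ} {F T : Set (Vec n)}

theorem isBounded_image_coordProj (s : Finset (Fin n)) (hb : Bornology.IsBounded F) :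
    Bornology.IsBounded (coordProj s '' F) := by
  obtain ⟨R, hR⟩ := hb.exists_norm_le
  refine isBounded_iff_forall_norm_le.2 ⟨|R|, ?_⟩
  rintro _ ⟨v, hv, rfl⟩
  refine (pi_norm_le_iff_of_nonneg (abs_nonneg _)).2 fun i => ?_
  exact (norm_le_pi_norm v i).trans ((hR v hv).trans (le_abs_self R))

theorem prod_pow_le_of_subset_triBox (hrk : Function.Injective rk)
    (hQ : ∀ i, Q i = ∑ j with i ∉ V j, e j) (hh : ∀ i, 0 < h i) (hT : MeasurableSet T)
    (hTF : T ⊆ F) (hTc : T ⊆ triBox rk c h) (hb : Bornology.IsBounded F)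
    (hT0 : 0 < volume.real T) (hFT : volume.real F ≤ 2 * volume.real T) (ha : ∀ j, 0 ≤ a j)
    (haF : ∀ j, a j * volume.real (coordProj (V j) '' F) ≤ volume.real F)
    {N : ℕ} (hN : ∀ i, N ≤ Q i) (hNe : N ≤ ∑ j, e j) :
    ∏ j, a j ^ e j ≤ 2 ^ (∑ j, e j) * 8 ^ (∑ i, Q i) *
      ((∏ i, h i ^ (Q i - N)) * volume.real F ^ N) := by
  have key := volume_pow_le_of_subset_triBox hrk hQ hT hTc hN hNe
  have hFfin : volume F ≠ ∞ := hb.measure_lt_top.ne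
  have hPfin : ∀ j, volume (coordProj (V j) '' T) ≠ ∞ := fun j =>
    (isBounded_image_coordProj _ (hb.subset hTF)).measure_lt_top.ne
  have hTfin : volume T ≠ ∞ := (hb.subset hTF).measure_lt_top.ne
  have key2 := ENNReal.toReal_mono (ENNReal.mul_ne_top (ENNReal.mul_ne_top
    (ENNReal.prod_ne_top fun i _ => ENNReal.pow_ne_top ENNReal.ofReal_ne_top)
    (ENNReal.prod_ne_top fun j _ => ENNReal.pow_ne_top (hPfin j))) hTfin) key
  simp only [ENNReal.toReal_mul, ENNReal.toReal_pow, ENNReal.toReal_prod, ← measureReal_def] at key2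
  have h8 : ∀ i, (ENNReal.ofReal (8 * h i)).toReal = 8 * h i := fun i =>
    ENNReal.toReal_ofReal (by have := hh i; positivity)
  simp only [h8] at key2
  set E := ∑ j, e j with hE
  set t := volume.real T
  set f := volume.real F
  have hf0 : 0 < f := hT0.trans_le (measureReal_mono hTF hFfin)
  rw [pow_succ] at key2
  have key3 := le_of_mul_le_mul_right key2 hT0
  have hprod : (∏ j, a j ^ e j) * ∏ j, volume.real (coordProj (V j) '' T) ^ e j ≤ f ^ E := by
    rw [hE, ← Finset.prod_pow_eq_pow_sum, ← Finset.prod_mul_distrib]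
    refine Finset.prod_le_prod (fun j _ => ?_) fun j _ => ?_
    · have := ha j; positivity
    · rw [← mul_pow]
      refine pow_le_pow_left₀ (mul_nonneg (ha j) measureReal_nonneg) ?_ _
      exact (mul_le_mul_of_nonneg_left (measureReal_mono (Set.image_mono hTF)
        (isBounded_image_coordProj _ hb).measure_lt_top.ne) (ha j)).trans (haF j)
  have hA0 : 0 ≤ ∏ j, a j ^ e j := Finset.prod_nonneg fun j _ => pow_nonneg (ha j) _
  have h88 : ∏ i, (8 * h i) ^ (Q i - N) ≤ 8 ^ (∑ i, Q i) * ∏ i, h i ^ (Q i - N) := by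
    rw [← Finset.prod_pow_eq_pow_sum, ← Finset.prod_mul_distrib]
    refine Finset.prod_le_prod (fun i _ => by have := hh i; positivity) fun i _ => ?_
    rw [mul_pow]
    have := hh i
    gcongr
    · norm_num
    · omega
  have hH0 : 0 ≤ ∏ i, h i ^ (Q i - N) := Finset.prod_nonneg fun i _ => pow_nonneg (hh i).le _
  have hpos : 0 < f ^ (E - N) := by positivity
  refine le_of_mul_le_mul_right ?_ hpos
  calc (∏ j, a j ^ e j) * f ^ (E - N) ≤ (∏ j, a j ^ e j) * (2 * t) ^ (E - N) := by gcongr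
    _ = 2 ^ (E - N) * ((∏ j, a j ^ e j) * t ^ (E - N)) := by rw [mul_pow]; ring
    _ ≤ 2 ^ E * ((∏ j, a j ^ e j) * ((∏ i, (8 * h i) ^ (Q i - N)) *
        ∏ j, volume.real (coordProj (V j) '' T) ^ e j)) := by
      gcongr
      · norm_num
      · omega
    _ = 2 ^ E * (∏ i, (8 * h i) ^ (Q i - N)) *
        ((∏ j, a j ^ e j) * ∏ j, volume.real (coordProj (V j) '' T) ^ e j) := by ring
    _ ≤ 2 ^ E * (8 ^ (∑ i, Q i) * ∏ i, h i ^ (Q i - N)) * f ^ E := by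
      have h3 : 0 ≤ ∏ i, (8 * h i) ^ (Q i - N) :=
        Finset.prod_nonneg fun i _ => pow_nonneg (by have := hh i; positivity) _
      gcongr
    _ = _ := by
      rw [show f ^ E = f ^ N * f ^ (E - N) by rw [← pow_add]; congr 1; omega]; ring


theorem le_two_mul_prod_of_sections {ι : Type*} {V : ι → Finset (Fin n)} {a : ι → ℝ} (j : ι)
    (hT : MeasurableSet T)
    (hTF : T ⊆ F) (hb : Bornology.IsBounded F)
    (hT0 : 0 < volume.real T) (hFT : volume.real F ≤ 2 * volume.real T) (ha : 0 ≤ a j)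
    (haF : a j * volume.real (coordProj (V j) '' F) ≤ volume.real F)
    (L : Fin n → ℝ) (hL0 : ∀ i, 0 ≤ L i)
    (hL : ∀ v ∈ T, ∀ v' ∈ T, ∀ i ∉ V j, (∀ l ∈ V j, v l = v' l) →
      (∀ l, rk l < rk i → v l = v' l) → |v i - v' i| ≤ L i) :
    a j ≤ 2 * ∏ i ∈ (V j)ᶜ, L i := by
  have hFfin : volume F ≠ ∞ := hb.measure_lt_top.ne
  have hTfin : volume T ≠ ∞ := (hb.subset hTF).measure_lt_top.ne
  have hPfin : volume (coordProj (V j) '' F) ≠ ∞ :=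
    (isBounded_image_coordProj _ hb).measure_lt_top.ne
  have key := le_prod_of_sections (rk := rk) (s := V j) (F := F) (T := T) hT hTF hb
    (fun h0 => by rw [measureReal_def, h0] at hT0; exact lt_irrefl _ hT0)
    (by
      rw [← ENNReal.toReal_le_toReal hFfin (ENNReal.mul_ne_top ENNReal.ofNat_ne_top hTfin)]
      simpa [measureReal_def] using hFT)
    (a := ENNReal.ofReal (a j))
    (by
      rw [← ENNReal.toReal_le_toReal (ENNReal.mul_ne_top ENNReal.ofReal_ne_top hPfin) hFfin]
      rw [ENNReal.toReal_mul, ENNReal.toReal_ofReal ha]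
      exact haF)
    (fun i => ENNReal.ofReal (L i)) (fun v hv v' hv' i hi h1 h2 => by
      rw [edist_dist, Real.dist_eq]
      refine ENNReal.ofReal_le_ofReal (hL v hv v' hv' i hi h1 fun l hl => ?_)
      by_cases hlV : l ∈ V j
      · exact h1 l hlV
      · exact h2 l hlV hl)
  rw [← ENNReal.ofReal_prod_of_nonneg fun i _ => hL0 i, ← ENNReal.ofReal_ofNat 2,
    ← ENNReal.ofReal_mul (by norm_num)] at key
  exact (ENNReal.ofReal_le_ofReal_iff
    (mul_nonneg (by norm_num) (Finset.prod_nonneg fun i _ => hL0 i))).1 key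

theorem prod_prod_compl (hQ : ∀ i, Q i = ∑ j with i ∉ V j, e j) (x : Fin n → ℝ) :
    ∏ j, (2 * ∏ i ∈ (V j)ᶜ, (8 * x i)) ^ e j =
      2 ^ (∑ j, e j) * 8 ^ (∑ i, Q i) * ∏ i, x i ^ Q i := by
  simp only [mul_pow, Finset.prod_mul_distrib, Finset.prod_pow_eq_pow_sum, mul_assoc]
  congr 1
  rw [← Finset.prod_pow_eq_pow_sum, ← Finset.prod_mul_distrib]
  calc ∏ j, ((∏ i ∈ (V j)ᶜ, (8 : ℝ)) ^ e j * (∏ i ∈ (V j)ᶜ, x i) ^ e j)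
      = ∏ j, ∏ i, (if i ∉ V j then (8 * x i) ^ e j else 1) := by
        refine Finset.prod_congr rfl fun j _ => ?_
        rw [← mul_pow, ← Finset.prod_mul_distrib, ← Finset.prod_pow, ← Finset.prod_filter]
        refine Finset.prod_congr ?_ fun _ _ => rfl
        ext; simp
    _ = ∏ i, ∏ j, (if i ∉ V j then (8 * x i) ^ e j else 1) := Finset.prod_comm
    _ = (∏ i, 8 ^ Q i) * ∏ i, x i ^ Q i := by
        rw [← Finset.prod_mul_distrib]
        refine Finset.prod_congr rfl fun i _ => ?_
        rw [← Finset.prod_filter, Finset.prod_pow_eq_pow_sum, ← hQ, mul_pow]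

theorem exists_separating (he : ∀ j, 0 < e j) (hQ : ∀ i, Q i = ∑ j with i ∉ V j, e j)
    {i b : Fin n} (hib : Q b ≤ Q i) (hne : ¬ ∀ j, i ∈ V j ↔ b ∈ V j) : ∃ j, i ∉ V j ∧ b ∈ V j := by
  by_contra hcon
  push Not at hcon
  have hsub : (univ.filter fun j => i ∉ V j) ⊆ univ.filter fun j => b ∉ V j := fun j hj => by
    have := hcon j (by simpa using hj)
    simpa using this
  push Not at hne
  obtain ⟨j, hj⟩ := hne
  have hlt : Q i < Q b := by
    rw [hQ, hQ]
    refine Finset.sum_lt_sum_of_subset hsub (i := j) ?_ ?_ (he j) fun _ _ _ => Nat.zero_le _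
    · simp only [Finset.mem_filter, mem_univ, true_and]
      intro hb
      rcases hj with ⟨_, h2⟩ | ⟨h1, _⟩
      · exact h2 hb
      · exact hcon j h1 hb
    · simp only [Finset.mem_filter, mem_univ, true_and, not_not]
      by_contra hi
      have := hcon j hi
      tauto
  omega

/-- If the section bounds nearly saturate the product of the `a j`, then the triangular box is
comparable to one whose forms only involve coordinates that are not separated by the `V j`. -/
theorem abs_triForm_class_le [DecidableEq ι] (hrk : Function.Injective rk) (he : ∀ j, 0 < e j)
    (hQ : ∀ i, Q i = ∑ j with i ∉ V j, e j) (hanti : ∀ i i', rk i ≤ rk i' → Q i' ≤ Q i)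
    (cls : Fin n → Finset ι) (hcls : ∀ i j, j ∈ cls i ↔ i ∈ V j)
    (hcont : ∀ i j k, rk i ≤ rk j → rk j ≤ rk k → cls i = cls k → cls j = cls k)
    (hh : ∀ i, 0 < h i) (hT : MeasurableSet T)
    (hTF : T ⊆ F) (hTc : T ⊆ triBox rk c h) (hb : Bornology.IsBounded F)
    (hT0 : 0 < volume.real T) (hFT : volume.real F ≤ 2 * volume.real T) (ha : ∀ j, 0 ≤ a j)
    (haF : ∀ j, a j * volume.real (coordProj (V j) '' F) ≤ volume.real F)
    {κ : ℝ} (hκ : 0 < κ) (hκa : κ * ∏ i, h i ^ Q i ≤ ∏ j, a j ^ e j) (b : Fin n) {v : Vec n}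
    (hv : v ∈ triBox rk c h) :
    |triForm rk (fun j => if cls j = cls b then c b j else 0) b v| ≤
      4 * (1 + 2 ^ (∑ j, e j) * 8 ^ (∑ i, Q i) / κ) ^ n * h b := by
  set S : Finset (Fin n) := univ.filter fun i => rk i < rk b ∧ cls i ≠ cls b with hS
  obtain ⟨t, ht⟩ := exists_sum_triForm hrk c S (fun i hi j hj => by
    simp only [hS, Finset.mem_filter, mem_univ, true_and] at hi ⊢
    refine ⟨hj.trans hi.1, fun hjb => hi.2 ?_⟩
    exact hcont j i b hj.le hi.1.le hjb) (c b)
  have hform : ∀ w : Vec n, triForm rk (fun j => if cls j = cls b then c b j else 0) b w =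
      triForm rk (c b) b w + ∑ i ∈ S, t i * triForm rk (c i) i w := by
    intro w
    rw [← ht w, triForm, triForm]
    have e1 : ∑ j with rk j < rk b, c b j * w j =
        ∑ j with rk j < rk b, (if cls j = cls b then c b j else 0) * w j +
          ∑ i ∈ S, c b i * w i := by
      rw [hS, ← Finset.filter_filter, Finset.sum_filter (fun i => cls i ≠ cls b),
        ← Finset.sum_add_distrib]
      refine Finset.sum_congr rfl fun j _ => ?_
      by_cases hj : cls j = cls b <;> simp [hj]
    rw [e1]
    ring
  set C1 : ℝ := 2 ^ (∑ j, e j) * 8 ^ (∑ i, Q i) with hC1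
  have hC10 : 0 < C1 := by positivity
  have hD : 0 ≤ C1 / κ := by positivity
  have hdiff : ∀ v ∈ T, ∀ v' ∈ T, ∀ i, |triForm rk (c i) i (v - v')| ≤ 8 * h i :=
    fun v hv v' hv' i => abs_triForm_sub_le (hTc hv) (hTc hv') i
  have hdiag : ∀ (w : Vec n) (i : Fin n), (∀ l, rk l < rk i → w l = 0) →
      triForm rk (c i) i w = w i := fun w i hw => triForm_eq_of_forall_lt hw
  have hgen : ∀ j, a j ≤ 2 * ∏ i ∈ (V j)ᶜ, (8 * h i) := fun j =>
    le_two_mul_prod_of_sections (rk := rk) j hT hTF hb hT0 hFT (ha j) (haF j) (fun i => 8 * h i)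
      (fun i => by have := hh i; positivity) fun v hv v' hv' i _ _ h2 => by
        have := hdiff v hv v' hv' i
        rwa [hdiag (v - v') i fun l hl => by simp [h2 l hl]] at this
  have hstep : ∀ i ∈ S, |t i| * h i ≤
      C1 / κ * (h b + ∑ j ∈ S with rk i < rk j, |t j| * h j) := by
    intro i hi
    set R := h b + ∑ j ∈ S with rk i < rk j, |t j| * h j with hR
    have hR0 : 0 < R := add_pos_of_pos_of_nonneg (hh b)
      (Finset.sum_nonneg fun j _ => mul_nonneg (abs_nonneg _) (hh j).le)
    by_cases hti : t i = 0
    · rw [hti, abs_zero, zero_mul]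
      positivity
    have hti' : 0 < |t i| := abs_pos.2 hti
    obtain ⟨hib, hclsne⟩ := (Finset.mem_filter.1 hi).2
    obtain ⟨j, hij, hbj⟩ := exists_separating he hQ (hanti i b hib.le) (fun hall => hclsne (by
      ext j; rw [hcls, hcls]; exact hall j))
    have hbound : ∀ v ∈ T, ∀ v' ∈ T, (∀ l ∈ V j, v l = v' l) →
        (∀ l, rk l < rk i → v l = v' l) → |v i - v' i| ≤ 8 * (R / |t i|) := by
      intro v hv v' hv' h1 h2
      have hw := hform (v - v')
      have hz : triForm rk (fun j => if cls j = cls b then c b j else 0) b (v - v') = 0 := by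
        rw [triForm, Finset.sum_eq_zero]
        · simp [h1 b hbj]
        · intro l _
          by_cases hl : cls l = cls b
          · have : l ∈ V j := by rw [← hcls, hl, hcls]; exact hbj
            simp [h1 l this]
          · simp [hl]
      rw [hz, ← Finset.add_sum_erase S _ hi,
        hdiag (v - v') i fun l hl => by simp [h2 l hl]] at hw
      have hsum : ∑ l ∈ S.erase i, t l * triForm rk (c l) l (v - v') =
          ∑ l ∈ S with rk i < rk l, t l * triForm rk (c l) l (v - v') := by
        symm
        refine Finset.sum_subset (fun l hl => ?_) fun l hl hl' => ?_
        · obtain ⟨hl1, hl2⟩ := Finset.mem_filter.1 hl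
          exact Finset.mem_erase.2 ⟨fun hli => by rw [hli] at hl2; exact lt_irrefl _ hl2, hl1⟩
        · obtain ⟨hl1, hl2⟩ := Finset.mem_erase.1 hl
          have hlt : rk l < rk i := by
            refine lt_of_le_of_ne ?_ fun heq => hl1 (hrk heq)
            by_contra hcon
            exact hl' (Finset.mem_filter.2 ⟨hl2, by omega⟩)
          rw [hdiag (v - v') l fun k hk => by simp [h2 k (hk.trans hlt)]]
          simp [h2 l hlt]
      rw [hsum] at hw
      have e1 : t i * (v - v') i = -(triForm rk (c b) b (v - v') +
          ∑ l ∈ S with rk i < rk l, t l * triForm rk (c l) l (v - v')) := by linarith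
      have e2 : |t i| * |v i - v' i| ≤ 8 * R := by
        rw [← abs_mul]
        change |t i * (v - v') i| ≤ _
        rw [e1, abs_neg, hR, mul_add, Finset.mul_sum]
        refine (abs_add_le _ _).trans (add_le_add (hdiff v hv v' hv' b) ?_)
        refine (Finset.abs_sum_le_sum_abs _ _).trans (Finset.sum_le_sum fun l _ => ?_)
        rw [abs_mul]
        have := mul_le_mul_of_nonneg_left (hdiff v hv v' hv' l) (abs_nonneg (t l))
        linarith
      rw [← mul_div_assoc, le_div_iff₀ hti']
      linarith
    have hj := le_two_mul_prod_of_sections (rk := rk) j hT hTF hb hT0 hFT (ha j) (haF j)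
      (fun l => 8 * (if l = i then R / |t i| else h l))
      (fun l => by have := hh l; split_ifs <;> positivity) fun v hv v' hv' l _ h1 h2 => by
        by_cases hl : l = i
        · subst hl
          simp only [if_true]
          exact hbound v hv v' hv' h1 h2
        · simp only [hl, if_false]
          have := hdiff v hv v' hv' l
          rwa [hdiag (v - v') l fun k hk => by simp [h2 k hk]] at this
    set G : ι → ℝ := fun j => 2 * ∏ i ∈ (V j)ᶜ, (8 * h i) with hG
    have hG0 : ∀ j, 0 < G j := fun j =>
      mul_pos (by norm_num) (Finset.prod_pos fun i _ => by have := hh i; positivity)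
    have hj' : a j ≤ G j * (R / (|t i| * h i)) := by
      refine hj.trans (le_of_eq ?_)
      have hic : i ∈ (V j)ᶜ := by simpa using hij
      rw [hG]
      simp only
      rw [← Finset.mul_prod_erase _ _ hic, ← Finset.mul_prod_erase _ (fun i => 8 * h i) hic]
      rw [Finset.prod_congr rfl fun l hl => by rw [if_neg (Finset.ne_of_mem_erase hl)]]
      have := (hh i).ne'
      simp only [if_true]
      field_simp
    have hGprod : ∏ j, G j ^ e j = C1 * ∏ i, h i ^ Q i := prod_prod_compl hQ h
    have hfin : ∏ j, a j ^ e j ≤ (∏ j, G j ^ e j) * (R / (|t i| * h i)) := by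
      rw [← Finset.mul_prod_erase _ _ (mem_univ j),
        ← Finset.mul_prod_erase _ (fun j => G j ^ e j) (mem_univ j)]
      have e1 : a j ^ e j ≤ G j ^ e j * (R / (|t i| * h i)) := by
        obtain ⟨k, hk⟩ := Nat.exists_eq_succ_of_ne_zero (he j).ne'
        rw [hk, Nat.succ_eq_add_one, pow_succ, pow_succ, mul_assoc]
        exact mul_le_mul (pow_le_pow_left₀ (ha j) (hgen j) _) hj' (ha j)
          (pow_nonneg (hG0 j).le _)
      have e2 : ∏ l ∈ univ.erase j, a l ^ e l ≤ ∏ l ∈ univ.erase j, G l ^ e l :=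
        Finset.prod_le_prod (fun l _ => pow_nonneg (ha l) _) fun l _ =>
          pow_le_pow_left₀ (ha l) (hgen l) _
      calc _ ≤ (G j ^ e j * (R / (|t i| * h i))) * ∏ l ∈ univ.erase j, G l ^ e l :=
            mul_le_mul e1 e2 (Finset.prod_nonneg fun l _ => pow_nonneg (ha l) _)
              ((pow_nonneg (ha j) _).trans e1)
        _ = _ := by ring
    rw [hGprod] at hfin
    have hH0 : 0 < ∏ i, h i ^ Q i := Finset.prod_pos fun i _ => pow_pos (hh i) _
    have h3 := hκa.trans hfin
    have h4 : κ ≤ C1 * (R / (|t i| * h i)) := by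
      refine le_of_mul_le_mul_right ?_ hH0
      linarith
    have hpos : 0 < |t i| * h i := mul_pos hti' (hh i)
    rw [← mul_div_assoc, le_div_iff₀ hpos] at h4
    rw [div_mul_eq_mul_div, le_div_iff₀ hκ]
    linarith
  have hsum := add_sum_le_pow rk (fun i => |t i| * h i) hD S hstep
    fun i => mul_nonneg (abs_nonneg _) (hh i).le
  have hcard : (1 + C1 / κ) ^ #S ≤ (1 + C1 / κ) ^ n := by
    refine pow_le_pow_right₀ (by linarith) ?_
    exact (card_le_univ S).trans_eq (Fintype.card_fin n)
  rw [hform]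
  calc |triForm rk (c b) b v + ∑ i ∈ S, t i * triForm rk (c i) i v|
      ≤ 4 * h b + ∑ i ∈ S, 4 * (|t i| * h i) := by
        refine (abs_add_le _ _).trans (add_le_add (hv b) ?_)
        refine (Finset.abs_sum_le_sum_abs _ _).trans (Finset.sum_le_sum fun l _ => ?_)
        rw [abs_mul]
        have := mul_le_mul_of_nonneg_left (hv l) (abs_nonneg (t l))
        linarith
    _ = 4 * (h b + ∑ i ∈ S, |t i| * h i) := by rw [← Finset.mul_sum]; ring
    _ ≤ 4 * ((1 + C1 / κ) ^ #S * h b) := by gcongr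
    _ ≤ 4 * ((1 + C1 / κ) ^ n * h b) := by
      have := hh b
      gcongr
    _ = _ := by ring

end FiberReal

end

section

theorem mem_coordSubspace_iff {n : ℕ} {s : Finset (Fin n)} {x : Vec n} :
    x ∈ coordSubspace s ↔ ∀ i ∉ s, x i = 0 := by
  constructor
  · intro hx i hi
    unfold coordSubspace at hx
    induction hx using Submodule.span_induction with
    | mem x hx =>
      obtain ⟨k, hk, rfl⟩ := hx
      have : i ≠ k := fun hik => hi (hik ▸ hk)
      simp [this]
    | zero => rfl
    | add x y _ _ hx hy => simp [hx, hy]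
    | smul a x _ hx => simp [hx]
  · intro hx
    have : x = ∑ i ∈ s, x i • (Pi.single i (1 : ℝ) : Vec n) := by
      ext k
      rw [Finset.sum_apply]
      by_cases hk : k ∈ s
      · rw [Finset.sum_eq_single k (fun i _ hik => by simp [hik.symm]) (fun h => absurd hk h)]
        simp
      · rw [hx k hk, Finset.sum_eq_zero]
        intro i hi
        have : k ≠ i := fun hki => hk (hki ▸ hi)
        simp [this]
    rw [this]
    exact Submodule.sum_mem _ fun i hi =>
      Submodule.smul_mem _ _ (Submodule.subset_span ⟨i, hi, rfl⟩)

/-- The classes of coordinates that are not separated by the `V j` give a maximal partition. -/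
theorem exists_isMaximalPartition {n : ℕ} (hn : 0 < n) {ι : Type*} [DecidableEq ι]
    (V : ι → Finset (Fin n)) (cls : Fin n → Finset ι) (hcls : ∀ i j, j ∈ cls i ↔ i ∈ V j) :
    ∃ (d : ℕ) (U : Fin d → Submodule ℝ (Vec n)), IsMaximalPartition V U ∧
      ∀ i, ∃ a, ∀ x : Vec n, (∀ k, cls k ≠ cls i → x k = 0) → x ∈ U a := by
  let ε := (univ.image cls).equivFin
  let s : Fin #(univ.image cls) → Finset (Fin n) := fun a =>
    univ.filter fun i => cls i = (ε.symm a : Finset ι)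
  have hs : ∀ i, ∃ a, ∀ k, k ∈ s a ↔ cls k = cls i := fun i =>
    ⟨ε ⟨cls i, mem_image_of_mem _ (mem_univ i)⟩, fun k => by simp [s]⟩
  have hdisj : ∀ a a' i, i ∈ s a → i ∈ s a' → a = a' := by
    intro a a' i h1 h2
    simp only [s, Finset.mem_filter, mem_univ, true_and] at h1 h2
    exact ε.symm.injective (Subtype.ext (h1.symm.trans h2))
  refine ⟨_, fun a => coordSubspace (s a), ⟨fun a => ⟨s a, rfl⟩, ?_, ?_, ?_⟩, fun i => ?_⟩
  · refine DirectSum.isInternal_submodule_of_iSupIndep_of_iSup_eq_top ?_ ?_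
    · intro a
      have hle : ⨆ (a') (_ : a' ≠ a), coordSubspace (s a') ≤ coordSubspace (s a)ᶜ := by
        refine iSup₂_le fun a' ha' x hx => ?_
        rw [mem_coordSubspace_iff] at hx ⊢
        intro i hi
        refine hx i fun hi' => ha' (hdisj _ _ i hi' (by simpa using hi))
      refine Disjoint.mono_right hle ?_
      rw [Submodule.disjoint_def]
      intro x h1 h2
      rw [mem_coordSubspace_iff] at h1 h2
      ext i
      by_cases hi : i ∈ s a
      · exact h2 i (by simpa using hi)
      · exact h1 i hi
    · rw [eq_top_iff]
      intro x _
      have : x = ∑ i, x i • (Pi.single i (1 : ℝ) : Vec n) := by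
        ext k
        rw [Finset.sum_apply, Finset.sum_eq_single k (fun i _ hik => by simp [hik.symm])
          (fun h => absurd (mem_univ k) h)]
        simp
      rw [this]
      refine Submodule.sum_mem _ fun i _ => Submodule.smul_mem _ _ ?_
      obtain ⟨a, ha⟩ := hs i
      exact Submodule.mem_iSup_of_mem a (Submodule.subset_span ⟨i, (ha i).2 rfl, rfl⟩)
  · intro a j
    have hcase : ∀ i ∈ s a, ∀ k ∈ s a, (i ∈ V j ↔ k ∈ V j) := by
      intro i hi k hk
      simp only [s, Finset.mem_filter, mem_univ, true_and] at hi hk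
      rw [← hcls, ← hcls, hi, hk]
    by_cases hex : ∃ i ∈ s a, i ∈ V j
    · obtain ⟨i, hi, hij⟩ := hex
      right
      intro x hx
      rw [mem_coordSubspace_iff] at hx ⊢
      exact fun k hk => hx k fun hks => hk ((hcase i hi k hks).1 hij)
    · left
      intro x hx
      rw [mem_coordSubspace_iff] at hx ⊢
      exact fun k hk => hx k fun hks => hex ⟨k, hks, by simpa using hk⟩
  · intro W hW
    by_cases hex : ∃ w ∈ W, ∃ i, w i ≠ 0
    · obtain ⟨w, hwW, i, hwi⟩ := hex
      obtain ⟨a, ha⟩ := hs i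
      refine ⟨a, fun x hx => ?_⟩
      rw [mem_coordSubspace_iff]
      intro k hk
      rw [ha] at hk
      have : ∃ j, ¬ (k ∈ V j ↔ i ∈ V j) := by
        by_contra hcon
        push Not at hcon
        exact hk (by ext j; rw [hcls, hcls]; exact hcon j)
      obtain ⟨j, hj⟩ := this
      rcases hW j with h | h
      · have hi : i ∉ V j := fun hi => hwi (mem_coordSubspace_iff.1 (h hwW) i (by simpa using hi))
        exact mem_coordSubspace_iff.1 (h hx) k (by simp; tauto)
      · have hi : i ∈ V j := by
          by_contra hi
          exact hwi (mem_coordSubspace_iff.1 (h hwW) i hi)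
        exact mem_coordSubspace_iff.1 (h hx) k (by tauto)
    · push Not at hex
      obtain ⟨a, _⟩ := hs ⟨0, hn⟩
      exact ⟨a, fun x hx => mem_coordSubspace_iff.2 fun i _ => hex x hx i⟩
  · obtain ⟨a, ha⟩ := hs i
    exact ⟨a, fun x hx => mem_coordSubspace_iff.2 fun k hk => hx k fun hki => hk ((ha k).2 hki)⟩

/-- A real symmetric block diagonal matrix has an orthonormal eigenbasis adapted to the blocks. -/
theorem exists_block_eigenbasis {n : ℕ} {γ : Type*} [DecidableEq γ] (cls : Fin n → γ)
    (A : Matrix (Fin n) (Fin n) ℝ) (hA : A.IsHermitian)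
    (hblock : ∀ i k, cls i ≠ cls k → A i k = 0) :
    ∃ (b : Fin n → Vec n) (lam : Fin n → ℝ),
      (∀ i k, b i ⬝ᵥ b k = if i = k then 1 else 0) ∧
      (∀ i k, cls k ≠ cls i → b i k = 0) ∧ ∀ i, A *ᵥ b i = lam i • b i := by
  have hM : ∀ κ, (A.submatrix (Subtype.val : {i // cls i = κ} → Fin n) Subtype.val).IsHermitian :=
    fun κ => hA.submatrix _
  let ex : ∀ κ, ({i // cls i = κ} → ℝ) → Vec n := fun κ u i =>
    if h : cls i = κ then u ⟨i, h⟩ else 0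
  have hsum : ∀ (κ) (u : {i // cls i = κ} → ℝ) (x : Vec n),
      ∑ i, x i * ex κ u i = ∑ l : {i // cls i = κ}, x l * u l := by
    intro κ u x
    have h1 := Finset.sum_subtype (F := inferInstance) (univ.filter fun i => cls i = κ)
      (p := fun i => cls i = κ)
      (by simp) fun i => x i * ex κ u i
    rw [Finset.sum_filter_of_ne fun i _ hi => by
      by_contra h
      exact hi (by simp [ex, h])] at h1
    rw [h1]
    exact Finset.sum_congr rfl fun l _ => by simp [ex, l.2]
  let w : ∀ κ, {i // cls i = κ} → ({i // cls i = κ} → ℝ) := fun κ l =>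
    ((hM κ).eigenvectorBasis l : EuclideanSpace ℝ _)
  have horth : ∀ κ (l l' : {i // cls i = κ}),
      ∑ k, w κ l k * w κ l' k = if l = l' then 1 else 0 := by
    intro κ l l'
    rw [← (orthonormal_iff_ite.1 (hM κ).eigenvectorBasis.orthonormal l l')]
    simp [w, PiLp.inner_apply, mul_comm]
  refine ⟨fun i => ex (cls i) (w (cls i) ⟨i, rfl⟩), fun i => (hM (cls i)).eigenvalues ⟨i, rfl⟩,
    ?_, ?_, ?_⟩
  · intro i k
    rw [dotProduct, hsum]
    by_cases hik : cls i = cls k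
    · have h1 : ∀ (κ) (hi : cls i = κ) (hk : cls k = κ),
          ∑ l : {i // cls i = κ}, ex κ (w κ ⟨i, hi⟩) l * w κ ⟨k, hk⟩ l =
            if i = k then 1 else 0 := by
        intro κ hi hk
        rw [Finset.sum_congr rfl fun l _ => by
          rw [show ex κ (w κ ⟨i, hi⟩) l = w κ ⟨i, hi⟩ l by simp [ex, l.2]]]
        rw [horth]
        simp
      have h2 : ∀ κ (hi : cls i = κ), ex (cls i) (w (cls i) ⟨i, rfl⟩) = ex κ (w κ ⟨i, hi⟩) := by
        rintro κ rfl
        rfl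
      beta_reduce
      rw [h2 _ hik]
      exact h1 _ hik rfl
    · rw [if_neg fun h => hik (congrArg cls h)]
      refine Finset.sum_eq_zero fun l _ => ?_
      have : cls l ≠ cls i := fun h => hik (h.symm.trans l.2)
      simp [ex, this]
  · intro i k hk
    simp [ex, hk]
  · intro i
    ext k
    rw [Matrix.mulVec, dotProduct, hsum, Pi.smul_apply, smul_eq_mul]
    beta_reduce
    by_cases hk : cls k = cls i
    · have := congrFun ((hM (cls i)).mulVec_eigenvectorBasis ⟨i, rfl⟩) ⟨k, hk⟩
      simp only [Matrix.mulVec, dotProduct, Matrix.submatrix_apply, Pi.smul_apply,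
        smul_eq_mul] at this
      rw [show ex (cls i) (w (cls i) ⟨i, rfl⟩) k = w (cls i) ⟨i, rfl⟩ ⟨k, hk⟩ by simp [ex, hk]]
      exact this
    · rw [show ex (cls i) (w (cls i) ⟨i, rfl⟩) k = 0 by simp [ex, hk], mul_zero]
      refine Finset.sum_eq_zero fun l _ => ?_
      rw [hblock k l (fun h => hk (h.trans l.2)), zero_mul]

/-- The row of coefficients of a triangular form. -/
def triRow {n : ℕ} (rk : Fin n → ℕ) (c : Fin n → ℝ) (i k : Fin n) : ℝ :=
  (if k = i then 1 else 0) - if rk k < rk i then c k else 0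

theorem triForm_eq_dotProduct {n : ℕ} (rk : Fin n → ℕ) (c : Fin n → ℝ) (i : Fin n) (x : Vec n) :
    triForm rk c i x = triRow rk c i ⬝ᵥ x := by
  simp only [triForm, triRow, dotProduct, sub_mul, Finset.sum_sub_distrib, ite_mul, one_mul,
    zero_mul, Finset.sum_ite_eq', mem_univ, if_true, Finset.sum_filter]

theorem eq_zero_of_triForm_eq_zero {n : ℕ} {rk : Fin n → ℕ} {c : Fin n → Fin n → ℝ} {x : Vec n}
    (hx : ∀ i, triForm rk (c i) i x = 0) : x = 0 := by
  by_contra hne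
  have hex : (univ.filter fun i => x i ≠ 0).Nonempty := by
    by_contra hcon
    rw [Finset.not_nonempty_iff_eq_empty, Finset.filter_eq_empty_iff] at hcon
    exact hne (funext fun i => by simpa using hcon (mem_univ i))
  obtain ⟨i, hi, hmin⟩ := Finset.exists_min_image _ rk hex
  have h1 : x i ≠ 0 := by simpa using hi
  refine h1 ?_
  rw [← triForm_eq_of_forall_lt (rk := rk) (c := c i) (i := i) (v := x), hx]
  intro j hj
  by_contra hj0
  exact absurd hj (not_lt.2 (hmin j (by simpa using hj0)))

theorem exists_isAdaptedEllipsoid {n : ℕ} (hn : 0 < n) {ι : Type*} [DecidableEq ι]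
    (V : ι → Finset (Fin n)) (cls : Fin n → Finset ι) (hcls : ∀ i j, j ∈ cls i ↔ i ∈ V j)
    {rk : Fin n → ℕ} {c : Fin n → Fin n → ℝ}
    (hc : ∀ i k, cls k ≠ cls i → c i k = 0) {H : Fin n → ℝ} (hH : ∀ i, 0 < H i) :
    ∃ E, IsAdaptedEllipsoid V E ∧
      (∀ v v' : Vec n, (∀ i, |triForm rk (c i) i v| ≤ H i) →
        (∀ i, |triForm rk (c i) i v'| ≤ H i) → v - v' ∈ E) ∧
      volume.real E ≤ ∏ i, (4 * n * H i) := by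
  have hn' : (0 : ℝ) < n := by exact_mod_cast hn
  have hn1 : (1 : ℝ) ≤ n := by exact_mod_cast hn
  set r : Fin n → ℝ := fun i => 2 * n * H i with hr
  have hr0 : ∀ i, 0 < r i := fun i => by have := hH i; positivity
  let A : Matrix (Fin n) (Fin n) ℝ := Matrix.of fun i k =>
    ∑ l, triRow rk (c l) l i * triRow rk (c l) l k / r l ^ 2
  have hA : A.IsHermitian := by
    ext i k
    simp [A, mul_comm]
  have hrow : ∀ l i, cls i ≠ cls l → triRow rk (c l) l i = 0 := fun l i h => by
    have : i ≠ l := fun hil => h (congrArg cls hil)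
    simp [triRow, this, hc l i h]
  have hblock : ∀ i k, cls i ≠ cls k → A i k = 0 := fun i k h => by
    simp only [A, Matrix.of_apply]
    refine Finset.sum_eq_zero fun l _ => ?_
    by_cases hil : cls i = cls l
    · rw [hrow l k fun hk => h (hil.trans hk.symm), mul_zero, zero_div]
    · rw [hrow l i hil, zero_mul, zero_div]
  have hquad : ∀ x : Vec n, x ⬝ᵥ A *ᵥ x = ∑ l, (triForm rk (c l) l x / r l) ^ 2 := by
    intro x
    simp only [triForm_eq_dotProduct, dotProduct, Matrix.mulVec, A, Matrix.of_apply,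
      Finset.mul_sum, Finset.sum_mul]
    rw [Finset.sum_congr rfl fun i _ => Finset.sum_comm, Finset.sum_comm]
    refine Finset.sum_congr rfl fun l _ => ?_
    rw [div_pow, pow_two (∑ i, _), Finset.sum_mul_sum, Finset.sum_div]
    refine Finset.sum_congr rfl fun i _ => ?_
    rw [Finset.sum_div]
    refine Finset.sum_congr rfl fun k _ => ?_
    ring
  obtain ⟨b, lam, hb, hbcls, heig⟩ := exists_block_eigenbasis cls A hA hblock
  have hlam : ∀ i, 0 < lam i := by
    intro i
    have h1 := hquad (b i)
    rw [heig, dotProduct_smul, hb, if_pos rfl, smul_eq_mul, mul_one] at h1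
    rw [h1]
    refine lt_of_le_of_ne (Finset.sum_nonneg fun l _ => sq_nonneg _) fun h0 => ?_
    have h2 := (Finset.sum_eq_zero_iff_of_nonneg fun l _ => sq_nonneg _).1 h0.symm
    have h3 : b i = 0 := eq_zero_of_triForm_eq_zero (rk := rk) (c := c) fun l => by
      have := pow_eq_zero_iff (two_ne_zero) |>.1 (h2 l (mem_univ l))
      rcases div_eq_zero_iff.1 this with h | h
      · exact h
      · exact absurd h (hr0 l).ne'
    have h4 := hb i i
    rw [h3, if_pos rfl, dotProduct_zero] at h4
    exact zero_ne_one h4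
  let B : Matrix (Fin n) (Fin n) ℝ := Matrix.of b
  have hBB : B * Bᵀ = 1 := by
    ext i k
    rw [Matrix.mul_apply, Matrix.one_apply, ← hb i k]
    rfl
  have hBB' : Bᵀ * B = 1 := mul_eq_one_comm.1 hBB
  have hAB : A * Bᵀ = Bᵀ * Matrix.diagonal lam := by
    ext i k
    rw [Matrix.mul_diagonal, Matrix.mul_apply]
    have := congrFun (heig k) i
    simp only [Matrix.mulVec, dotProduct, Pi.smul_apply, smul_eq_mul] at this
    simpa [B, mul_comm] using this
  have hAeq : A = Bᵀ * Matrix.diagonal lam * B := by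
    rw [← hAB, Matrix.mul_assoc, hBB', Matrix.mul_one]
  have hquad' : ∀ x : Vec n, x ⬝ᵥ A *ᵥ x = ∑ i, lam i * (b i ⬝ᵥ x) ^ 2 := by
    intro x
    rw [hAeq, ← Matrix.mulVec_mulVec, ← Matrix.mulVec_mulVec, Matrix.dotProduct_mulVec,
      Matrix.vecMul_transpose]
    refine Finset.sum_congr rfl fun i _ => ?_
    rw [Matrix.mulVec_diagonal]
    change (b i ⬝ᵥ x) * (lam i * (b i ⬝ᵥ x)) = _
    ring
  obtain ⟨d, U, hU, hUmem⟩ := exists_isMaximalPartition hn V cls hcls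
  refine ⟨{x | ∑ l, (triForm rk (c l) l x / r l) ^ 2 ≤ 1},
    ⟨d, U, b, fun i => 1 / √(lam i), hU, hb, fun i => ?_, fun i => ?_, ?_⟩, ?_, ?_⟩
  · obtain ⟨a, ha⟩ := hUmem i
    exact ⟨a, ha _ fun k hk => hbcls i k hk⟩
  · have := Real.sqrt_pos.2 (hlam i)
    positivity
  · ext x
    rw [Set.mem_ofPred_eq, Set.mem_ofPred_eq, ← hquad, hquad']
    refine iff_of_eq (congrArg (· ≤ (1 : ℝ)) (Finset.sum_congr rfl fun i _ => ?_))
    rw [div_div_eq_mul_div, div_one, mul_pow, Real.sq_sqrt (hlam i).le, mul_comm]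
  · intro v v' hv hv'
    rw [Set.mem_ofPred_eq]
    calc ∑ l, (triForm rk (c l) l (v - v') / r l) ^ 2 ≤ ∑ l : Fin n, (1 / (n : ℝ)) ^ 2 := by
          refine Finset.sum_le_sum fun l _ => ?_
          rw [sq_le_sq, abs_div, abs_of_pos (hr0 l), abs_of_pos (by positivity : 0 < 1 / (n : ℝ)),
            div_le_div_iff₀ (hr0 l) hn', triForm_sub]
          have := abs_sub (triForm rk (c l) l v) (triForm rk (c l) l v')
          have h1 := hv l
          have h2 := hv' l
          rw [hr]
          have h3 : |triForm rk (c l) l v - triForm rk (c l) l v'| ≤ 2 * H l := by linarith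
          calc _ ≤ 2 * H l * n := by gcongr
            _ = _ := by ring
      _ = 1 / n := by
          rw [Finset.sum_const, Finset.card_univ, Fintype.card_fin, nsmul_eq_mul]
          field_simp
      _ ≤ 1 := by rw [div_le_one hn']; exact hn1
  · set E : Set (Vec n) := {x | ∑ l, (triForm rk (c l) l x / r l) ^ 2 ≤ 1} with hE
    have hEm : MeasurableSet E := by
      refine (isClosed_le (continuous_finsetSum _ fun l _ => ?_) continuous_const).measurableSet
      exact ((continuous_triForm rk (c l) l).div_const _).pow 2
    have hEle : ∀ x ∈ E, ∀ l, |triForm rk (c l) l x| ≤ r l := by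
      intro x hx l
      have h1 : (triForm rk (c l) l x / r l) ^ 2 ≤ 1 :=
        (Finset.single_le_sum (f := fun l => (triForm rk (c l) l x / r l) ^ 2)
          (fun l _ => sq_nonneg _) (mem_univ l)).trans hx
      rw [sq_le_one_iff_abs_le_one, abs_div, abs_of_pos (hr0 l), div_le_one (hr0 l)] at h1
      exact h1
    have key := lmarginal_indicator_le_prod rk hEm (fun i => ENNReal.ofReal (4 * n * H i)) univ
      (fun v hv v' hv' i _ _ h2 => by
        rw [edist_dist, Real.dist_eq]
        refine ENNReal.ofReal_le_ofReal ?_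
        have e1 : v i - v' i = triForm rk (c i) i v - triForm rk (c i) i v' := by
          rw [← triForm_sub, triForm_eq_of_forall_lt]
          · rfl
          · intro l hl
            simp [h2 l (mem_univ l) hl]
        rw [e1]
        have := abs_sub (triForm rk (c i) i v) (triForm rk (c i) i v')
        have h1 := hEle v hv i
        have h2 := hEle v' hv' i
        simp only [hr] at h1 h2
        linarith) 0
    rw [lmarginal_univ, lintegral_indicator_one hEm,
      ← ENNReal.ofReal_prod_of_nonneg fun i _ => by have := hH i; positivity] at key
    have := ENNReal.toReal_mono ENNReal.ofReal_ne_top key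
    rwa [ENNReal.toReal_ofReal
      (Finset.prod_nonneg fun i _ => by have := hH i; positivity)] at this

end

section

/-- The consequences of the scaling and transversality conditions for the integer exponents. -/
structure IsAdmissible {n M : ℕ} (m : ℕ) (V : Fin M → Finset (Fin n)) (e : Fin M → ℕ) (q : ℕ) :
    Prop where
  dim_pos : 0 < n
  exp_pos : ∀ j, 0 < e j
  q_pos : 0 < q
  bigQ_eq : ∀ i, bigQ m V e i = ∑ j ∈ idxY M m with i ∉ V j, e j
  bigN_lt : ∀ i, bigN e q < bigQ m V e i
  bigN_pos : 0 < bigN e q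
  sum_bigQ : ∑ i, bigQ m V e i = (n + 1) * bigN e q
  bigN_add : bigN e q + q = ∑ j, e j

theorem sum_idxX_add_sum_idxY {M : ℕ} (m : ℕ) {R : Type*} [AddCommMonoid R] (f : Fin M → R) :
    ∑ j ∈ idxX M m, f j + ∑ j ∈ idxY M m, f j = ∑ j, f j := by
  rw [← Finset.sum_filter_add_sum_filter_not univ (fun j : Fin M => (j : ℕ) < m)]
  simp [idxX, idxY]

theorem isAdmissible {n m M : ℕ} (hn : 0 < n)
    {V : Fin M → Finset (Fin n)} {p : Fin M → ℚ}
    {q : ℕ} {e : Fin M → ℕ} (hq : 0 < q) (he : ∀ j, 0 < e j)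
    (hpq : ∀ j, (p j)⁻¹ = (e j : ℚ) / q)
    (hA : (n : ℚ) + 1 =
      ∑ j ∈ idxX M m, ((#(V j) : ℚ) + 1) / p j + ∑ j ∈ idxY M m, ((n : ℚ) + 1) / p j)
    (hB : ∀ W : Finset (Fin n), W ≠ Finset.univ → (#W : ℚ) + 1 <
      ∑ j ∈ idxX M m, ((#(V j ∩ W) : ℚ) + 1) / p j +
        ∑ j ∈ idxY M m, ((#W : ℚ) + 1) / p j)
    (hC : ∀ W : Finset (Fin n),
      ∑ j ∈ idxX M m, (#((V j)ᶜ ∩ W) : ℚ) / p j =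
        ∑ j ∈ idxY M m, (#((V j)ᶜ ∩ W) : ℚ) / p j) : IsAdmissible m V e q := by
  have hq' : (q : ℚ) ≠ 0 := by positivity
  have hq0 : (0 : ℚ) < q := by positivity
  have hdiv : ∀ (s : Finset (Fin M)) (x : Fin M → ℚ),
      ∑ j ∈ s, x j / p j = (∑ j ∈ s, x j * e j) / q := by
    intro s x
    rw [Finset.sum_div]
    refine Finset.sum_congr rfl fun j _ => ?_
    rw [div_eq_mul_inv, hpq, mul_div_assoc]
  simp only [hdiv] at hA hB hC
  rw [← add_div, eq_div_iff hq'] at hA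
  have hE := sum_idxX_add_sum_idxY m (fun j => (e j : ℚ))
  have hQX : ∀ i, (bigQ m V e i : ℚ) = ∑ j ∈ idxX M m, if i ∉ V j then (e j : ℚ) else 0 := by
    intro i
    rw [bigQ, Nat.cast_sum, Finset.sum_filter]
  have hcard : ∀ j, (#(V j) : ℚ) = n - ∑ i, if i ∉ V j then (1 : ℚ) else 0 := by
    intro j
    rw [← Finset.sum_filter, Finset.sum_const, nsmul_eq_mul, mul_one, eq_sub_iff_add_eq]
    have h1 := card_compl_add_card (V j)
    rw [Fintype.card_fin] at h1
    have h2 : (univ.filter fun i => i ∉ V j) = (V j)ᶜ := by ext; simp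
    rw [h2, add_comm]
    exact_mod_cast h1
  have hcardi : ∀ j i,
      (#(V j ∩ univ.erase i) : ℚ) = #(V j) - 1 + if i ∉ V j then (1 : ℚ) else 0 := by
    intro j i
    rw [Finset.inter_erase, Finset.inter_univ]
    by_cases hi : i ∈ V j
    · have := Finset.card_erase_add_one hi
      have h2 : ((#((V j).erase i) + 1 : ℕ) : ℚ) = #(V j) := by rw [this]
      push_cast at h2
      simp only [hi, not_true, if_false]
      linarith
    · rw [Finset.erase_eq_of_notMem hi]
      simp [hi]
  have hsumQ : ∑ i, (bigQ m V e i : ℚ) = (n + 1) * (∑ j, (e j : ℚ) - q) := by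
    simp only [hQX]
    rw [Finset.sum_comm]
    have h1 : ∀ j ∈ idxX M m, ((#(V j) : ℚ) + 1) * e j =
        (n + 1) * e j - ∑ i, if i ∉ V j then (e j : ℚ) else 0 := by
      intro j _
      rw [hcard, show (∑ i, if i ∉ V j then (e j : ℚ) else 0) =
        (∑ i, if i ∉ V j then (1 : ℚ) else 0) * e j by
          rw [Finset.sum_mul]; exact Finset.sum_congr rfl fun i _ => by split_ifs <;> simp]
      ring
    rw [Finset.sum_congr rfl h1, Finset.sum_sub_distrib, ← Finset.mul_sum, ← Finset.mul_sum] at hA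
    rw [← hE]
    linarith
  have hlt : (q : ℚ) < ∑ j, (e j : ℚ) := by
    have := hB ∅ (fun h => by
      have := Finset.mem_univ (⟨0, hn⟩ : Fin n)
      rw [← h] at this
      exact absurd this (Finset.notMem_empty _))
    simp only [Finset.inter_empty, Finset.card_empty, Nat.cast_zero, zero_add, one_mul] at this
    rw [← add_div, lt_div_iff₀ hq0, hE, one_mul] at this
    exact this
  have hlt' : q < ∑ j, e j := by exact_mod_cast hlt
  have hNcast : (bigN e q : ℚ) = ∑ j, (e j : ℚ) - q := by
    rw [bigN, Nat.cast_sub hlt'.le, Nat.cast_sum]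
  have hQe : ∀ i, bigN e q < bigQ m V e i := by
    intro i
    have hn1 : ((n - 1 : ℕ) : ℚ) = n - 1 := by rw [Nat.cast_sub hn, Nat.cast_one]
    have := hB (univ.erase i) (fun h => by
      have := Finset.mem_univ i
      rw [← h] at this
      exact absurd this (Finset.notMem_erase _ _))
    rw [Finset.card_erase_of_mem (mem_univ i), Finset.card_univ, Fintype.card_fin, hn1, ← add_div,
      lt_div_iff₀ hq0] at this
    have h1 : ∑ j ∈ idxX M m, ((#(V j ∩ univ.erase i) : ℚ) + 1) * e j =
        ∑ j ∈ idxX M m, ((#(V j) : ℚ) + 1) * e j - ∑ j ∈ idxX M m, (e j : ℚ) +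
          bigQ m V e i := by
      rw [hQX, ← Finset.sum_sub_distrib, ← Finset.sum_add_distrib]
      refine Finset.sum_congr rfl fun j _ => ?_
      rw [hcardi]
      split_ifs <;> ring
    rw [h1, ← Finset.mul_sum] at this
    rw [← Finset.mul_sum] at hA
    have h2 : (bigN e q : ℚ) < bigQ m V e i := by rw [hNcast, ← hE]; linarith
    exact_mod_cast h2
  refine ⟨hn, he, hq, fun i => ?_, hQe, ?_, ?_, ?_⟩
  · have := hC {i}
    rw [div_left_inj' hq'] at this
    have h1 : ∀ s : Finset (Fin M), ∑ j ∈ s, (#((V j)ᶜ ∩ {i}) : ℚ) * e j =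
        ((∑ j ∈ s with i ∉ V j, e j : ℕ) : ℚ) := by
      intro s
      rw [Nat.cast_sum, Finset.sum_filter]
      refine Finset.sum_congr rfl fun j _ => ?_
      by_cases hi : i ∈ V j
      · have : (V j)ᶜ ∩ {i} = ∅ := by
          rw [Finset.inter_singleton_of_notMem]; simpa using hi
        simp [this, hi]
      · have : (V j)ᶜ ∩ {i} = {i} := by
          rw [Finset.inter_singleton_of_mem]; simpa using hi
        simp [this, hi]
    rw [h1, h1] at this
    rw [bigQ]
    exact_mod_cast this
  · rw [bigN]; omega
  · rw [← hNcast] at hsumQ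
    exact_mod_cast hsumQ
  · rw [bigN]; omega

/-- An enumeration of the coordinates along which `Q` decreases and the classes are contiguous. -/
theorem exists_order {n : ℕ} (hn : 0 < n) {γ : Type*} (Q : Fin n → ℕ) (cls : Fin n → γ)
    (hcls : ∀ i k, cls i = cls k → Q i = Q k) :
    ∃ (rk : Fin n → ℕ) (o : ℕ → Fin n), Function.Injective rk ∧ (∀ b < n, rk (o b) = b) ∧
      (∀ i, rk i < n) ∧
      (∀ i i', rk i ≤ rk i' → Q i' ≤ Q i) ∧
      ∀ i j k, rk i ≤ rk j → rk j ≤ rk k → cls i = cls k → cls j = cls k := by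
  have : Nonempty (Fin n) := ⟨⟨0, hn⟩⟩
  let code : Fin n → Fin n := fun i => Function.invFun cls (cls i)
  have hcode : ∀ i, cls (code i) = cls i := fun i => Function.invFun_eq ⟨i, rfl⟩
  let f : Fin n → ℕᵒᵈ ×ₗ Fin n := fun i => toLex (OrderDual.toDual (Q i), code i)
  let σ := Tuple.sort f
  have hmono : ∀ i k, σ.symm i ≤ σ.symm k → f i ≤ f k := fun i k h => by
    have := Tuple.monotone_sort f h
    simpa [σ] using this
  refine ⟨fun i => σ.symm i, fun b => if h : b < n then σ ⟨b, h⟩ else ⟨0, hn⟩, ?_, ?_, ?_, ?_, ?_⟩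
  · intro i k h
    exact σ.symm.injective (Fin.ext h)
  · intro b hb
    simp [hb]
  · exact fun i => (σ.symm i).2
  · intro i k h
    have := hmono i k h
    rw [Prod.Lex.le_iff] at this
    rcases this with h1 | ⟨h1, _⟩
    · exact le_of_lt h1
    · exact le_of_eq h1.symm
  · intro i j k hij hjk hik
    have h1 := hmono i j hij
    have h2 := hmono j k hjk
    have h3 : f i = f k := by
      simp only [f, code, hik, hcls i k hik]
    have h4 : f j = f k := le_antisymm h2 (h3 ▸ h1)
    have h5 : code j = code k := congrArg (fun x => (ofLex x).2) h4
    rw [← hcode j, h5, hcode]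

theorem card_rank_lt {n : ℕ} {rk : Fin n → ℕ} {o : ℕ → Fin n} (hrk : Function.Injective rk)
    (ho : ∀ b < n, rk (o b) = b) {b : ℕ} (hb : b ≤ n) :
    #(univ.filter fun i => rk i < b) = b := by
  have : (univ.filter fun i => rk i < b) = (range b).image o := by
    ext i
    simp only [Finset.mem_filter, mem_univ, true_and, Finset.mem_image, Finset.mem_range]
    constructor
    · intro h
      exact ⟨rk i, h, hrk (ho _ (h.trans_le hb))⟩
    · rintro ⟨a, ha, rfl⟩
      rwa [ho a (ha.trans_le hb)]
  rw [this, Finset.card_image_of_injOn, Finset.card_range]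
  intro a ha a' ha' h
  simp only [Finset.coe_range, Set.mem_Iio] at ha ha'
  have := congrArg rk h
  rwa [ho a (ha.trans_le hb), ho a' (ha'.trans_le hb)] at this

theorem mem_iff_rank_lt_card {n : ℕ} {rk : Fin n → ℕ} {o : ℕ → Fin n}
    (hrk : Function.Injective rk) (ho : ∀ b < n, rk (o b) = b) (hlt : ∀ i, rk i < n)
    {K : Finset (Fin n)} (hK : ∀ i ∈ K, ∀ i', rk i' ≤ rk i → i' ∈ K) (i : Fin n) :
    i ∈ K ↔ rk i < #K := by
  constructor
  · intro hi
    have h1 : #(univ.filter fun i' => rk i' < rk i + 1) ≤ #K := by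
      refine card_le_card fun i' hi' => hK i hi i' ?_
      have := (Finset.mem_filter.1 hi').2
      omega
    rw [card_rank_lt hrk ho (hlt i)] at h1
    exact h1
  · intro h
    by_contra hi
    have h1 : #K ≤ #(univ.filter fun i' => rk i' < rk i) := by
      refine card_le_card fun i' hi' => Finset.mem_filter.2 ⟨mem_univ _, ?_⟩
      by_contra hcon
      exact hi (hK i' hi' i (not_lt.1 hcon))
    rw [card_rank_lt hrk ho (hlt i).le] at h1
    omega

theorem exists_equiv_of_initial {n : ℕ} {rk : Fin n → ℕ} {o : ℕ → Fin n}
    (hrk : Function.Injective rk) (ho : ∀ b < n, rk (o b) = b) (hlt : ∀ i, rk i < n)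
    {K : Finset (Fin n)} (hK : ∀ i ∈ K, ∀ i', rk i' ≤ rk i → i' ∈ K) :
    (∃ E : Fin #K ≃ K, ∀ b, (E b : Fin n) = o b) ∧ #K ≤ n ∧
      ∀ f : Fin n → ℝ, ∏ b ∈ range #K, f (o b) = ∏ i ∈ K, f i := by
  have hKn : #K ≤ n := (card_le_univ K).trans_eq (Fintype.card_fin n)
  have hmem := mem_iff_rank_lt_card hrk ho hlt hK
  have horank : ∀ b < #K, o b ∈ K := fun b hb => by
    rw [hmem, ho b (hb.trans_le hKn)]; exact hb
  refine ⟨⟨⟨fun b => ⟨o b, horank b b.2⟩, fun i => ⟨rk i, (hmem i).1 i.2⟩,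
    fun b => ?_, fun i => ?_⟩,
    fun b => rfl⟩, hKn, fun f => ?_⟩
  · exact Fin.ext (ho b (b.2.trans_le hKn))
  · exact Subtype.ext (hrk (ho _ (hlt i)))
  · refine Finset.prod_bij (fun b _ => o b) (fun b hb => horank b (by simpa using hb)) ?_ ?_
      fun _ _ => rfl
    · intro a ha a' ha' h
      simp only [Finset.mem_range] at ha ha'
      have := congrArg rk h
      rwa [ho a (ha.trans_le hKn), ho a' (ha'.trans_le hKn)] at this
    · intro i hi
      exact ⟨rk i, by simpa using (hmem i).1 hi, hrk (ho _ (hlt i))⟩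

end

section

section Sizes

variable {n : ℕ} {Ω A : Set (Heis n)}

theorem continuous_projX (s : Finset (Fin n)) : Continuous (projX (n := n) s) := by
  unfold projX coordProj dotProduct
  fun_prop

theorem isBounded_image_projX (s : Finset (Fin n)) (h : Bornology.IsBounded Ω) :
    Bornology.IsBounded (projX s '' Ω) :=
  (((Metric.isCompact_of_isClosed_isBounded isClosed_closure h.closure).image
    (continuous_projX s)).isBounded).subset (Set.image_mono subset_closure)

theorem volume_projX_ne_top (s : Finset (Fin n)) (h : Bornology.IsBounded Ω) :
    volume (projX s '' Ω) ≠ ∞ := (isBounded_image_projX s h).measure_lt_top.ne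

theorem volume_projY_ne_top (s : Finset (Fin n)) (h : Bornology.IsBounded Ω) :
    volume (projY s '' Ω) ≠ ∞ := by
  rw [volume_image_projY]
  exact volume_projX_ne_top s (isBounded_swapH_preimage h)

theorem volume_projX_ne_zero (s : Finset (Fin n)) (hA : MeasurableSet A) (hAΩ : A ⊆ Ω)
    (h0 : volume A ≠ 0) : volume (projX s '' Ω) ≠ 0 := by
  intro h
  have h1 := volume_le_mul_projX (s := s) (k := sᶜ) (compl_compl s).symm hA (τ := ∞)
    fun _ _ => le_top
  have h2 : volume (projX s '' A) = 0 :=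
    le_antisymm ((measure_mono (Set.image_mono hAΩ)).trans h.le) zero_le
  rw [h2, mul_zero] at h1
  exact h0 (le_antisymm h1 zero_le)

theorem volume_projY_ne_zero (s : Finset (Fin n)) (hA : MeasurableSet A) (hAΩ : A ⊆ Ω)
    (h0 : volume A ≠ 0) : volume (projY s '' Ω) ≠ 0 := by
  rw [volume_image_projY]
  refine volume_projX_ne_zero s (measurable_swapH hA) (Set.preimage_mono hAΩ) ?_
  rwa [volume_swapH_preimage hA]

/-- A refinement of a set all of whose fibers along the maps `projX` are large compared with the
corresponding average fibers of a larger set. -/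
theorem exists_refineX (hA : MeasurableSet A) (hAΩ : A ⊆ Ω) (hb : Bornology.IsBounded Ω)
    {δ : ℝ} (hδ : 0 ≤ δ) :
    ∃ B ⊆ A, MeasurableSet B ∧
      (∀ k : Finset (Fin n), ∀ z ∈ B, δ * (volume.real Ω / volume.real (projX kᶜ '' Ω)) ≤
        volume.real (sliceX k B z)) ∧
      (∀ z ∈ B, δ * volume.real (fibX A z) ≤ volume.real (fibX B z)) ∧
      volume.real A ≤ volume.real B + (2 ^ n + 1) * (δ * volume.real Ω) := by
  have hAb := hb.subset hAΩ
  have hΩ : volume Ω ≠ ∞ := hb.measure_lt_top.ne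
  obtain ⟨B, hBA, hBm, hB, hAB⟩ := exists_refinement_sliceX
    (fun o : Option (Finset (Fin n)) => o.elim univ id) hA hAb
    (fun o z => o.elim (ENNReal.ofReal δ * volume (sliceX univ A z)) fun k =>
      ENNReal.ofReal (δ * (volume.real Ω / volume.real (projX kᶜ '' Ω))))
    (fun o => by
      cases o with
      | none => exact (measurable_volume_sliceX univ hA).const_mul _
      | some k => exact measurable_const)
    (fun o z u => by
      cases o with
      | none =>
        exact congrArg (ENNReal.ofReal δ * ·) (volume_sliceX_expX univ A z u)
      | some k => rfl)
    (fun _ => ENNReal.ofReal δ * volume Ω)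
    (fun o D hD hDA hDk => by
      cases o with
      | none =>
        exact (volume_le_mul_of_sliceX_le univ hA hD _ hDk).trans
          (mul_le_mul_right (measure_mono hAΩ) _)
      | some k =>
        have h1 := volume_le_mul_projX (s := kᶜ) (k := k) rfl hD hDk
        refine h1.trans ?_
        change ENNReal.ofReal (δ * (volume.real Ω / volume.real (projX kᶜ '' Ω))) * _ ≤ _
        have h2 : volume (projX kᶜ '' D) ≤ volume (projX kᶜ '' Ω) :=
          measure_mono (Set.image_mono (hDA.trans hAΩ))
        by_cases hP : volume.real (projX kᶜ '' Ω) = 0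
        · rw [hP, div_zero, mul_zero, ENNReal.ofReal_zero, zero_mul]
          exact zero_le
        · refine (mul_le_mul_right h2 _).trans (le_of_eq ?_)
          rw [← ENNReal.ofReal_toReal (volume_projX_ne_top kᶜ hb), ← measureReal_def,
            ← ENNReal.ofReal_mul (by positivity), mul_assoc, div_mul_cancel₀ _ hP,
            ENNReal.ofReal_mul hδ, measureReal_def, ENNReal.ofReal_toReal hΩ])
  refine ⟨B, hBA, hBm, fun k z hz => ?_, fun z hz => ?_, ?_⟩
  · exact (ENNReal.ofReal_le_iff_le_toReal
      (volume_sliceX_ne_top k (hAb.subset hBA) z)).1 (hB (some k) z hz)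
  · have h1 := hB none z hz
    change ENNReal.ofReal δ * volume (sliceX univ A z) ≤ volume (sliceX univ B z) at h1
    rw [volume_sliceX_of_eq_univ rfl hA, volume_sliceX_of_eq_univ rfl hBm] at h1
    have h2 := ENNReal.toReal_mono (isBounded_fibX (hAb.subset hBA) z).measure_lt_top.ne h1
    rwa [ENNReal.toReal_mul, ENNReal.toReal_ofReal hδ] at h2
  · rw [Finset.sum_const, Finset.card_univ, Fintype.card_option, Fintype.card_finset,
      Fintype.card_fin, nsmul_eq_mul] at hAB
    have hB' : volume B ≠ ∞ := (hAb.subset hBA).measure_lt_top.ne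
    have h1 := ENNReal.toReal_mono (ENNReal.add_ne_top.2 ⟨hB', ENNReal.mul_ne_top
      (ENNReal.natCast_ne_top _) (ENNReal.mul_ne_top ENNReal.ofReal_ne_top hΩ)⟩) hAB
    rw [ENNReal.toReal_add hB' (ENNReal.mul_ne_top
      (ENNReal.natCast_ne_top _) (ENNReal.mul_ne_top ENNReal.ofReal_ne_top hΩ)),
      ENNReal.toReal_mul, ENNReal.toReal_mul, ENNReal.toReal_ofReal hδ,
      ENNReal.toReal_natCast] at h1
    push_cast at h1
    exact h1

theorem exists_refineY (hA : MeasurableSet A) (hAΩ : A ⊆ Ω) (hb : Bornology.IsBounded Ω)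
    (hΩm : NullMeasurableSet Ω) {δ : ℝ} (hδ : 0 ≤ δ) :
    ∃ B ⊆ A, MeasurableSet B ∧
      (∀ k : Finset (Fin n), ∀ z ∈ B, δ * (volume.real Ω / volume.real (projY kᶜ '' Ω)) ≤
        volume.real (sliceY k B z)) ∧
      (∀ z ∈ B, δ * volume.real (fibY A z) ≤ volume.real (fibY B z)) ∧
      volume.real A ≤ volume.real B + (2 ^ n + 1) * (δ * volume.real Ω) := by
  have hvol : volume (swapH ⁻¹' Ω) = volume Ω :=
    measurePreserving_swapH.measure_preimage hΩm
  obtain ⟨B, hBA, hBm, hB, hB', hAB⟩ := exists_refineX (measurable_swapH hA)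
    (Set.preimage_mono hAΩ) (isBounded_swapH_preimage hb) hδ
  have hinv : ∀ S : Set (Heis n), swapH ⁻¹' (swapH ⁻¹' S) = S := fun S => by
    ext z; simp only [Set.mem_preimage, swapH_swapH]
  refine ⟨swapH ⁻¹' B, fun z hz => ?_, measurable_swapH hBm, fun k z hz => ?_, fun z hz => ?_, ?_⟩
  · have := hBA hz
    rwa [Set.mem_preimage, swapH_swapH] at this
  · have := hB k _ hz
    rw [sliceY_eq, hinv, measureReal_def volume (projY kᶜ '' Ω), volume_image_projY]
    rwa [measureReal_def volume (swapH ⁻¹' Ω), hvol] at this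
  · rw [fibY_eq, fibY_eq, hinv]
    exact hB' _ hz
  · rw [measureReal_def volume (swapH ⁻¹' A), volume_swapH_preimage hA,
      measureReal_def volume (swapH ⁻¹' Ω), hvol] at hAB
    rwa [measureReal_def volume (swapH ⁻¹' B), volume_swapH_preimage hBm]

end Sizes

/-- The points at which the determinant integrals of the fibers are not much larger than their
averages. -/
theorem exists_detIntegral_le {n : ℕ} {Ω A : Set (Heis n)} (hA : MeasurableSet A) (hAΩ : A ⊆ Ω)
    (hb : Bornology.IsBounded Ω) (hA0 : volume A ≠ 0) {Q : Fin n → ℕ} {rk : Fin n → ℕ}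
    {o : ℕ → Fin n} (hrk : Function.Injective rk)
    (ho : ∀ b < n, rk (o b) = b) (hlt : ∀ i, rk i < n)
    (hQ : ∀ i i', rk i ≤ rk i' → Q i' ≤ Q i) {δ : ℝ} (hδ : 0 < δ) :
    ∃ G ⊆ A, MeasurableSet G ∧ volume.real A ≤ volume.real G + numLevels Q * (δ * volume.real Ω) ∧
      ∀ z ∈ G, ∀ j < numLevels Q, detIntegral o #(auxKer Q j) (fibY A z) ≤
        ENNReal.ofReal (volume.real (projX (∅ : Finset (Fin n)) '' Ω) ^ #(auxKer Q j) *
          volume.real (projX (auxKer Q j)ᶜ '' Ω) / (δ * volume.real Ω)) := by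
  have hΩ : volume Ω ≠ ∞ := hb.measure_lt_top.ne
  have hA' : volume A ≠ ∞ := (hb.subset hAΩ).measure_lt_top.ne
  have hΩ0 : 0 < volume.real Ω :=
    ENNReal.toReal_pos (fun h => hA0 (le_antisymm ((measure_mono hAΩ).trans h.le) zero_le)) hΩ
  set L : ℕ → ℝ := fun j => volume.real (projX (∅ : Finset (Fin n)) '' Ω) ^ #(auxKer Q j) *
          volume.real (projX (auxKer Q j)ᶜ '' Ω) / (δ * volume.real Ω) with hL
  have hXpos : ∀ s : Finset (Fin n), 0 < volume.real (projX s '' Ω) := fun s =>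
    ENNReal.toReal_pos (volume_projX_ne_zero s hA hAΩ hA0) (volume_projX_ne_top s hb)
  have hLpos : ∀ j, 0 < L j := fun j => by
    have h1 := hXpos ∅
    have h2 := hXpos (auxKer Q j)ᶜ
    simp only [hL]
    positivity
  let D : ℕ → Set (Heis n) := fun j =>
    A ∩ {z | ENNReal.ofReal (L j) < detIntegral o #(auxKer Q j) (fibY A z)}
  have hDm : ∀ j, MeasurableSet (D j) := fun j =>
    hA.inter (measurableSet_lt measurable_const (measurable_detIntegral_fibY o _ hA))
  have hDle : ∀ j, volume (D j) ≤ ENNReal.ofReal (δ * volume.real Ω) := by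
    intro j
    have hK : ∀ i ∈ auxKer Q j, ∀ i', rk i' ≤ rk i → i' ∈ auxKer Q j := fun i hi i' h =>
      mem_auxKer.2 ((mem_auxKer.1 hi).trans (hQ i' i h))
    obtain ⟨⟨E, hE⟩, _, _⟩ := exists_equiv_of_initial hrk ho hlt hK
    have h1 := setLIntegral_detIntegral_le E hE hA
    have h2 : ENNReal.ofReal (L j) * volume (D j) ≤
        ∫⁻ z in A, detIntegral o #(auxKer Q j) (fibY A z) := by
      rw [← setLIntegral_const]
      refine (setLIntegral_mono (measurable_detIntegral_fibY o _ hA)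
        fun z hz => le_of_lt hz.2).trans (lintegral_mono_set Set.inter_subset_left)
    have h3 : volume (projX (∅ : Finset (Fin n)) '' A) ^ #(auxKer Q j) *
        volume (projX (auxKer Q j)ᶜ '' A) ≤
        ENNReal.ofReal (L j) * ENNReal.ofReal (δ * volume.real Ω) := by
      rw [← ENNReal.ofReal_mul (hLpos j).le, hL, div_mul_cancel₀ _ (by positivity),
        ENNReal.ofReal_mul (by positivity), ENNReal.ofReal_pow measureReal_nonneg,
        measureReal_def, measureReal_def, ENNReal.ofReal_toReal (volume_projX_ne_top _ hb),
        ENNReal.ofReal_toReal (volume_projX_ne_top _ hb)]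
      gcongr
    exact (ENNReal.mul_le_mul_iff_right (by simpa using hLpos j) ENNReal.ofReal_ne_top).1
      (h2.trans (h1.trans h3))
  set U := ⋃ j ∈ range (numLevels Q), D j with hU
  have hUm : MeasurableSet U := Finset.measurableSet_biUnion _ fun j _ => hDm j
  have hUle : volume U ≤ numLevels Q * ENNReal.ofReal (δ * volume.real Ω) := by
    refine (measure_biUnion_finset_le _ _).trans ((Finset.sum_le_sum fun j _ => hDle j).trans ?_)
    rw [Finset.sum_const, Finset.card_range, nsmul_eq_mul]
  refine ⟨A \ U, Set.sdiff_subset, hA.diff hUm, ?_, fun z hz j hj => ?_⟩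
  · have h1 : volume A ≤ volume (A \ U) + numLevels Q * ENNReal.ofReal (δ * volume.real Ω) := by
      refine le_trans ?_ (add_le_add_right hUle _)
      exact (measure_mono (by rw [Set.sdiff_union_self]; exact Set.subset_union_left)).trans
        (measure_union_le _ _)
    have hfin : volume (A \ U) ≠ ∞ := ne_top_of_le_ne_top hA' (measure_mono Set.sdiff_subset)
    have hfin2 : (numLevels Q : ℝ≥0∞) * ENNReal.ofReal (δ * volume.real Ω) ≠ ∞ :=
      ENNReal.mul_ne_top (ENNReal.natCast_ne_top _) ENNReal.ofReal_ne_top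
    have h2 := ENNReal.toReal_mono (ENNReal.add_ne_top.2 ⟨hfin, hfin2⟩) h1
    rwa [ENNReal.toReal_add hfin hfin2, ENNReal.toReal_mul, ENNReal.toReal_natCast,
      ENNReal.toReal_ofReal (by positivity)] at h2
  · by_contra hcon
    refine hz.2 ?_
    rw [hU, Set.mem_iUnion₂]
    exact ⟨j, Finset.mem_range.2 hj, hz.1, not_le.1 hcon⟩

/-- Finner's inequality for the maps `projX`, with the fibers of the nested projections bounded by
`B`. -/
theorem measureReal_pow_le_of_nested {n : ℕ} (hn : 0 < n) {ι : Type*} [Fintype ι]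
    (W : ι → Finset (Fin n)) (e : ι → ℕ) (Q : Fin n → ℕ) (hQ : ∀ i, Q i = ∑ j with i ∉ W j, e j)
    {A : Set (Heis n)} (hA : MeasurableSet A) (hb : Bornology.IsBounded A) (hA0 : volume A ≠ 0)
    (B : ℕ → ℝ) (hB0 : ∀ j, 0 ≤ B j)
    (hB : ∀ j < numLevels Q, ∀ z ∈ A, volume.real (sliceX (auxKer Q j) A z) ≤ B j) :
    volume.real A ^ (∑ j, e j) ≤ (∏ j ∈ range (numLevels Q), B j ^ auxExp Q j) *
      ∏ j, volume.real (projX (W j) '' A) ^ e j := by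
  have hQ' : ∀ i, (∑ j with i ∈ W j, e j) + Q i = ∑ j, e j := fun i => by
    rw [hQ]; exact Finset.sum_filter_add_sum_filter_not univ (fun j => i ∈ W j) e
  let W' : Option ι → Finset (Fin n) := fun o => o.elim univ W
  let e' : Option ι → ℕ := fun o => o.elim 1 e
  have hsum : ∑ o, e' o = 1 + ∑ j, e j := Fintype.sum_option _
  have key := volume_pow_le_of_nested hn W' e' Q (fun i => by
      rw [hsum, Finset.sum_filter, Fintype.sum_option]
      change (if i ∈ univ then 1 else 0) + ∑ j, (if i ∈ W j then e j else 0) + Q i = _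
      rw [if_pos (mem_univ i), ← Finset.sum_filter, add_assoc, hQ' i])
    (fun i => by rw [hsum, ← hQ' i]; omega) hA (fun j => ENNReal.ofReal (B j))
    (fun j hj z hz => (ENNReal.le_ofReal_iff_toReal_le (volume_sliceX_ne_top _ hb z) (hB0 j)).2
      (hB j hj z hz))
  rw [hsum, Fintype.prod_option] at key
  change volume A ^ (1 + ∑ j, e j) ≤ _ * (volume (projX univ '' A) ^ 1 *
    ∏ j, volume (projX (W j) '' A) ^ e j) at key
  have huniv : volume (projX univ '' A) ≤ volume A := by
    have hk : (univ : Finset (Fin n)) = (∅ : Finset (Fin n))ᶜ := by simp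
    rw [volume_eq_lintegral_sliceX hk hA]
    have h1 := mul_meas_ge_le_lintegral
      ((measurable_volume_sliceX ∅ hA).comp (measurable_liftX univ)) 1 (μ := volume)
    rw [one_mul] at h1
    refine (measure_mono ?_).trans h1
    rintro _ ⟨z, hz, rfl⟩
    change 1 ≤ volume (sliceX ∅ A (liftX univ (projX univ z)))
    have h2 : sliceX ∅ A (liftX univ (projX univ z)) = Set.univ := by
      refine Set.eq_univ_of_forall fun u => ?_
      rw [Subsingleton.elim u (coordProj ∅ z.1), sliceX, Set.mem_ofPred_eq, expX_liftX_projX hk]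
      exact hz
    rw [h2, Measure.volume_pi_eq_dirac, measure_univ]
  have hAfin : volume A ≠ ∞ := hb.measure_lt_top.ne
  have hApos : 0 < volume.real A := ENNReal.toReal_pos hA0 hAfin
  have key2 : volume A ^ (1 + ∑ j, e j) ≤
      (∏ j ∈ range (numLevels Q), ENNReal.ofReal (B j) ^ auxExp Q j) * (volume A ^ 1 *
        ∏ j, volume (projX (W j) '' A) ^ e j) := key.trans (by gcongr)
  have key3 := ENNReal.toReal_mono (ENNReal.mul_ne_top
    (ENNReal.prod_ne_top fun j _ => ENNReal.pow_ne_top ENNReal.ofReal_ne_top)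
    (ENNReal.mul_ne_top (ENNReal.pow_ne_top hAfin) (ENNReal.prod_ne_top fun j _ =>
      ENNReal.pow_ne_top (volume_projX_ne_top _ hb)))) key2
  simp only [ENNReal.toReal_mul, ENNReal.toReal_pow, ENNReal.toReal_prod, ← measureReal_def,
    ENNReal.toReal_ofReal (hB0 _), pow_one] at key3
  rw [pow_add, pow_one] at key3
  refine le_of_mul_le_mul_left ?_ hApos
  linarith

end

section

theorem exists_eq_level {n : ℕ} {Q : Fin n → ℕ} {j : ℕ} (hj : j < numLevels Q) :
    ∃ i, Q i = level Q j := by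
  have hl : ((univ.image Q).sort (· ≥ ·)).length = numLevels Q := Finset.length_sort _
  have : level Q j ∈ (univ.image Q).sort (· ≥ ·) := by
    rw [level, List.getD_eq_getElem _ _ (by omega)]
    exact List.getElem_mem _
  rw [Finset.mem_sort, Finset.mem_image] at this
  obtain ⟨i, _, hi⟩ := this
  exact ⟨i, hi⟩

/-- The weighted product of the determinant bounds over the levels of `Q`. -/
theorem exists_prod_levels_le {n : ℕ} (hn : 0 < n) (Q : Fin n → ℕ) {N : ℕ} (hN : ∀ i, N < Q i)
    (hsum : ∑ i, Q i = (n + 1) * N) {δ : ℝ} (hδ : 0 < δ) :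
    ∃ C : ℝ, 0 < C ∧ ∀ (h : Fin n → ℝ) (f X w : ℝ) (P : ℕ → ℝ), (∀ i, 0 < h i) → 0 < f → 0 < X →
      0 < w → (∀ j, 0 < P j) → (∀ j, j + 1 = numLevels Q → P j = X) →
      (∀ j < numLevels Q, (∏ i ∈ auxKer Q j, h i) * (f / (2 * n)) ^ #(auxKer Q j) ≤
        X ^ #(auxKer Q j) * P j / (δ * w)) →
      (∏ j ∈ range (numLevels Q), (w / P j) ^ auxExp Q j) *
        ((∏ i, h i ^ (Q i - N)) * f ^ N) ≤ C * w ^ N := by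
  obtain ⟨l, hl⟩ : ∃ l, l + 1 = numLevels Q :=
    ⟨numLevels Q - 1, Nat.sub_add_cancel (numLevels_pos hn)⟩
  have hlmem : l ∈ range (numLevels Q) := by rw [Finset.mem_range]; omega
  have hexpl : N ≤ auxExp Q l := by
    obtain ⟨i, hi⟩ := exists_eq_level (Q := Q) (j := l) (by omega)
    rw [auxExp, level_of_le hl.ge, Nat.sub_zero, ← hi]
    exact (hN i).le
  have hlast : auxKer Q l = univ := auxKer_eq_univ hl
  set θ : ℕ → ℕ := fun j => if j = l then auxExp Q j - N else auxExp Q j with hθ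
  have hθadd : ∀ j, θ j + (if j = l then N else 0) = auxExp Q j := by
    intro j
    by_cases hj : j = l
    · subst hj; simp only [hθ, if_true]; omega
    · simp [hθ, hj]
  have hθi : ∀ i, ∑ j ∈ range (numLevels Q) with i ∈ auxKer Q j, θ j = Q i - N := by
    intro i
    have h1 := sum_auxExp (Q := Q) i
    rw [← Finset.sum_congr rfl fun j _ => hθadd j, Finset.sum_add_distrib,
      Finset.sum_ite_eq' _ l, if_pos (Finset.mem_filter.2 ⟨hlmem, by rw [hlast]; exact mem_univ i⟩)]
      at h1
    omega
  have hθk : ∑ j ∈ range (numLevels Q), #(auxKer Q j) * θ j = N := by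
    have h1 : ∑ j ∈ range (numLevels Q), #(auxKer Q j) * θ j = ∑ i, (Q i - N) := by
      simp only [← hθi, Finset.sum_filter]
      rw [Finset.sum_comm]
      refine Finset.sum_congr rfl fun j _ => ?_
      rw [← Finset.sum_filter, Finset.sum_const, smul_eq_mul]
      congr 2
      ext; simp
    have h2 : ∑ i, (Q i - N) + n * N = ∑ i, Q i := by
      have : ∑ i : Fin n, N = n * N := by simp
      rw [← this, ← Finset.sum_add_distrib]
      exact Finset.sum_congr rfl fun i _ => Nat.sub_add_cancel (hN i).le
    rw [h1]
    rw [hsum] at h2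
    linarith
  refine ⟨(1 / δ) ^ (∑ j ∈ range (numLevels Q), θ j) * (2 * n) ^ N, by positivity,
    fun h f X w P hh hf hX hw hP hPX hle => ?_⟩
  have hn' : (0 : ℝ) < n := by exact_mod_cast hn
  have h1 : ∏ j ∈ range (numLevels Q), ((w / P j) *
      ((∏ i ∈ auxKer Q j, h i) * (f / (2 * n)) ^ #(auxKer Q j))) ^ θ j ≤
      ∏ j ∈ range (numLevels Q), ((1 / δ) * X ^ #(auxKer Q j)) ^ θ j := by
    refine Finset.prod_le_prod (fun j _ => ?_) fun j hj => ?_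
    · have := hP j
      have h2 : 0 < ∏ i ∈ auxKer Q j, h i := Finset.prod_pos fun i _ => hh i
      positivity
    · have hPj := hP j
      refine pow_le_pow_left₀ ?_ ?_ _
      · have h2 : 0 < ∏ i ∈ auxKer Q j, h i := Finset.prod_pos fun i _ => hh i
        positivity
      · refine (mul_le_mul_of_nonneg_left (hle j (by simpa using hj)) (by positivity)).trans
          (le_of_eq ?_)
        field_simp
  simp only [mul_pow, Finset.prod_mul_distrib, ← pow_mul, Finset.prod_pow_eq_pow_sum, hθk] at h1
  have h2 : ∏ j ∈ range (numLevels Q), (∏ i ∈ auxKer Q j, h i) ^ θ j = ∏ i, h i ^ (Q i - N) := by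
    simp only [← hθi, ← Finset.prod_pow_eq_pow_sum, Finset.prod_filter, ← Finset.prod_pow]
    rw [Finset.prod_comm]
    refine Finset.prod_congr rfl fun j _ => ?_
    rw [← Finset.prod_filter]
    refine Finset.prod_congr ?_ fun _ _ => rfl
    ext; simp
  have h3 : ∏ j ∈ range (numLevels Q), (w / P j) ^ auxExp Q j =
      (∏ j ∈ range (numLevels Q), (w / P j) ^ θ j) * (w / X) ^ N := by
    simp only [← hθadd, pow_add, Finset.prod_mul_distrib]
    congr 1
    rw [Finset.prod_eq_single l (fun j _ hj => by simp [hj]) (fun h => absurd hlmem h)]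
    simp [hPX l hl]
  rw [h2] at h1
  rw [h3]
  have h4 : f ^ N = (f / (2 * n)) ^ N * (2 * n) ^ N := by
    rw [← mul_pow, div_mul_cancel₀ _ (by positivity)]
  have h5 : w ^ N = (w / X) ^ N * X ^ N := by
    rw [← mul_pow, div_mul_cancel₀ _ hX.ne']
  rw [h4, h5]
  calc _ = ((w / X) ^ N * (2 * n) ^ N) * ((∏ j ∈ range (numLevels Q), (w / P j) ^ θ j) *
        ((∏ i, h i ^ (Q i - N)) * (f / (2 * n)) ^ N)) := by ring
    _ ≤ ((w / X) ^ N * (2 * n) ^ N) * ((1 / δ) ^ (∑ j ∈ range (numLevels Q), θ j) * X ^ N) := by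
      gcongr
    _ = _ := by ring

/-- A fiber all of whose sections are large is concentrated on a triangular box that controls its
determinant integrals. -/
theorem exists_fiber_box {n : ℕ} (hn : 0 < n) {Ω A : Set (Heis n)} (hA : MeasurableSet A)
    (hb : Bornology.IsBounded A) {rk : Fin n → ℕ} {o : ℕ → Fin n} (hrk : Function.Injective rk)
    (ho : ∀ b < n, rk (o b) = b) (hlt : ∀ i, rk i < n) {δ : ℝ}
    (hδ : ∀ k : Finset (Fin n), ∀ z ∈ A, δ * (volume.real Ω / volume.real (projY kᶜ '' Ω)) ≤
        volume.real (sliceY k A z))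
    (hpos : ∀ k : Finset (Fin n), 0 < δ * (volume.real Ω / volume.real (projY kᶜ '' Ω)))
    {z : Heis n} (hz : z ∈ A) :
    0 < volume.real (fibY A z) ∧
    (∀ s : Finset (Fin n), δ * (volume.real Ω / volume.real (projY s '' Ω)) *
      volume.real (coordProj s '' fibY A z) ≤ volume.real (fibY A z)) ∧
    ∃ (h : Fin n → ℝ) (c : Fin n → Fin n → ℝ), (∀ i, 0 < h i) ∧
      volume.real (fibY A z) ≤ 2 * volume.real (fibY A z ∩ triBox rk c h) ∧
      ∀ K : Finset (Fin n), (∀ i ∈ K, ∀ i', rk i' ≤ rk i → i' ∈ K) → ∀ L : ℝ, 0 ≤ L →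
        detIntegral o #K (fibY A z) ≤ ENNReal.ofReal L →
        (∏ i ∈ K, h i) * (volume.real (fibY A z) / (2 * n)) ^ #K ≤ L := by
  have hFm := measurableSet_fibY hA z
  have hFb := isBounded_fibY hb z
  have hF : volume (fibY A z) ≠ ∞ := hFb.measure_lt_top.ne
  have h0 : 0 < volume.real (fibY A z) := by
    have h1 := hδ univ z hz
    rw [measureReal_def volume (sliceY univ A z), volume_sliceY_of_eq_univ rfl hA,
      ← measureReal_def] at h1
    exact (hpos univ).trans_le h1
  have hF0 : volume (fibY A z) ≠ 0 := fun h => by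
    rw [measureReal_def, h] at h0; exact lt_irrefl _ h0
  have hn' : (0 : ℝ) < n := by exact_mod_cast hn
  refine ⟨h0, fun s => ?_, ?_⟩
  · have h1 := mul_volume_coordProj_le (s := s) (k := sᶜ) (compl_compl s).symm hFm
      (τ := ENNReal.ofReal (δ * (volume.real Ω / volume.real (projY s '' Ω)))) fun u hu => by
        rw [setOf_add_mem_fibY]
        have h2 := hδ sᶜ (expY u z) hu
        rw [compl_compl] at h2
        exact (ENNReal.ofReal_le_iff_le_toReal (volume_sliceY_ne_top _ hb _)).2 h2
    have h2 := ENNReal.toReal_mono hF h1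
    have h3 := hpos sᶜ
    rw [compl_compl] at h3
    rwa [ENNReal.toReal_mul, ENNReal.toReal_ofReal h3.le] at h2
  · obtain ⟨h, c, hh, hT, hdet⟩ := exists_triangular_box rk o hrk ho hFm hFb hF0
      (η := ENNReal.ofReal (1 / (2 * n))) (by
        rw [ENNReal.ofReal_lt_one, div_lt_one (by positivity)]
        have : (1 : ℝ) ≤ n := by exact_mod_cast hn
        linarith)
    refine ⟨h, c, hh, ?_, fun K hK L hL hdL => ?_⟩
    · have hT1 : volume (fibY A z ∩ triBox rk c h) ≠ ∞ :=
        ne_top_of_le_ne_top hF (measure_mono Set.inter_subset_left)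
      have hT2 : (n : ℝ≥0∞) * (ENNReal.ofReal (1 / (2 * n)) * volume (fibY A z)) ≠ ∞ :=
        ENNReal.mul_ne_top (ENNReal.natCast_ne_top _) (ENNReal.mul_ne_top ENNReal.ofReal_ne_top hF)
      have h1 := ENNReal.toReal_mono (ENNReal.add_ne_top.2 ⟨hT1, hT2⟩) hT
      rw [ENNReal.toReal_add hT1 hT2, ENNReal.toReal_mul, ENNReal.toReal_mul,
        ENNReal.toReal_natCast, ENNReal.toReal_ofReal (by positivity), ← measureReal_def,
        ← measureReal_def] at h1
      have h2 : (n : ℝ) * (1 / (2 * n) * volume.real (fibY A z)) =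
          1 / 2 * volume.real (fibY A z) := by field_simp
      linarith
    · obtain ⟨_, hKn, hprod⟩ := exists_equiv_of_initial hrk ho hlt hK
      have h1 := (hdet #K hKn).trans hdL
      have h2 := ENNReal.toReal_mono ENNReal.ofReal_ne_top h1
      rw [ENNReal.toReal_prod, ENNReal.toReal_ofReal hL] at h2
      simp only [ENNReal.toReal_mul, ENNReal.toReal_ofReal (hh _).le] at h2
      rw [ENNReal.toReal_ofReal (by positivity), ← measureReal_def, Finset.prod_mul_distrib,
        Finset.prod_const, Finset.card_range, hprod] at h2
      refine le_trans (le_of_eq ?_) h2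
      congr 2
      field_simp

end

section

/-- The set of indices `j ≥ m` with `i ∈ V j`. -/
def classY {n M : ℕ} (m : ℕ) (V : Fin M → Finset (Fin n)) (i : Fin n) :
    Finset {j // j ∈ idxY M m} := univ.filter fun j => i ∈ V j

theorem mem_classY {n M : ℕ} {m : ℕ} {V : Fin M → Finset (Fin n)} (i : Fin n)
    (j : {j // j ∈ idxY M m}) : j ∈ classY m V i ↔ i ∈ V j := by simp [classY]

theorem bigQ_eq_sum_subtype {n M : ℕ} (m : ℕ) (V : Fin M → Finset (Fin n)) (e : Fin M → ℕ)
    (i : Fin n) : bigQ m V e i =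
      ∑ j ∈ univ.filter (fun j : {j // j ∈ idxX M m} => i ∉ V j), e j := by
  rw [bigQ, Finset.sum_filter, Finset.sum_filter]
  exact (Finset.sum_coe_sort (idxX M m) fun j => if i ∉ V j then e j else 0).symm

theorem IsAdmissible.bigQ_eq_subtype {n M : ℕ} {m : ℕ} {V : Fin M → Finset (Fin n)}
    {e : Fin M → ℕ} {q : ℕ} (had : IsAdmissible m V e q) (i : Fin n) :
    bigQ m V e i =
      ∑ j ∈ univ.filter (fun j : {j // j ∈ idxY M m} => i ∉ V j), e j := by
  rw [had.bigQ_eq, Finset.sum_filter, Finset.sum_filter]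
  exact (Finset.sum_coe_sort (idxY M m) fun j => if i ∉ V j then e j else 0).symm

/-- `rk` ranks the coordinates so that `Q` decreases and the classes of coordinates not separated by
the `V j`, `j ≥ m`, are contiguous. -/
structure IsRanking {n M : ℕ} (m : ℕ) (V : Fin M → Finset (Fin n)) (e : Fin M → ℕ)
    (rk : Fin n → ℕ) (o : ℕ → Fin n) : Prop where
  inj : Function.Injective rk
  rank : ∀ b < n, rk (o b) = b
  lt : ∀ i, rk i < n
  anti : ∀ i i', rk i ≤ rk i' → bigQ m V e i' ≤ bigQ m V e i
  contiguous : ∀ i j k, rk i ≤ rk j → rk j ≤ rk k → classY m V i = classY m V k →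
    classY m V j = classY m V k

theorem IsAdmissible.exists_ranking {n M : ℕ} {m : ℕ} {V : Fin M → Finset (Fin n)}
    {e : Fin M → ℕ} {q : ℕ} (had : IsAdmissible m V e q) : ∃ rk o, IsRanking m V e rk o := by
  obtain ⟨rk, o, h1, h2, h3, h4, h5⟩ := exists_order had.dim_pos (bigQ m V e) (classY m V)
    fun i k hik => by
      have : ∀ j : {j // j ∈ idxY M m}, i ∈ V j ↔ k ∈ V j := fun j => by
        rw [← mem_classY, ← mem_classY, hik]
      rw [had.bigQ_eq_subtype, had.bigQ_eq_subtype]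
      simp only [this]
  exact ⟨rk, o, h1, h2, h3, h4, h5⟩

/-- The loss parameter of the refinement procedure. -/
def lossParam {n M : ℕ} (m : ℕ) (V : Fin M → Finset (Fin n)) (e : Fin M → ℕ) : ℝ :=
  1 / (16 * (2 ^ n + 1 + numLevels (bigQ m V e)))

theorem lossParam_pos {n M : ℕ} (m : ℕ) (V : Fin M → Finset (Fin n)) (e : Fin M → ℕ) :
    0 < lossParam m V e := by unfold lossParam; positivity

/-- A subset of `Ω` all of whose fibers along the maps `projY` are large, with a set of points at
which the determinant integrals of the fibers are controlled. -/
structure IsGoodPair {n M : ℕ} (m : ℕ) (V : Fin M → Finset (Fin n)) (e : Fin M → ℕ)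
    (o : ℕ → Fin n) (Ω A G : Set (Heis n)) : Prop where
  subset : A ⊆ Ω
  subset' : G ⊆ A
  measurable : MeasurableSet A
  measurable' : MeasurableSet G
  slice : ∀ k : Finset (Fin n), ∀ z ∈ A,
    lossParam m V e * (volume.real Ω / volume.real (projY kᶜ '' Ω)) ≤ volume.real (sliceY k A z)
  det : ∀ z ∈ G, ∀ j < numLevels (bigQ m V e),
    detIntegral o #(auxKer (bigQ m V e) j) (fibY A z) ≤
        ENNReal.ofReal (volume.real (projX (∅ : Finset (Fin n)) '' Ω) ^ #(auxKer (bigQ m V e) j) *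
          volume.real (projX (auxKer (bigQ m V e) j)ᶜ '' Ω) / (lossParam m V e * volume.real Ω))

variable {n M m : ℕ} {V : Fin M → Finset (Fin n)} {e : Fin M → ℕ} {q : ℕ} {rk : Fin n → ℕ}
  {o : ℕ → Fin n}

theorem exists_isGoodPair (hr : IsRanking m V e rk o) {Ω A₀ : Set (Heis n)}
    (hb : Bornology.IsBounded Ω) (hΩm : NullMeasurableSet Ω) (hA : MeasurableSet A₀)
    (hAΩ : A₀ ⊆ Ω) (hΩ0 : 0 < volume Ω) (hA0 : volume.real Ω ≤ 2 * volume.real A₀) :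
    ∃ A G, A ⊆ A₀ ∧ IsGoodPair m V e o Ω A G ∧
      volume.real A₀ ≤ volume.real G + 1 / 8 * volume.real Ω := by
  set δ := lossParam m V e with hδ
  have hδ0 : 0 < δ := lossParam_pos m V e
  have hΩ : 0 < volume.real Ω := ENNReal.toReal_pos hΩ0.ne' hb.measure_lt_top.ne
  have hl1 : (2 ^ n + 1) * (δ * volume.real Ω) ≤ 1 / 16 * volume.real Ω := by
    rw [← mul_assoc]
    gcongr
    rw [hδ, lossParam, mul_one_div, div_le_div_iff₀ (by positivity) (by norm_num)]
    have : (0 : ℝ) ≤ numLevels (bigQ m V e) := Nat.cast_nonneg _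
    linarith
  have hl2 : numLevels (bigQ m V e) * (δ * volume.real Ω) ≤ 1 / 16 * volume.real Ω := by
    rw [← mul_assoc]
    gcongr
    rw [hδ, lossParam, mul_one_div, div_le_div_iff₀ (by positivity) (by norm_num)]
    have : (0 : ℝ) ≤ 2 ^ n := by positivity
    linarith
  obtain ⟨A, hAA, hAm, hAs, _, hloss⟩ := exists_refineY hA hAΩ hb hΩm hδ0.le
  have hApos : 0 < volume.real A := by linarith
  obtain ⟨G, hGA, hGm, hGloss, hG⟩ := exists_detIntegral_le hAm (hAA.trans hAΩ) hb
    (fun h => by rw [measureReal_def, h] at hApos; exact lt_irrefl _ hApos)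
    hr.inj hr.rank hr.lt hr.anti hδ0
  exact ⟨A, G, hAA, ⟨hAA.trans hAΩ, hGA, hAm, hGm, hAs, hG⟩, by linarith⟩

theorem exists_measurable_core {Ω : Set (Heis n)}
    (h : NullMeasurableSet Ω (volume : Measure (Heis n))) :
    ∃ Ω₀ ⊆ Ω, MeasurableSet Ω₀ ∧ volume Ω₀ = volume Ω := by
  obtain ⟨t, ht, htm, hte⟩ := h.exists_measurable_subset_ae_eq
  exact ⟨t, ht, htm, measure_congr hte⟩

theorem measureReal_pos_of {Ω : Set (Heis n)} (hb : Bornology.IsBounded Ω) (h0 : 0 < volume Ω) :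
    0 < volume.real Ω := ENNReal.toReal_pos h0.ne' hb.measure_lt_top.ne

theorem measureReal_projX_pos {Ω : Set (Heis n)} (hb : Bornology.IsBounded Ω)
    (hm : NullMeasurableSet Ω (volume : Measure (Heis n))) (h0 : 0 < volume Ω)
    (s : Finset (Fin n)) : 0 < volume.real (projX s '' Ω) := by
  obtain ⟨t, ht, htm, hte⟩ := exists_measurable_core hm
  exact ENNReal.toReal_pos (volume_projX_ne_zero s htm ht (hte ▸ h0.ne')) (volume_projX_ne_top s hb)

theorem measureReal_projY_pos {Ω : Set (Heis n)} (hb : Bornology.IsBounded Ω)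
    (hm : NullMeasurableSet Ω (volume : Measure (Heis n))) (h0 : 0 < volume Ω)
    (s : Finset (Fin n)) : 0 < volume.real (projY s '' Ω) := by
  obtain ⟨t, ht, htm, hte⟩ := exists_measurable_core hm
  exact ENNReal.toReal_pos (volume_projY_ne_zero s htm ht (hte ▸ h0.ne')) (volume_projY_ne_top s hb)

theorem piSize_pos {Ω : Set (Heis n)} (hb : Bornology.IsBounded Ω)
    (hm : NullMeasurableSet Ω (volume : Measure (Heis n))) (h0 : 0 < volume Ω)
    (j : Fin M) : 0 < piSize m V j Ω := by
  unfold piSize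
  split_ifs
  · exact measureReal_projX_pos hb hm h0 _
  · exact measureReal_projY_pos hb hm h0 _

theorem alpha_pos {Ω : Set (Heis n)} (hb : Bornology.IsBounded Ω)
    (hm : NullMeasurableSet Ω (volume : Measure (Heis n))) (h0 : 0 < volume Ω)
    (j : Fin M) : 0 < alpha m V Ω j :=
  div_pos (measureReal_pos_of hb h0) (piSize_pos hb hm h0 j)

theorem beta_pos {Ω : Set (Heis n)} (hb : Bornology.IsBounded Ω)
    (hm : NullMeasurableSet Ω (volume : Measure (Heis n))) (h0 : 0 < volume Ω)
    (Q : Fin n → ℕ) (j : ℕ) : 0 < beta Q Ω j :=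
  div_pos (measureReal_pos_of hb h0) (measureReal_projX_pos hb hm h0 _)

theorem alpha_idxX {Ω : Set (Heis n)} {j : Fin M} (hj : j ∈ idxX M m) :
    alpha m V Ω j = volume.real Ω / volume.real (projX (V j) '' Ω) := by
  have : (j : ℕ) < m := by simpa [idxX] using hj
  simp [alpha, piSize, this]

theorem alpha_idxY {Ω : Set (Heis n)} {j : Fin M} (hj : j ∈ idxY M m) :
    alpha m V Ω j = volume.real Ω / volume.real (projY (V j) '' Ω) := by
  have : ¬ (j : ℕ) < m := by simpa [idxY] using hj
  simp [alpha, piSize, this]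

/-- The estimates for the fiber through a good point in terms of a triangular box. -/
theorem exists_fiber_estimates (had : IsAdmissible m V e q) (hr : IsRanking m V e rk o) :
    ∃ C : ℝ, 1 ≤ C ∧ ∀ Ω A G : Set (Heis n), Bornology.IsBounded Ω →
      NullMeasurableSet Ω (volume : Measure (Heis n)) → 0 < volume Ω →
      IsGoodPair m V e o Ω A G → ∀ z ∈ G, 0 < volume.real (fibY A z) ∧
      ∃ (h : Fin n → ℝ) (c : Fin n → Fin n → ℝ), (∀ i, 0 < h i) ∧
        volume.real (fibY A z) ≤ 2 * volume.real (fibY A z ∩ triBox rk c h) ∧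
        (∏ j ∈ range (numLevels (bigQ m V e)), beta (bigQ m V e) Ω j ^ auxExp (bigQ m V e) j) *
          ((∏ i, h i ^ (bigQ m V e i - bigN e q)) * volume.real (fibY A z) ^ bigN e q) ≤
          C * volume.real Ω ^ bigN e q ∧
        (∀ N' ≤ bigN e q + 1, ∏ j ∈ idxY M m, alpha m V Ω j ^ e j ≤
          C * ((∏ i, h i ^ (bigQ m V e i - N')) * volume.real (fibY A z) ^ N')) ∧
        ∀ κ : ℝ, 0 < κ →
          κ * ∏ i, h i ^ bigQ m V e i ≤ ∏ j ∈ idxY M m, alpha m V Ω j ^ e j →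
          ∀ b, ∀ v ∈ triBox rk c h,
            |triForm rk (fun j => if classY m V j = classY m V b then c b j else 0) b v| ≤
              4 * (1 + C / κ) ^ n * h b := by
  set δ := lossParam m V e with hδ
  have hδ0 : 0 < δ := lossParam_pos m V e
  obtain ⟨C₁, hC₁, hlev⟩ := exists_prod_levels_le had.dim_pos (bigQ m V e) had.bigN_lt
    had.sum_bigQ hδ0
  set E := ∑ j : {j // j ∈ idxY M m}, e j with hE
  set C₂ : ℝ := 2 ^ E * 8 ^ (∑ i, bigQ m V e i) / δ ^ E with hC₂
  have hC₂0 : 0 < C₂ := by positivity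
  refine ⟨1 + C₁ + C₂, by linarith, fun Ω A G hb hm h0 hG z hz => ?_⟩
  have hAb : Bornology.IsBounded A := hb.subset hG.subset
  have hw := measureReal_pos_of hb h0
  have hpX := measureReal_projX_pos hb hm h0
  have hpY := measureReal_projY_pos hb hm h0
  obtain ⟨hf, hsec, h, c, hh, hT, hdet⟩ := exists_fiber_box had.dim_pos hG.measurable hAb hr.inj
    hr.rank hr.lt hG.slice (fun k => mul_pos hδ0 (div_pos hw (hpY kᶜ))) (hG.subset' hz)
  have hT0 : 0 < volume.real (fibY A z ∩ triBox rk c h) := by linarith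
  have hTm : MeasurableSet (fibY A z ∩ triBox rk c h) :=
    (measurableSet_fibY hG.measurable z).inter (isClosed_triBox rk c h).measurableSet
  have hFb := isBounded_fibY hAb z
  have hα : ∀ j, 0 < alpha m V Ω j := alpha_pos hb hm h0
  have hQE : ∀ i, bigQ m V e i ≤ E := fun i => by
    rw [had.bigQ_eq_subtype]
    exact Finset.sum_le_sum_of_subset
      (Finset.filter_subset (fun j : {j // j ∈ idxY M m} => i ∉ V j) _)
  have haF : ∀ j : {j // j ∈ idxY M m}, δ * alpha m V Ω j *
      volume.real (coordProj (V j) '' fibY A z) ≤ volume.real (fibY A z) := fun j => by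
    rw [alpha_idxY j.2]; exact hsec (V j)
  have hprodδ : ∏ j : {j // j ∈ idxY M m}, (δ * alpha m V Ω j) ^ e j =
      δ ^ E * ∏ j ∈ idxY M m, alpha m V Ω j ^ e j := by
    simp only [mul_pow, Finset.prod_mul_distrib, Finset.prod_pow_eq_pow_sum, hE]
    rw [Finset.prod_coe_sort (idxY M m) fun j => alpha m V Ω j ^ e j]
  have hH0 : ∀ N', 0 < (∏ i, h i ^ (bigQ m V e i - N')) * volume.real (fibY A z) ^ N' := fun N' =>
    mul_pos (Finset.prod_pos fun i _ => pow_pos (hh i) _) (pow_pos hf _)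
  refine ⟨hf, h, c, hh, hT, ?_, fun N' hN' => ?_, fun κ hκ hκa b v hv => ?_⟩
  · have h1 := hlev h (volume.real (fibY A z)) (volume.real (projX (∅ : Finset (Fin n)) '' Ω))
      (volume.real Ω) (fun j => volume.real (projX (auxKer (bigQ m V e) j)ᶜ '' Ω)) hh hf (hpX _) hw
      (fun j => hpX _) (fun j hj => by rw [auxKer_eq_univ hj, Finset.compl_univ])
      (fun j hj => by
        refine hdet _ (fun i hi i' h => mem_auxKer.2 ((mem_auxKer.1 hi).trans (hr.anti i' i h))) _
          ?_ (hG.det z hz j hj)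
        have h1 := hpX (auxKer (bigQ m V e) j)ᶜ
        have h2 := hpX ∅
        positivity)
    refine h1.trans ?_
    gcongr
    linarith
  · have hN'Q : ∀ i, N' ≤ bigQ m V e i := fun i => hN'.trans (had.bigN_lt i)
    have h1 := prod_pow_le_of_subset_triBox (V := fun j : {j // j ∈ idxY M m} => V j)
      (e := fun j => e j) (a := fun j => δ * alpha m V Ω j)
      hr.inj had.bigQ_eq_subtype hh hTm Set.inter_subset_left
      Set.inter_subset_right hFb hT0 hT (fun j => (mul_pos hδ0 (hα j)).le) haF hN'Q
      ((hN'Q ⟨0, had.dim_pos⟩).trans (hQE _))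
    rw [hprodδ] at h1
    have h2 : ∏ j ∈ idxY M m, alpha m V Ω j ^ e j ≤
        C₂ * ((∏ i, h i ^ (bigQ m V e i - N')) * volume.real (fibY A z) ^ N') := by
      rw [hC₂, div_mul_eq_mul_div, le_div_iff₀ (by positivity), mul_comm]
      exact h1
    refine h2.trans (mul_le_mul_of_nonneg_right (by linarith) (hH0 N').le)
  · have h1 := abs_triForm_class_le (V := fun j : {j // j ∈ idxY M m} => V j)
      (e := fun j => e j) (a := fun j => δ * alpha m V Ω j) (c := c) (κ := δ ^ E * κ)
      hr.inj (fun j => had.exp_pos j) had.bigQ_eq_subtype hr.anti (classY m V)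
      (fun i j => mem_classY i j) hr.contiguous hh hTm Set.inter_subset_left
      Set.inter_subset_right hFb hT0 hT (fun j => (mul_pos hδ0 (hα j)).le) haF
      (by positivity) (by rw [hprodδ, mul_assoc]; gcongr) b hv
    refine h1.trans ?_
    have := hh b
    rw [← div_div, ← hE, ← hC₂]
    gcongr
    linarith

end

section

variable {n M m : ℕ} {V : Fin M → Finset (Fin n)} {e : Fin M → ℕ} {q : ℕ} {rk : Fin n → ℕ}
  {o : ℕ → Fin n}

theorem prod_idxX_mul_prod_idxY (m : ℕ) (f : Fin M → ℝ) :
    (∏ j ∈ idxX M m, f j) * ∏ j ∈ idxY M m, f j = ∏ j, f j := by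
  rw [← Finset.prod_filter_mul_prod_filter_not univ (fun j : Fin M => (j : ℕ) < m)]
  simp [idxX, idxY]

/-- The product of the average fibers of the maps `π_j`, `j < m`, is bounded by that of the
auxiliary maps with nested kernels for semiregular sets. -/
theorem prod_alpha_le_of_isSemiregular (hn : 0 < n) (m : ℕ) (V : Fin M → Finset (Fin n))
    (e : Fin M → ℕ) {σ : ℝ} (hσ : 0 < σ) {Ω : Set (Heis n)}
    (hΩ : IsSemiregular (bigQ m V e) σ Ω) :
    ∏ j, alpha m V Ω j ^ e j ≤
      (2 * σ⁻¹) ^ (∑ j ∈ range (numLevels (bigQ m V e)), auxExp (bigQ m V e) j) *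
      ((∏ j ∈ range (numLevels (bigQ m V e)), beta (bigQ m V e) Ω j ^ auxExp (bigQ m V e) j) *
        ∏ j ∈ idxY M m, alpha m V Ω j ^ e j) := by
  have hb := hΩ.bounded
  have hm := hΩ.measurable
  have h0 := hΩ.pos
  obtain ⟨t, ht, htm, hte⟩ := exists_measurable_core hm
  have htb := hb.subset ht
  have hβ := beta_pos hb hm h0 (bigQ m V e)
  have hpX := measureReal_projX_pos hb hm h0
  have key := measureReal_pow_le_of_nested hn (fun j : {j // j ∈ idxX M m} => V j)
    (fun j => e j) (bigQ m V e) (bigQ_eq_sum_subtype m V e) htm htb (hte ▸ h0.ne')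
    (fun j => 2 * σ⁻¹ * beta (bigQ m V e) Ω j)
    (fun j => by have := hβ j; positivity) (fun j hj z hz =>
      (measureReal_mono (sliceX_mono _ ht z) (volume_sliceX_ne_top _ hb z)).trans
        (hΩ.fiber_le z (ht hz) j hj))
  have hte' : volume.real t = volume.real Ω := by rw [measureReal_def, hte, measureReal_def]
  rw [hte', Finset.prod_coe_sort (idxX M m) fun j => volume.real (projX (V j) '' t) ^ e j] at key
  simp only [mul_pow (2 * σ⁻¹), Finset.prod_mul_distrib, Finset.prod_pow_eq_pow_sum] at key
  have h1 : (∏ j ∈ idxX M m, alpha m V Ω j ^ e j) *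
      ∏ j ∈ idxX M m, volume.real (projX (V j) '' Ω) ^ e j =
        volume.real Ω ^ ∑ j : {j // j ∈ idxX M m}, e j := by
    rw [Finset.sum_coe_sort (idxX M m) fun j => e j, ← Finset.prod_mul_distrib,
      ← Finset.prod_pow_eq_pow_sum]
    refine Finset.prod_congr rfl fun j hj => ?_
    rw [alpha_idxX hj, ← mul_pow, div_mul_cancel₀ _ (hpX _).ne']
  have h2 : 0 < ∏ j ∈ idxX M m, volume.real (projX (V j) '' Ω) ^ e j :=
    Finset.prod_pos fun j _ => pow_pos (hpX _) _
  have h3 : ∏ j ∈ idxX M m, volume.real (projX (V j) '' t) ^ e j ≤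
      ∏ j ∈ idxX M m, volume.real (projX (V j) '' Ω) ^ e j :=
    Finset.prod_le_prod (fun j _ => pow_nonneg measureReal_nonneg _) fun j _ =>
      pow_le_pow_left₀ measureReal_nonneg
        (measureReal_mono (Set.image_mono ht) (volume_projX_ne_top _ hb)) _
  have h4 : 0 ≤ ∏ j ∈ range (numLevels (bigQ m V e)),
      beta (bigQ m V e) Ω j ^ auxExp (bigQ m V e) j :=
    Finset.prod_nonneg fun j _ => (pow_pos (hβ j) _).le
  have h5 : ∏ j ∈ idxX M m, alpha m V Ω j ^ e j ≤
      (2 * σ⁻¹) ^ (∑ j ∈ range (numLevels (bigQ m V e)), auxExp (bigQ m V e) j) *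
        ∏ j ∈ range (numLevels (bigQ m V e)),
          beta (bigQ m V e) Ω j ^ auxExp (bigQ m V e) j := by
    refine le_of_mul_le_mul_right ?_ h2
    rw [h1]
    refine key.trans ?_
    gcongr
  rw [← prod_idxX_mul_prod_idxY m, ← mul_assoc]
  refine mul_le_mul_of_nonneg_right h5 (Finset.prod_nonneg fun j _ => ?_)
  exact (pow_pos (alpha_pos hb hm h0 j) _).le

/-- The lower bound for the measure in terms of the average fibers. -/
theorem exists_prod_beta_mul_prod_alpha_le (had : IsAdmissible m V e q) :
    ∃ C : ℝ, 1 ≤ C ∧ ∀ Ω : Set (Heis n), Bornology.IsBounded Ω →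
      NullMeasurableSet Ω (volume : Measure (Heis n)) → 0 < volume Ω →
      (∏ j ∈ range (numLevels (bigQ m V e)), beta (bigQ m V e) Ω j ^ auxExp (bigQ m V e) j) *
        ∏ j ∈ idxY M m, alpha m V Ω j ^ e j ≤ C * volume.real Ω ^ bigN e q := by
  obtain ⟨rk, o, hr⟩ := had.exists_ranking
  obtain ⟨C, hC, hest⟩ := exists_fiber_estimates had hr
  refine ⟨C * C, by nlinarith, fun Ω hb hm h0 => ?_⟩
  obtain ⟨t, ht, htm, hte⟩ := exists_measurable_core hm
  have hte' : volume.real t = volume.real Ω := by rw [measureReal_def, hte, measureReal_def]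
  have hw := measureReal_pos_of hb h0
  obtain ⟨A, G, -, hG, hloss⟩ := exists_isGoodPair hr hb hm htm ht h0 (by linarith)
  have hGpos : 0 < volume.real G := by linarith
  obtain ⟨z, hz⟩ : G.Nonempty := by
    by_contra hne
    rw [Set.not_nonempty_iff_eq_empty] at hne
    rw [hne, measureReal_empty] at hGpos
    exact lt_irrefl _ hGpos
  obtain ⟨hf, h, c, hh, -, h1, h2, -⟩ := hest Ω A G hb hm h0 hG z hz
  have hβ : 0 ≤ ∏ j ∈ range (numLevels (bigQ m V e)),
      beta (bigQ m V e) Ω j ^ auxExp (bigQ m V e) j :=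
    Finset.prod_nonneg fun j _ => (pow_pos (beta_pos hb hm h0 _ j) _).le
  calc _ ≤ (∏ j ∈ range (numLevels (bigQ m V e)),
        beta (bigQ m V e) Ω j ^ auxExp (bigQ m V e) j) *
        (C * ((∏ i, h i ^ (bigQ m V e i - bigN e q)) * volume.real (fibY A z) ^ bigN e q)) :=
        mul_le_mul_of_nonneg_left (h2 _ (Nat.le_succ _)) hβ
    _ = C * ((∏ j ∈ range (numLevels (bigQ m V e)),
        beta (bigQ m V e) Ω j ^ auxExp (bigQ m V e) j) *
        ((∏ i, h i ^ (bigQ m V e i - bigN e q)) * volume.real (fibY A z) ^ bigN e q)) := by ring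
    _ ≤ C * (C * volume.real Ω ^ bigN e q) := by gcongr
    _ = _ := by ring

theorem prod_alpha_mul_prod_piSize {Ω : Set (Heis n)} (hb : Bornology.IsBounded Ω)
    (hm : NullMeasurableSet Ω (volume : Measure (Heis n))) (h0 : 0 < volume Ω) :
    (∏ j, alpha m V Ω j ^ e j) * ∏ j, piSize m V j Ω ^ e j = volume.real Ω ^ ∑ j, e j := by
  rw [← Finset.prod_mul_distrib, ← Finset.prod_pow_eq_pow_sum]
  refine Finset.prod_congr rfl fun j _ => ?_
  rw [← mul_pow, alpha, div_mul_cancel₀ _ (piSize_pos hb hm h0 j).ne']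

theorem prod_piSize_rpow_pow {p : Fin M → ℚ} (hq : 0 < q) (hpq : ∀ j, (p j)⁻¹ = (e j : ℚ) / q)
    (Ω : Set (Heis n)) :
    (∏ j, piSize m V j Ω ^ (1 / (p j : ℝ))) ^ q = ∏ j, piSize m V j Ω ^ e j := by
  rw [← Finset.prod_pow]
  refine Finset.prod_congr rfl fun j _ => ?_
  have h1 : (1 / (p j : ℝ)) = (e j : ℝ) / q := by
    rw [one_div, ← Rat.cast_inv, hpq]; push_cast; rfl
  have h2 : (q : ℝ) ≠ 0 := by positivity
  have h3 : 0 ≤ piSize m V j Ω := by unfold piSize; split_ifs <;> exact measureReal_nonneg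
  rw [h1, ← Real.rpow_mul_natCast h3, div_mul_cancel₀ _ h2, Real.rpow_natCast]

theorem inv_mul_rpow_mul_le {K σ x y : ℝ} {D : ℕ} (hK : 0 < K) (hσ : 0 < σ)
    (h : x ≤ K * σ⁻¹ ^ D * y) : K⁻¹ * σ ^ (D : ℝ) * x ≤ y := by
  have h1 : K⁻¹ * σ ^ (D : ℝ) * x ≤ K⁻¹ * σ ^ (D : ℝ) * (K * σ⁻¹ ^ D * y) := by gcongr
  refine h1.trans (le_of_eq ?_)
  rw [Real.rpow_natCast, inv_pow]
  field_simp

/-- The restricted inequality for semiregular sets, with its two steps. -/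
theorem exists_semiregular_bounds (had : IsAdmissible m V e q) {p : Fin M → ℚ}
    (hpq : ∀ j, (p j)⁻¹ = (e j : ℚ) / q) :
    ∃ (D : ℕ) (K : ℝ), 0 < D ∧ 1 ≤ K ∧ ∀ (σ : ℝ) (Ω : Set (Heis n)), 0 < σ → σ < 1 →
      IsSemiregular (bigQ m V e) σ Ω →
      (∏ j ∈ range (numLevels (bigQ m V e)), beta (bigQ m V e) Ω j ^ auxExp (bigQ m V e) j) *
          (∏ j ∈ idxY M m, alpha m V Ω j ^ e j) ≤ K * σ⁻¹ ^ D * volume.real Ω ^ bigN e q ∧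
      ∏ j, alpha m V Ω j ^ e j ≤ K * σ⁻¹ ^ D *
        ((∏ j ∈ range (numLevels (bigQ m V e)), beta (bigQ m V e) Ω j ^ auxExp (bigQ m V e) j) *
          ∏ j ∈ idxY M m, alpha m V Ω j ^ e j) ∧
      volume.real Ω ≤ K * σ⁻¹ ^ D * ∏ j, piSize m V j Ω ^ (1 / (p j : ℝ)) := by
  obtain ⟨C, hC, hlow⟩ := exists_prod_beta_mul_prod_alpha_le had
  set D := ∑ j ∈ range (numLevels (bigQ m V e)), auxExp (bigQ m V e) j with hD
  have h2D : (1 : ℝ) ≤ 2 ^ D := one_le_pow₀ (by norm_num)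
  refine ⟨D + 1, C * 2 ^ D, Nat.succ_pos _, by nlinarith, fun σ Ω hσ hσ1 hΩ => ?_⟩
  have hb := hΩ.bounded
  have hm := hΩ.measurable
  have h0 := hΩ.pos
  have hw := measureReal_pos_of hb h0
  have hσ' : 1 ≤ σ⁻¹ := (one_le_inv₀ hσ).2 hσ1.le
  have hσD : (1 : ℝ) ≤ σ⁻¹ ^ (D + 1) := one_le_pow₀ hσ'
  have h1 := hlow Ω hb hm h0
  have h2 := prod_alpha_le_of_isSemiregular had.dim_pos m V e hσ hΩ
  rw [← hD, mul_pow] at h2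
  set P := (∏ j ∈ range (numLevels (bigQ m V e)),
    beta (bigQ m V e) Ω j ^ auxExp (bigQ m V e) j) * ∏ j ∈ idxY M m, alpha m V Ω j ^ e j with hP
  have hP0 : 0 < P := mul_pos (Finset.prod_pos fun j _ => pow_pos (beta_pos hb hm h0 _ j) _)
    (Finset.prod_pos fun j _ => pow_pos (alpha_pos hb hm h0 j) _)
  have hσpow : σ⁻¹ ^ D ≤ σ⁻¹ ^ (D + 1) := pow_le_pow_right₀ hσ' (Nat.le_succ _)
  have hC2 : C ≤ C * 2 ^ D := by nlinarith
  refine ⟨?_, ?_, ?_⟩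
  · refine h1.trans ?_
    gcongr
    nlinarith
  · refine h2.trans ?_
    gcongr
    nlinarith
  · have h3 : ∏ j, alpha m V Ω j ^ e j ≤ C * 2 ^ D * σ⁻¹ ^ (D + 1) * volume.real Ω ^ bigN e q := by
      refine h2.trans ?_
      calc 2 ^ D * σ⁻¹ ^ D * P ≤ 2 ^ D * σ⁻¹ ^ (D + 1) * (C * volume.real Ω ^ bigN e q) := by
            gcongr
        _ = _ := by ring
    have h4 := prod_alpha_mul_prod_piSize (m := m) (V := V) (e := e) hb hm h0
    have hS0 : 0 < ∏ j, piSize m V j Ω ^ e j :=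
      Finset.prod_pos fun j _ => pow_pos (piSize_pos hb hm h0 j) _
    have h5 : volume.real Ω ^ q ≤
        C * 2 ^ D * σ⁻¹ ^ (D + 1) * ∏ j, piSize m V j Ω ^ e j := by
      refine le_of_mul_le_mul_left ?_ (pow_pos hw (bigN e q))
      rw [← pow_add, had.bigN_add, ← h4]
      calc _ ≤ (C * 2 ^ D * σ⁻¹ ^ (D + 1) * volume.real Ω ^ bigN e q) *
            ∏ j, piSize m V j Ω ^ e j := by gcongr
        _ = _ := by ring
    rw [← prod_piSize_rpow_pow had.q_pos hpq] at h5
    have hR0 : 0 ≤ ∏ j, piSize m V j Ω ^ (1 / (p j : ℝ)) :=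
      Finset.prod_nonneg fun j _ => Real.rpow_nonneg (piSize_pos hb hm h0 j).le _
    have hbig : 1 ≤ C * 2 ^ D * σ⁻¹ ^ (D + 1) := by
      have : 1 ≤ C * 2 ^ D := by nlinarith
      nlinarith
    refine le_of_pow_le_pow_left₀ had.q_pos.ne' (by positivity) (h5.trans ?_)
    rw [mul_pow]
    gcongr
    exact le_self_pow₀ hbig had.q_pos.ne'

end

section

variable {n M m : ℕ} {V : Fin M → Finset (Fin n)} {e : Fin M → ℕ} {q : ℕ} {rk : Fin n → ℕ}
  {o : ℕ → Fin n}

/-- Only the coefficients between coordinates of the same class are kept. -/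
def classCoeff (m : ℕ) (V : Fin M → Finset (Fin n)) (c : Fin n → Fin n → ℝ) (b j : Fin n) : ℝ :=
  if classY m V j = classY m V b then c b j else 0

theorem IsQuasiextremal.pow_le (had : IsAdmissible m V e q) {p : Fin M → ℚ}
    (hpq : ∀ j, (p j)⁻¹ = (e j : ℚ) / q) {ε : ℝ} (hε : 0 < ε) {Ω : Set (Heis n)}
    (h0 : 0 < volume Ω) (hΩ : IsQuasiextremal m V p ε Ω) :
    ε ^ q * volume.real Ω ^ bigN e q ≤ ∏ j, alpha m V Ω j ^ e j := by
  have hb := hΩ.bounded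
  have hm := hΩ.measurable
  have hw := measureReal_pos_of hb h0
  have hR0 : 0 ≤ ∏ j, piSize m V j Ω ^ (1 / (p j : ℝ)) :=
    Finset.prod_nonneg fun j _ => Real.rpow_nonneg (piSize_pos hb hm h0 j).le _
  have h1 := pow_le_pow_left₀ (by positivity) hΩ.le q
  rw [mul_pow, prod_piSize_rpow_pow had.q_pos hpq] at h1
  have h4 := prod_alpha_mul_prod_piSize (m := m) (V := V) (e := e) hb hm h0
  have hα : 0 < ∏ j, alpha m V Ω j ^ e j :=
    Finset.prod_pos fun j _ => pow_pos (alpha_pos hb hm h0 j) _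
  refine le_of_mul_le_mul_right ?_ (pow_pos hw q)
  calc ε ^ q * volume.real Ω ^ bigN e q * volume.real Ω ^ q
      = ε ^ q * volume.real Ω ^ ∑ j, e j := by rw [mul_assoc, ← pow_add, had.bigN_add]
    _ = (∏ j, alpha m V Ω j ^ e j) * (ε ^ q * ∏ j, piSize m V j Ω ^ e j) := by rw [← h4]; ring
    _ ≤ (∏ j, alpha m V Ω j ^ e j) * volume.real Ω ^ q := by gcongr

/-- For quasiextremal sets the fibers through good points are concentrated on adapted boxes of
comparable measure. -/
theorem exists_adapted_concentration (had : IsAdmissible m V e q) (hr : IsRanking m V e rk o)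
    {p : Fin M → ℚ} (hpq : ∀ j, (p j)⁻¹ = (e j : ℚ) / q) :
    ∃ (D : ℕ) (K : ℝ), 1 ≤ K ∧ ∀ (σ ε : ℝ) (Ω A G : Set (Heis n)), 0 < σ → σ < 1 → 0 < ε → ε ≤ σ →
      IsSemiregular (bigQ m V e) σ Ω → IsQuasiextremal m V p ε Ω →
      IsGoodPair m V e o Ω A G → ∀ z ∈ G, 0 < volume.real (fibY A z) ∧
      ∃ (c : Fin n → Fin n → ℝ) (H : Fin n → ℝ), (∀ i, 0 < H i) ∧
        volume.real (fibY A z) ≤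
          2 * volume.real (fibY A z ∩ triBox rk (classCoeff m V c) H) ∧
        ∏ i, H i ≤ K * ε⁻¹ ^ D * volume.real (fibY A z) := by
  obtain ⟨C, hC, hest⟩ := exists_fiber_estimates had hr
  obtain ⟨D, K, -, hK, hsemi⟩ := exists_semiregular_bounds had hpq
  set N := bigN e q with hN
  have hC0 : 0 < C := by linarith
  refine ⟨(D + q) * ((N + 1) * n * n + 1),
    ((2 * C ^ (N + 1) * (C * K) ^ (N + 1)) ^ n) ^ n * (C * (C * K)), ?_, ?_⟩
  · have h1 : 1 ≤ C * K := by nlinarith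
    have h2 : (1 : ℝ) ≤ 2 * C ^ (N + 1) * (C * K) ^ (N + 1) := by
      have h3 : 1 ≤ C ^ (N + 1) := one_le_pow₀ hC
      have h4 : 1 ≤ (C * K) ^ (N + 1) := one_le_pow₀ h1
      nlinarith
    have h5 : (1 : ℝ) ≤ ((2 * C ^ (N + 1) * (C * K) ^ (N + 1)) ^ n) ^ n :=
      one_le_pow₀ (one_le_pow₀ h2)
    have h6 : 1 ≤ C * (C * K) := by nlinarith
    nlinarith
  intro σ ε Ω A G hσ hσ1 hε hεσ hΩ hΩε hG z hz
  have hb := hΩ.bounded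
  have hm := hΩ.measurable
  have h0 := hΩ.pos
  have hw := measureReal_pos_of hb h0
  obtain ⟨hf, h, c, hh, hT, hBH, hL, hcls⟩ := hest Ω A G hb hm h0 hG z hz
  obtain ⟨-, hPα, -⟩ := hsemi σ Ω hσ hσ1 hΩ
  have hqe := hΩε.pow_le had hpq hε h0
  rw [← hN] at *
  set Bβ := ∏ j ∈ range (numLevels (bigQ m V e)), beta (bigQ m V e) Ω j ^ auxExp (bigQ m V e) j
  set Aα := ∏ j ∈ idxY M m, alpha m V Ω j ^ e j
  set f := volume.real (fibY A z)
  have hBβ : 0 < Bβ := Finset.prod_pos fun j _ => pow_pos (beta_pos hb hm h0 _ j) _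
  have hAα : 0 < Aα := Finset.prod_pos fun j _ => pow_pos (alpha_pos hb hm h0 j) _
  have hσε : σ⁻¹ ≤ ε⁻¹ := inv_anti₀ hε hεσ
  have hε1 : 1 ≤ ε⁻¹ := (one_le_inv₀ hε).2 (by linarith)
  set Θ := C * K * ε⁻¹ ^ (D + q) with hΘ
  have hCK : 1 ≤ C * K := by nlinarith
  have hΘ1 : 1 ≤ Θ := by
    have : (1 : ℝ) ≤ ε⁻¹ ^ (D + q) := one_le_pow₀ hε1
    nlinarith
  have hHf : (∏ i, h i ^ (bigQ m V e i - N)) * f ^ N ≤ Θ * Aα := by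
    refine le_of_mul_le_mul_left (hBH.trans ?_) hBβ
    have h1 : volume.real Ω ^ N ≤ ε⁻¹ ^ q * ∏ j, alpha m V Ω j ^ e j := by
      rw [inv_pow, ← div_eq_inv_mul, le_div_iff₀ (by positivity), mul_comm]
      exact hqe
    calc C * volume.real Ω ^ N ≤ C * (ε⁻¹ ^ q * (K * ε⁻¹ ^ D * (Bβ * Aα))) := by
          gcongr
          refine h1.trans ?_
          gcongr
          refine hPα.trans ?_
          gcongr
      _ = Bβ * (Θ * Aα) := by rw [hΘ, pow_add]; ring
  have hprodh : 0 < ∏ i, h i := Finset.prod_pos fun i _ => hh i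
  have hH1 : 0 < ∏ i, h i ^ (bigQ m V e i - (N + 1)) := Finset.prod_pos fun i _ => pow_pos (hh i) _
  have hHN : ∏ i, h i ^ (bigQ m V e i - N) =
      (∏ i, h i ^ (bigQ m V e i - (N + 1))) * ∏ i, h i := by
    rw [← Finset.prod_mul_distrib]
    refine Finset.prod_congr rfl fun i _ => ?_
    rw [← pow_succ]
    congr 1
    have := had.bigN_lt i
    omega
  have hvol : ∏ i, h i ≤ Θ * C * f := by
    have h1 := hHf.trans (mul_le_mul_of_nonneg_left (hL (N + 1) le_rfl) (by linarith))
    rw [hHN] at h1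
    refine le_of_mul_le_mul_left ?_ (mul_pos hH1 (pow_pos hf N))
    calc _ = (∏ i, h i ^ (bigQ m V e i - (N + 1))) * (∏ i, h i) * f ^ N := by ring
      _ ≤ _ := h1
      _ = _ := by ring
  have hQ : ∏ i, h i ^ bigQ m V e i ≤ (Θ * C) ^ N * Θ * Aα := by
    have h1 : ∏ i, h i ^ bigQ m V e i = (∏ i, h i ^ (bigQ m V e i - N)) * (∏ i, h i) ^ N := by
      rw [← Finset.prod_pow, ← Finset.prod_mul_distrib]
      refine Finset.prod_congr rfl fun i _ => ?_
      rw [← pow_add, Nat.sub_add_cancel (had.bigN_lt i).le]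
    rw [h1]
    have hHN0 : 0 ≤ ∏ i, h i ^ (bigQ m V e i - N) :=
      Finset.prod_nonneg fun i _ => pow_nonneg (hh i).le _
    calc _ ≤ (∏ i, h i ^ (bigQ m V e i - N)) * (Θ * C * f) ^ N := by gcongr
      _ = (Θ * C) ^ N * ((∏ i, h i ^ (bigQ m V e i - N)) * f ^ N) := by rw [mul_pow (Θ * C)]; ring
      _ ≤ (Θ * C) ^ N * (Θ * Aα) := by gcongr
      _ = _ := by ring
  set κ := ((Θ * C) ^ N * Θ)⁻¹ with hκ
  have hκ0 : 0 < κ := by positivity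
  have hbox := hcls κ hκ0 (by
    rw [hκ, inv_mul_le_iff₀ (by positivity)]
    exact hQ)
  set Λ := (1 + C / κ) ^ n with hΛ
  have hΛ0 : 0 < Λ := by positivity
  refine ⟨hf, c, fun i => Λ * h i, fun i => mul_pos hΛ0 (hh i), hT.trans ?_, ?_⟩
  · gcongr
    · exact ((isBounded_fibY (hb.subset hG.subset) z).subset
        Set.inter_subset_left).measure_lt_top.ne
    · intro v hv b
      refine (hbox b v hv).trans (le_of_eq ?_)
      rw [hΛ]; ring
  · rw [Finset.prod_mul_distrib, Finset.prod_const, Finset.card_univ, Fintype.card_fin]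
    have hΛle : Λ ≤ (2 * C ^ (N + 1) * Θ ^ (N + 1)) ^ n := by
      rw [hΛ]
      gcongr
      rw [hκ, div_inv_eq_mul]
      have h1 : C * ((Θ * C) ^ N * Θ) = C ^ (N + 1) * Θ ^ (N + 1) := by rw [mul_pow]; ring
      rw [h1]
      have h3 : 1 ≤ C ^ (N + 1) := one_le_pow₀ hC
      have h4 : 1 ≤ Θ ^ (N + 1) := one_le_pow₀ hΘ1
      nlinarith
    calc Λ ^ n * ∏ i, h i ≤ ((2 * C ^ (N + 1) * Θ ^ (N + 1)) ^ n) ^ n * (Θ * C * f) := by gcongr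
      _ = _ := by
        rw [hΘ]
        simp only [mul_pow, ← pow_mul, pow_add, mul_add, add_mul, mul_one, one_mul]
        ring

end

section

variable {n M m : ℕ} {V : Fin M → Finset (Fin n)} {rk : Fin n → ℕ}

theorem measurable_volume_fibY {A : Set (Heis n)} (hA : MeasurableSet A) :
    Measurable fun z => volume (fibY A z) := by
  have := measurable_volume_sliceY univ hA
  simpa only [volume_sliceY_of_eq_univ rfl hA] using this

theorem volume_fibY_expY (A : Set (Heis n)) (u : Vec n) (z : Heis n) :
    volume (fibY A (expY u z)) = volume (fibY A z) := by
  have : fibY A (expY u z) = (fun v => u + v) ⁻¹' fibY A z := by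
    ext v
    simp only [fibY, Set.mem_ofPred_eq, Set.mem_preimage, expY_expY]
  rw [this, measure_preimage_add]

theorem continuous_triForm_classCoeff (i : Fin n) :
    Continuous fun p : (Fin n → Fin n → ℝ) × Vec n =>
      triForm rk (classCoeff m V p.1 i) i p.2 := by
  unfold triForm
  refine Continuous.sub (by fun_prop)
    (continuous_finsetSum _ fun j _ => Continuous.mul ?_ (by fun_prop))
  unfold classCoeff
  split_ifs <;> fun_prop

/-- A box can be replaced by one from a dense sequence of boxes. -/
theorem exists_denseSeq_box {d : ℕ → Vec n × (Fin n → Fin n → ℝ) × Vec n} (hd : DenseRange d)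
    (y : Vec n) (c : Fin n → Fin n → ℝ) {H : Fin n → ℝ} (hH : ∀ i, 0 < H i) (R : ℝ) :
    ∃ k, (∀ i, 0 < (d k).2.2 i) ∧ (∀ i, (d k).2.2 i ≤ 2 * H i) ∧
      ∀ v : Vec n, ‖v‖ ≤ R → v ∈ triBox rk (classCoeff m V c) H →
        y + v - (d k).1 ∈ triBox rk (classCoeff m V (d k).2.1) (d k).2.2 := by
  let π₀ : Vec n × (Fin n → Fin n → ℝ) × Vec n := (y, c, fun i => 3 / 2 * H i)
  have hK : IsCompact (Metric.closedBall (0 : Vec n) R ∩ triBox rk (classCoeff m V c) H) :=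
    (isCompact_closedBall _ _).inter_right (isClosed_triBox _ _ _)
  have h1 : ∀ᶠ π in 𝓝 π₀, ∀ v ∈ Metric.closedBall (0 : Vec n) R ∩ triBox rk (classCoeff m V c) H,
      ∀ i, |triForm rk (classCoeff m V π.2.1 i) i (y + v - π.1)| < 4 * π.2.2 i := by
    refine hK.eventually_forall_of_forall_eventually fun v hv => ?_
    refine Filter.eventually_all.2 fun i => ?_
    have hcont : Continuous fun p : (Vec n × (Fin n → Fin n → ℝ) × Vec n) × Vec n =>
        |triForm rk (classCoeff m V p.1.2.1 i) i (y + p.2 - p.1.1)| :=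
      ((continuous_triForm_classCoeff i).comp
        (f := fun p : (Vec n × (Fin n → Fin n → ℝ) × Vec n) × Vec n =>
          (p.1.2.1, y + p.2 - p.1.1)) (by fun_prop)).abs
    have hcont2 : Continuous fun p : (Vec n × (Fin n → Fin n → ℝ) × Vec n) × Vec n =>
        4 * p.1.2.2 i := by fun_prop
    refine (isOpen_lt hcont hcont2).mem_nhds ?_
    change |triForm rk (classCoeff m V c i) i (y + v - y)| < 4 * (3 / 2 * H i)
    rw [add_sub_cancel_left]
    have := hv.2 i
    have := hH i
    linarith
  have h2 : ∀ᶠ π : Vec n × (Fin n → Fin n → ℝ) × Vec n in 𝓝 π₀,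
      ∀ i, 0 < π.2.2 i ∧ π.2.2 i < 2 * H i := by
    refine Filter.eventually_all.2 fun i => ?_
    have hcont : Continuous fun p : Vec n × (Fin n → Fin n → ℝ) × Vec n => p.2.2 i := by fun_prop
    have h3 := hH i
    exact ((isOpen_lt continuous_const hcont).inter (isOpen_lt hcont continuous_const)).mem_nhds
      ⟨by change 0 < 3 / 2 * H i; linarith, by change 3 / 2 * H i < 2 * H i; linarith⟩
  obtain ⟨U, hU, hUo, hπU⟩ := eventually_nhds_iff.1 (h1.and h2)
  obtain ⟨k, hk⟩ := hd.exists_mem_open hUo ⟨π₀, hπU⟩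
  obtain ⟨h3, h4⟩ := hU _ hk
  exact ⟨k, fun i => (h4 i).1, fun i => (h4 i).2.le, fun v hv hvb i =>
    (h3 v ⟨by simpa using hv, hvb⟩ i).le⟩

/-- If the fibers through the points of `G` are concentrated on boxes, then there is a large subset
each of whose fibers is contained in a box. -/
theorem exists_subset_fibers_in_boxes {A G : Set (Heis n)} (hA : MeasurableSet A)
    (hb : Bornology.IsBounded A) (hG : MeasurableSet G) (hGA : G ⊆ A) {K : ℝ} (hK : 0 ≤ K)
    (hconc : ∀ z ∈ G, ∃ (c : Fin n → Fin n → ℝ) (H : Fin n → ℝ), (∀ i, 0 < H i) ∧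
        volume.real (fibY A z) ≤
          2 * volume.real (fibY A z ∩ triBox rk (classCoeff m V c) H) ∧
        ∏ i, H i ≤ K * volume.real (fibY A z)) :
    ∃ P ⊆ A, MeasurableSet P ∧ volume.real G ≤ 2 * volume.real P ∧ ∀ z ∈ P,
      volume.real (fibY A z) ≤ 2 * volume.real (fibY P z) ∧
      ∃ (c : Fin n → Fin n → ℝ) (H : Fin n → ℝ) (y : Vec n), (∀ i, 0 < H i) ∧
        ∏ i, H i ≤ 2 ^ n * K * volume.real (fibY A z) ∧
        ∀ u ∈ fibY P z, z.2.1 + u - y ∈ triBox rk (classCoeff m V c) H := by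
  let d := TopologicalSpace.denseSeq (Vec n × (Fin n → Fin n → ℝ) × Vec n)
  have hd : DenseRange d := TopologicalSpace.denseRange_denseSeq _
  have hFfin : ∀ z, volume (fibY A z) ≠ ∞ := fun z => (isBounded_fibY hb z).measure_lt_top.ne
  let Ak : ℕ → Set (Heis n) := fun k =>
    A ∩ {z | z.2.1 - (d k).1 ∈ triBox rk (classCoeff m V (d k).2.1) (d k).2.2}
  have hAk : ∀ k, MeasurableSet (Ak k) := fun k => by
    have h1 : Measurable fun z : Heis n => z.2.1 - (d k).1 := by fun_prop
    exact hA.inter (h1 (isClosed_triBox _ _ _).measurableSet)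
  let Bk : ℕ → Set (Heis n) := fun k => {z | volume (fibY A z) ≤ 2 * volume (fibY (Ak k) z) ∧
    (∀ i, 0 < (d k).2.2 i) ∧
      ENNReal.ofReal (∏ i, (d k).2.2 i) ≤ ENNReal.ofReal (2 ^ n * K) * volume (fibY A z)}
  have hBk : ∀ k, MeasurableSet (Bk k) := fun k => by
    refine (measurableSet_le (measurable_volume_fibY hA)
      ((measurable_volume_fibY (hAk k)).const_mul 2)).inter ?_
    exact (MeasurableSet.const _).inter (measurableSet_le measurable_const
      ((measurable_volume_fibY hA).const_mul _))
  have hBinv : ∀ k u z, expY u z ∈ Bk k ↔ z ∈ Bk k := fun k u z => by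
    simp only [Bk, Set.mem_ofPred_eq, volume_fibY_expY]
  let S : ℕ → Set (Heis n) := disjointed Bk
  have hS : ∀ k, MeasurableSet (S k) := fun k => MeasurableSet.disjointed hBk k
  have hSiff : ∀ k z, z ∈ S k ↔ z ∈ Bk k ∧ ∀ l < k, z ∉ Bk l := fun k z => by
    rw [show S k = Bk k ∩ ⋂ l < k, (Bk l)ᶜ from disjointed_eq_inter_compl Bk k]
    simp
  have hSinv : ∀ k u z, expY u z ∈ S k ↔ z ∈ S k := fun k u z => by
    simp only [hSiff, hBinv]
  have hSuniq : ∀ k l z, z ∈ S k → z ∈ S l → k = l := fun k l z hk hl => by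
    by_contra hne
    exact Set.disjoint_left.1 (disjoint_disjointed Bk hne) hk hl
  set P : Set (Heis n) := ⋃ k, Ak k ∩ S k with hP
  have hPm : MeasurableSet P := MeasurableSet.iUnion fun k => (hAk k).inter (hS k)
  have hPA : P ⊆ A := Set.iUnion_subset fun k => Set.inter_subset_left.trans Set.inter_subset_left
  have hfib : ∀ k, ∀ z ∈ S k, fibY P z = fibY (Ak k) z := fun k z hz => by
    ext u
    simp only [fibY, Set.mem_ofPred_eq, hP, Set.mem_iUnion]
    constructor
    · rintro ⟨l, hl, hl'⟩
      rwa [hSuniq k l z hz ((hSinv l u z).1 hl')]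
    · intro hu
      exact ⟨k, hu, (hSinv k u z).2 hz⟩
  have hSP : ∀ k, ∀ z ∈ S k, volume (fibY A z) ≤ 2 * volume (fibY P z) := fun k z hz => by
    rw [hfib k z hz]
    exact ((hSiff k z).1 hz).1.1
  have hGS : ∀ z ∈ G, ∃ k, z ∈ S k := by
    intro z hz
    obtain ⟨c, H, hH, hT, hprod⟩ := hconc z hz
    obtain ⟨R, hR⟩ := (isBounded_fibY hb z).exists_norm_le
    obtain ⟨k, hk0, hk2, hk⟩ := exists_denseSeq_box (m := m) (V := V) (rk := rk) hd z.2.1 c hH R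
    have hkB : z ∈ Bk k := by
      refine ⟨?_, hk0, ?_⟩
      · have hsub : fibY A z ∩ triBox rk (classCoeff m V c) H ⊆ fibY (Ak k) z :=
          fun v hv => ⟨hv.1, hk v (hR v hv.1) hv.2⟩
        have h1 := hT.trans (mul_le_mul_of_nonneg_left (measureReal_mono hsub
          (isBounded_fibY (hb.subset Set.inter_subset_left) z).measure_lt_top.ne) zero_le_two)
        rw [← ENNReal.toReal_le_toReal (hFfin z) (ENNReal.mul_ne_top ENNReal.ofNat_ne_top
          (isBounded_fibY (hb.subset Set.inter_subset_left) z).measure_lt_top.ne),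
          ENNReal.toReal_mul]
        exact h1
      · rw [← ENNReal.ofReal_toReal (hFfin z), ← ENNReal.ofReal_mul (by positivity)]
        refine ENNReal.ofReal_le_ofReal ?_
        calc ∏ i, (d k).2.2 i ≤ ∏ i, (2 * H i) :=
              Finset.prod_le_prod (fun i _ => (hk0 i).le) fun i _ => hk2 i
          _ = 2 ^ n * ∏ i, H i := by
              rw [Finset.prod_mul_distrib, Finset.prod_const, Finset.card_univ, Fintype.card_fin]
          _ ≤ 2 ^ n * (K * volume.real (fibY A z)) := by gcongr
          _ = _ := by rw [measureReal_def]; ring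
    classical
    have hex : ∃ k, z ∈ Bk k := ⟨k, hkB⟩
    exact ⟨Nat.find hex, (hSiff _ z).2 ⟨Nat.find_spec hex, fun l hl => Nat.find_min hex hl⟩⟩
  have hPfin : ∀ z, volume (fibY P z) ≠ ∞ := fun z =>
    (isBounded_fibY (hb.subset hPA) z).measure_lt_top.ne
  refine ⟨P, hPA, hPm, ?_, fun z hz => ?_⟩
  · have h1 : volume G ≤ 2 * volume P := by
      refine volume_le_mul_of_sliceY_le univ hPm hG 2 fun z hz => ?_
      obtain ⟨k, hk⟩ := hGS z hz
      rw [volume_sliceY_of_eq_univ rfl hPm]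
      refine le_trans ?_ (hSP k z hk)
      rw [← volume_sliceY_of_eq_univ rfl hA]
      exact measure_mono (sliceY_mono _ hGA z)
    have h2 := ENNReal.toReal_mono (ENNReal.mul_ne_top ENNReal.ofNat_ne_top
      (hb.subset hPA).measure_lt_top.ne) h1
    rwa [ENNReal.toReal_mul] at h2
  · obtain ⟨k, hkA, hkS⟩ := Set.mem_iUnion.1 hz
    obtain ⟨-, hk0, hkK⟩ := ((hSiff k z).1 hkS).1
    refine ⟨?_, (d k).2.1, (d k).2.2, (d k).1, hk0, ?_, fun u hu => ?_⟩
    · have h2 := ENNReal.toReal_mono (ENNReal.mul_ne_top ENNReal.ofNat_ne_top (hPfin z))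
        (hSP k z hkS)
      rwa [ENNReal.toReal_mul] at h2
    · have h2 := ENNReal.toReal_mono (ENNReal.mul_ne_top ENNReal.ofReal_ne_top (hFfin z)) hkK
      rwa [ENNReal.toReal_ofReal (Finset.prod_nonneg fun i _ => (hk0 i).le), ENNReal.toReal_mul,
        ENNReal.toReal_ofReal (by positivity)] at h2
    · rw [hfib k z hkS] at hu
      exact hu.2

end

section

variable {n M m : ℕ} {V : Fin M → Finset (Fin n)} {e : Fin M → ℕ} {q : ℕ} {rk : Fin n → ℕ}
  {o : ℕ → Fin n}

/-- All fibers of `R` along the maps `projX` are large compared with the average fibers of `Ω`. -/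
def IsRegularX (c : ℝ) (Ω R : Set (Heis n)) : Prop :=
  ∀ k : Finset (Fin n), ∀ z ∈ R, c * (volume.real Ω / volume.real (projX kᶜ '' Ω)) ≤
    volume.real (sliceX k R z)

/-- All fibers of `R` along the maps `projY` are large compared with the average fibers of `Ω`. -/
def IsRegularY (c : ℝ) (Ω R : Set (Heis n)) : Prop :=
  ∀ k : Finset (Fin n), ∀ z ∈ R, c * (volume.real Ω / volume.real (projY kᶜ '' Ω)) ≤
    volume.real (sliceY k R z)

theorem IsRegularX.mono {c c' : ℝ} {Ω R : Set (Heis n)} (h : IsRegularX c Ω R) (hc : c' ≤ c) :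
    IsRegularX c' Ω R := fun k z hz =>
  (mul_le_mul_of_nonneg_right hc (div_nonneg measureReal_nonneg measureReal_nonneg)).trans (h k z hz)

theorem IsRegularY.mono {c c' : ℝ} {Ω R : Set (Heis n)} (h : IsRegularY c Ω R) (hc : c' ≤ c) :
    IsRegularY c' Ω R := fun k z hz =>
  (mul_le_mul_of_nonneg_right hc (div_nonneg measureReal_nonneg measureReal_nonneg)).trans (h k z hz)

theorem le_div_coordProj {F : Set (Vec n)} (hF : MeasurableSet F) (hb : Bornology.IsBounded F)
    (h0 : 0 < volume.real F) (s : Finset (Fin n)) {τ : ℝ}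
    (h : ∀ x ∈ F, τ ≤ volume.real {u : (sᶜ : Finset (Fin n)) → ℝ | x + coordIncl sᶜ u ∈ F}) :
    τ ≤ volume.real F / volume.real (coordProj s '' F) := by
  have hFfin : volume F ≠ ∞ := hb.measure_lt_top.ne
  have hP0 : 0 < volume.real (coordProj s '' F) := by
    refine ENNReal.toReal_pos (fun hP => ?_) (isBounded_image_coordProj s hb).measure_lt_top.ne
    have h1 := volume_le_mul_coordProj (s := s) (k := sᶜ) (compl_compl s).symm hF (τ := ∞)
      fun _ _ => le_top
    rw [hP, mul_zero] at h1
    rw [measureReal_def, le_antisymm h1 zero_le] at h0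
    exact lt_irrefl _ h0
  rw [le_div_iff₀ hP0]
  by_cases hτ : τ < 0
  · exact (mul_nonpos_of_nonpos_of_nonneg hτ.le hP0.le).trans h0.le
  have h1 := mul_volume_coordProj_le (s := s) (k := sᶜ) (compl_compl s).symm hF
    (τ := ENNReal.ofReal τ) fun x hx => ENNReal.ofReal_le_of_le_toReal (h x hx)
  have h2 := ENNReal.toReal_mono hFfin h1
  rwa [ENNReal.toReal_mul, ENNReal.toReal_ofReal (not_lt.1 hτ)] at h2

theorem IsRegularX.le_div {c : ℝ} (hc : 0 < c) {Ω R : Set (Heis n)} (h : IsRegularX c Ω R)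
    (hb : Bornology.IsBounded Ω) (hm : NullMeasurableSet Ω (volume : Measure (Heis n)))
    (h0 : 0 < volume Ω) (hR : MeasurableSet R) (hRΩ : R ⊆ Ω) {z : Heis n} (hz : z ∈ R)
    (s : Finset (Fin n)) : c * (volume.real Ω / volume.real (projX s '' Ω)) ≤
      volume.real (fibX R z) / volume.real (coordProj s '' fibX R z) := by
  have hw := measureReal_pos_of hb h0
  refine le_div_coordProj (measurableSet_fibX hR z) (isBounded_fibX (hb.subset hRΩ) z) ?_ s
    fun x hx => ?_
  · have h1 := h univ z hz
    rw [measureReal_def volume (sliceX univ R z), volume_sliceX_of_eq_univ rfl hR] at h1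
    have h2 := measureReal_projX_pos hb hm h0 (univ : Finset (Fin n))ᶜ
    exact (by positivity : (0 : ℝ) < _).trans_le h1
  · rw [setOf_add_mem_fibX]
    have h1 := h sᶜ _ hx
    rwa [compl_compl] at h1

theorem IsRegularY.le_div {c : ℝ} (hc : 0 < c) {Ω R : Set (Heis n)} (h : IsRegularY c Ω R)
    (hb : Bornology.IsBounded Ω) (hm : NullMeasurableSet Ω (volume : Measure (Heis n)))
    (h0 : 0 < volume Ω) (hR : MeasurableSet R) (hRΩ : R ⊆ Ω) {z : Heis n} (hz : z ∈ R)
    (s : Finset (Fin n)) : c * (volume.real Ω / volume.real (projY s '' Ω)) ≤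
      volume.real (fibY R z) / volume.real (coordProj s '' fibY R z) := by
  have hw := measureReal_pos_of hb h0
  refine le_div_coordProj (measurableSet_fibY hR z) (isBounded_fibY (hb.subset hRΩ) z) ?_ s
    fun x hx => ?_
  · have h1 := h univ z hz
    rw [measureReal_def volume (sliceY univ R z), volume_sliceY_of_eq_univ rfl hR] at h1
    have h2 := measureReal_projY_pos hb hm h0 (univ : Finset (Fin n))ᶜ
    exact (by positivity : (0 : ℝ) < _).trans_le h1
  · rw [setOf_add_mem_fibY]
    have h1 := h sᶜ _ hx
    rwa [compl_compl] at h1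

theorem compFlow_mem {Ωs : ℕ → Set (Heis n)} {z : Heis n} {l : ℕ} {s : Fin (l + 1) → Vec n}
    (hs : s ∈ flowSet Ωs z (l + 1)) : compFlow z (l + 1) s ∈ Ωs (l + 1) := by
  obtain ⟨-, h⟩ := hs
  rw [compFlow]
  split_ifs with hl
  · rw [if_pos hl] at h; exact h
  · rw [if_neg hl] at h; exact h

theorem flowFiber_eq {Ωs : ℕ → Set (Heis n)} {z : Heis n} {l : ℕ} {s : Fin l → Vec n}
    (hs : s ∈ flowSet Ωs z l) : flowFiber Ωs z l s =
      if Even l then fibX (Ωs (l + 1)) (compFlow z l s)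
        else fibY (Ωs (l + 1)) (compFlow z l s) := by
  ext u
  simp only [flowFiber, flowSet, Set.mem_ofPred_eq, Fin.init_snoc, Fin.snoc_last, hs, true_and]

/-- A chain of sets that are alternately regular in the two groups of variables gives a refined flow
scheme. -/
theorem isRefinedFlowScheme_of_regular {Ω : Set (Heis n)} (hb : Bornology.IsBounded Ω)
    (hm : NullMeasurableSet Ω (volume : Measure (Heis n))) (h0 : 0 < volume Ω) {A : ℕ} {c : ℝ}
    (hc : 0 < c) {Ωs : ℕ → Set (Heis n)} {z : Heis n} (hz : z ∈ Ωs 1)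
    (hmeas : ∀ l, 1 ≤ l → l ≤ A → MeasurableSet (Ωs l))
    (hchain : ∀ l, 1 ≤ l → l < A → Ωs l ⊆ Ωs (l + 1)) (hsub : ∀ l, 1 ≤ l → l ≤ A → Ωs l ⊆ Ω)
    (hlarge : ∀ l, 1 ≤ l → l ≤ A → c * volume.real Ω ≤ volume.real (Ωs l))
    (hX : ∀ l, 1 ≤ l → l ≤ A → Odd l → IsRegularX c Ω (Ωs l))
    (hY : ∀ l, 1 ≤ l → l ≤ A → Even l → IsRegularY c Ω (Ωs l)) :
    IsRefinedFlowScheme m V e Ω A c Ωs z := by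
  have hmem : ∀ l < A, ∀ s ∈ flowSet Ωs z l, compFlow z l s ∈ Ωs (l + 1) := by
    intro l hl s hs
    cases l with
    | zero => exact hz
    | succ l => exact hchain (l + 1) (by omega) hl (compFlow_mem hs)
  refine ⟨hmeas, hchain, hsub, hlarge, fun l hl hle s hs j hj => ?_, fun l hl hlo s hs j hj => ?_,
    fun l h1 hl hlo w hw j _ => hX l h1 hl hlo _ w hw,
    fun l h1 hl hlo w hw j _ => hY l h1 hl hlo _ w hw⟩
  · rw [flowFiber_eq hs, if_pos hle, alpha_idxX hj]
    exact (hX (l + 1) (by omega) hl hle.add_one).le_div hc hb hm h0 (hmeas _ (by omega) hl)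
      (hsub _ (by omega) hl) (hmem l hl s hs) _
  · rw [flowFiber_eq hs, if_neg (Nat.not_even_iff_odd.2 hlo), alpha_idxY hj]
    exact (hY (l + 1) (by omega) hl hlo.add_one).le_div hc hb hm h0 (hmeas _ (by omega) hl)
      (hsub _ (by omega) hl) (hmem l hl s hs) _

/-- The outer part of the chain. -/
theorem exists_regular_chain {Ω : Set (Heis n)} (hb : Bornology.IsBounded Ω)
    (hm : NullMeasurableSet Ω (volume : Measure (Heis n))) {A : ℕ} {δ : ℝ}
    (hδ : 0 ≤ δ) :
    ∃ Ωs : ℕ → Set (Heis n), (∀ l ≤ A, MeasurableSet (Ωs l)) ∧ (∀ l < A, Ωs l ⊆ Ωs (l + 1)) ∧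
      (∀ l ≤ A, Ωs l ⊆ Ω) ∧
      (∀ l ≤ A, volume.real Ω ≤
        volume.real (Ωs l) + (A + 1 - l : ℕ) * ((2 ^ n + 1) * (δ * volume.real Ω))) ∧
      (∀ l ≤ A, Odd l → IsRegularX δ Ω (Ωs l)) ∧ ∀ l ≤ A, Even l → IsRegularY δ Ω (Ωs l) := by
  obtain ⟨t, ht, htm, hte⟩ := exists_measurable_core hm
  have hte' : volume.real t = volume.real Ω := by rw [measureReal_def, hte, measureReal_def]
  have hstep : ∀ (l : ℕ) (S : {S : Set (Heis n) // MeasurableSet S ∧ S ⊆ Ω}),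
      ∃ R : {S : Set (Heis n) // MeasurableSet S ∧ S ⊆ Ω}, (R : Set (Heis n)) ⊆ S ∧
        volume.real (S : Set (Heis n)) ≤
          volume.real (R : Set (Heis n)) + (2 ^ n + 1) * (δ * volume.real Ω) ∧
        (Odd l → IsRegularX δ Ω R) ∧ (Even l → IsRegularY δ Ω R) := by
    rintro l ⟨S, hSm, hSΩ⟩
    rcases Nat.even_or_odd l with hl | hl
    · obtain ⟨B, hBS, hBm, hB, -, hvol⟩ := exists_refineY hSm hSΩ hb hm hδ
      exact ⟨⟨B, hBm, hBS.trans hSΩ⟩, hBS, hvol,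
        fun h => absurd hl (Nat.not_even_iff_odd.2 h), fun _ => hB⟩
    · obtain ⟨B, hBS, hBm, hB, -, hvol⟩ := exists_refineX hSm hSΩ hb hδ
      exact ⟨⟨B, hBm, hBS.trans hSΩ⟩, hBS, hvol, fun _ => hB,
        fun h => absurd h (Nat.not_even_iff_odd.2 hl)⟩
  choose f hf1 hf2 hf3 hf4 using hstep
  let T : ℕ → {S : Set (Heis n) // MeasurableSet S ∧ S ⊆ Ω} := fun i =>
    Nat.rec ⟨t, htm, ht⟩ (fun i S => f (A - i) S) i
  have hT : ∀ i, T (i + 1) = f (A - i) (T i) := fun i => rfl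
  have hTvol : ∀ i : ℕ, volume.real Ω ≤
      volume.real (T i).1 + i * ((2 ^ n + 1) * (δ * volume.real Ω)) := by
    intro i
    induction i with
    | zero => simp [T, hte']
    | succ i ih =>
      have := hf2 (A - i) (T i)
      rw [hT]
      push_cast
      linarith
  have hTl : ∀ l ≤ A, T (A + 1 - l) = f l (T (A - l)) := fun l hl => by
    rw [show A + 1 - l = (A - l) + 1 by omega, hT, show A - (A - l) = l by omega]
  refine ⟨fun l => (T (A + 1 - l)).1, fun l _ => (T _).2.1, fun l hl => ?_, fun l _ => (T _).2.2,
    fun l hl => hTvol _, fun l hl hlo => ?_, fun l hl hle => ?_⟩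
  · beta_reduce
    rw [hTl l hl.le, show A + 1 - (l + 1) = A - l by omega]
    exact hf1 l _
  · beta_reduce
    rw [hTl l hl]; exact hf3 l _ hlo
  · beta_reduce
    rw [hTl l hl]; exact hf4 l _ hle

end

section

variable {n M m : ℕ} {V : Fin M → Finset (Fin n)} {e : Fin M → ℕ} {q : ℕ}

/-- Refined flow schemes of quasiextremal sets with first fibers in adapted ellipsoids. -/
theorem exists_refinedFlowScheme (had : IsAdmissible m V e q) {p : Fin M → ℚ}
    (hpq : ∀ j, (p j)⁻¹ = (e j : ℚ) / q) :
    ∃ (D : ℕ) (K : ℝ), 1 ≤ K ∧ ∀ A : ℕ, 3 ≤ A → ∃ c : ℝ, 0 < c ∧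
      ∀ (σ ε : ℝ) (Ω : Set (Heis n)), 0 < σ → σ < 1 → 0 < ε → ε ≤ σ →
        IsSemiregular (bigQ m V e) σ Ω → IsQuasiextremal m V p ε Ω →
        ∃ (Ωs : ℕ → Set (Heis n)) (z₀ : Heis n), IsRefinedFlowScheme m V e Ω A c Ωs z₀ ∧
          ∀ s ∈ flowSet Ωs z₀ 1, ∃ E : Set (Vec n),
            IsAdaptedEllipsoid (fun j : {j // j ∈ idxY M m} => V j) E ∧
            flowFiber Ωs z₀ 1 s ⊆ E ∧
            volume.real E ≤ K * ε⁻¹ ^ D * volume.real (flowFiber Ωs z₀ 1 s) := by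
  obtain ⟨rk, o, hr⟩ := had.exists_ranking
  obtain ⟨D, K, hK, hconc⟩ := exists_adapted_concentration had hr hpq
  have hn1 : (1 : ℝ) ≤ n := by exact_mod_cast had.dim_pos
  have hK0 : 0 < K := by linarith
  set δ : ℝ := 1 / (16 * (2 ^ n + 1)) with hδ
  have hδ0 : 0 < δ := by positivity
  have hδ1 : 1 ≤ 1 / δ := by
    rw [hδ, one_div_one_div]
    have : (0 : ℝ) < 2 ^ n := by positivity
    linarith
  refine ⟨D, (16 * n) ^ n * (2 ^ n * K * 2 * (1 / δ)), ?_, fun A hA => ?_⟩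
  · have h1 : (1 : ℝ) ≤ (16 * n) ^ n := one_le_pow₀ (by linarith)
    have h2 : (1 : ℝ) ≤ 2 ^ n := one_le_pow₀ one_le_two
    have h3 : 1 ≤ 2 ^ n * K := by nlinarith
    have h4 : 1 ≤ 2 ^ n * K * 2 * (1 / δ) := by nlinarith
    nlinarith
  set δA : ℝ := 1 / (4 * (A + 1) * (2 ^ n + 1)) with hδA
  have hδA0 : 0 < δA := by positivity
  set c : ℝ := 1 / (16 * (A + 1) * (2 ^ n + 1)) with hc
  have hc0 : 0 < c := by positivity
  have hA0 : (0 : ℝ) ≤ A := Nat.cast_nonneg A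
  have h2n : (0 : ℝ) < 2 ^ n := by positivity
  have hcδ : c ≤ δ := by
    rw [hc, hδ]
    refine one_div_le_one_div_of_le (by positivity) ?_
    nlinarith
  have hcδA : c ≤ δA := by
    rw [hc, hδA]
    refine one_div_le_one_div_of_le (by positivity) ?_
    nlinarith
  have hc16 : c ≤ 1 / 16 := by
    rw [hc]
    refine one_div_le_one_div_of_le (by positivity) ?_
    nlinarith
  refine ⟨c, hc0, fun σ ε Ω hσ hσ1 hε hεσ hΩ hΩε => ?_⟩
  have hb := hΩ.bounded
  have hm := hΩ.measurable
  have h0 := hΩ.pos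
  have hw := measureReal_pos_of hb h0
  obtain ⟨T, hTm, hTchain, hTΩ, hTvol, hTX, hTY⟩ :=
    exists_regular_chain hb hm (A := A) (δ := δA) hδA0.le
  have hTvol' : ∀ l ≤ A, 3 / 4 * volume.real Ω ≤ volume.real (T l) := by
    intro l hl
    have h1 := hTvol l hl
    have h2 : ((A + 1 - l : ℕ) : ℝ) * ((2 ^ n + 1) * (δA * volume.real Ω)) ≤
        1 / 4 * volume.real Ω := by
      have h3 : ((A + 1 - l : ℕ) : ℝ) ≤ A + 1 := by exact_mod_cast Nat.sub_le _ _
      calc _ ≤ (A + 1 : ℝ) * ((2 ^ n + 1) * (δA * volume.real Ω)) := by gcongr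
        _ = _ := by rw [hδA]; field_simp
    linarith
  have hloss : (2 ^ n + 1) * (δ * volume.real Ω) = 1 / 16 * volume.real Ω := by
    rw [hδ]; field_simp
  obtain ⟨S, G, hST, hSG, hSvol⟩ := exists_isGoodPair hr hb hm (hTm 3 hA) (hTΩ 3 hA) h0
    (by have := hTvol' 3 hA; linarith)
  have hSb : Bornology.IsBounded S := hb.subset hSG.subset
  obtain ⟨P, hPS, hPm, hPvol, hP⟩ := exists_subset_fibers_in_boxes (m := m) (V := V) (rk := rk)
    hSG.measurable hSb hSG.measurable' hSG.subset' (K := K * ε⁻¹ ^ D) (by positivity)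
    fun z hz => (hconc σ ε Ω S G hσ hσ1 hε hεσ hΩ hΩε hSG z hz).2
  have hPΩ : P ⊆ Ω := hPS.trans hSG.subset
  obtain ⟨Ω₂, h2P, h2m, h2reg, h2fib, h2vol⟩ := exists_refineY hPm hPΩ hb hm hδ0.le
  have h2Ω : Ω₂ ⊆ Ω := h2P.trans hPΩ
  obtain ⟨Ω₁, h12, h1m, h1reg, -, h1vol⟩ := exists_refineX h2m h2Ω hb hδ0.le
  rw [hloss] at h1vol h2vol
  have hT3 := hTvol' 3 hA
  have h1large : 1 / 16 * volume.real Ω ≤ volume.real Ω₁ := by linarith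
  have h2large : 1 / 16 * volume.real Ω ≤ volume.real Ω₂ := by linarith
  obtain ⟨z₀, hz₀⟩ : Ω₁.Nonempty := by
    by_contra hne
    rw [Set.not_nonempty_iff_eq_empty] at hne
    rw [hne, measureReal_empty] at h1large
    linarith
  let Ωs : ℕ → Set (Heis n) := fun l => if l = 1 then Ω₁ else if l = 2 then Ω₂ else T l
  have hΩs1 : Ωs 1 = Ω₁ := if_pos rfl
  have hΩs2 : Ωs 2 = Ω₂ := by simp [Ωs]
  have hΩs3 : ∀ l, 3 ≤ l → Ωs l = T l := fun l hl => by
    have h1 : l ≠ 1 := by omega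
    have h2 : l ≠ 2 := by omega
    simp [Ωs, h1, h2]
  have hcases : ∀ l, 1 ≤ l → l = 1 ∨ l = 2 ∨ 3 ≤ l := fun l hl => by omega
  refine ⟨Ωs, z₀, ?_, fun s hs => ?_⟩
  · refine isRefinedFlowScheme_of_regular hb hm h0 hc0 (hΩs1 ▸ hz₀) ?_ ?_ ?_ ?_ ?_ ?_
    · intro l hl hlA
      rcases hcases l hl with rfl | rfl | h3
      · rwa [hΩs1]
      · rwa [hΩs2]
      · rw [hΩs3 l h3]; exact hTm l hlA
    · intro l hl hlA
      rcases hcases l hl with rfl | rfl | h3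
      · rwa [hΩs1, hΩs2]
      · rw [hΩs2, hΩs3 3 le_rfl]; exact h2P.trans (hPS.trans hST)
      · rw [hΩs3 l h3, hΩs3 (l + 1) (by omega)]; exact hTchain l hlA
    · intro l hl hlA
      rcases hcases l hl with rfl | rfl | h3
      · rw [hΩs1]; exact h12.trans h2Ω
      · rwa [hΩs2]
      · rw [hΩs3 l h3]; exact hTΩ l hlA
    · intro l hl hlA
      have hcw : c * volume.real Ω ≤ 1 / 16 * volume.real Ω := by gcongr
      rcases hcases l hl with rfl | rfl | h3
      · rw [hΩs1]; exact hcw.trans h1large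
      · rw [hΩs2]; exact hcw.trans h2large
      · rw [hΩs3 l h3]
        have := hTvol' l hlA
        linarith
    · intro l hl hlA hlo
      rcases hcases l hl with rfl | rfl | h3
      · rw [hΩs1]; exact IsRegularX.mono h1reg hcδ
      · exact absurd hlo (by decide)
      · rw [hΩs3 l h3]; exact (hTX l hlA hlo).mono hcδA
    · intro l hl hlA hle
      rcases hcases l hl with rfl | rfl | h3
      · exact absurd hle (by decide)
      · rw [hΩs2]; exact IsRegularY.mono h2reg hcδ
      · rw [hΩs3 l h3]; exact (hTY l hlA hle).mono hcδA
  · have hmem : compFlow z₀ 1 s ∈ Ω₂ := by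
      have : compFlow z₀ 1 s ∈ Ωs 1 := compFlow_mem (l := 0) hs
      rw [hΩs1] at this
      exact h12 this
    have hfib : flowFiber Ωs z₀ 1 s = fibY Ω₂ (compFlow z₀ 1 s) := by
      rw [flowFiber_eq hs, if_neg (by decide), hΩs2]
    rw [hfib]
    set w := compFlow z₀ 1 s
    obtain ⟨hSP, c', H, y, hH, hprod, hbox⟩ := hP w (h2P hmem)
    obtain ⟨E, hE, hsub, hvol⟩ := exists_isAdaptedEllipsoid had.dim_pos
      (fun j : {j // j ∈ idxY M m} => V j) (classY m V) (fun i j => mem_classY i j) (rk := rk)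
      (c := classCoeff m V c') (fun i k hik => by simp [classCoeff, hik]) (H := fun i => 4 * H i)
      (fun i => by have := hH i; positivity)
    refine ⟨E, hE, fun u hu => ?_, ?_⟩
    · have h1 := hbox u (h2P hu)
      have h2 := hbox 0 (by
        change expY 0 w ∈ P
        rw [expY_zero]; exact h2P hmem)
      have h3 := hsub _ _ h1 h2
      have h4 : w.2.1 + u - y - (w.2.1 + 0 - y) = u := by rw [add_zero]; abel
      rwa [h4] at h3
    · refine hvol.trans ?_
      have h1 : ∏ i, (4 * (n : ℝ) * (4 * H i)) = (16 * n) ^ n * ∏ i, H i := by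
        rw [show (fun i => 4 * (n : ℝ) * (4 * H i)) = fun i => (16 * n) * H i by
          funext i; ring, Finset.prod_mul_distrib, Finset.prod_const, Finset.card_univ,
          Fintype.card_fin]
      rw [h1, mul_assoc, mul_assoc]
      refine mul_le_mul_of_nonneg_left (hprod.trans ?_) (by positivity)
      have h2 : volume.real (fibY P w) ≤ 1 / δ * volume.real (fibY Ω₂ w) := by
        rw [one_div, ← div_eq_inv_mul, le_div_iff₀ hδ0, mul_comm]
        exact h2fib w hmem
      calc 2 ^ n * (K * ε⁻¹ ^ D) * volume.real (fibY S w)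
          ≤ 2 ^ n * (K * ε⁻¹ ^ D) * (2 * (1 / δ * volume.real (fibY Ω₂ w))) := by gcongr; linarith
        _ = _ := by ring

end

end HeisFinner

end

theorem proposition11p1 (n m M : ℕ) (hn : 0 < n) (hm : 0 < m) (hmM : m < M)
    (V : Fin M → Finset (Fin n)) (p : Fin M → ℚ) (hp : ∀ j, 1 ≤ p j)
    (q : ℕ) (e : Fin M → ℕ) (hq : 0 < q) (he : ∀ j, 0 < e j)
    (hpq : ∀ j, (p j)⁻¹ = (e j : ℚ) / q) (hgcd : Nat.gcd (Finset.univ.gcd e) q = 1)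
    (hA : (n : ℚ) + 1 =
      ∑ j ∈ idxX M m, ((#(V j) : ℚ) + 1) / p j + ∑ j ∈ idxY M m, ((n : ℚ) + 1) / p j)
    (hB : ∀ W : Finset (Fin n), W ≠ Finset.univ → (#W : ℚ) + 1 <
      ∑ j ∈ idxX M m, ((#(V j ∩ W) : ℚ) + 1) / p j +
        ∑ j ∈ idxY M m, ((#W : ℚ) + 1) / p j)
    (hC : ∀ W : Finset (Fin n),
      ∑ j ∈ idxX M m, (#((V j)ᶜ ∩ W) : ℚ) / p j =
        ∑ j ∈ idxY M m, (#((V j)ᶜ ∩ W) : ℚ) / p j) :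
    ∃ C K : ℝ, 0 < C ∧ 0 < K ∧
      (∀ (σ : ℝ) (Ω : Set (Heis n)), 0 < σ → σ < 1 →
        IsSemiregular (bigQ m V e) σ Ω →
          K⁻¹ * σ ^ C *
              ((∏ j ∈ Finset.range (numLevels (bigQ m V e)),
                  beta (bigQ m V e) Ω j ^
                    auxExp (bigQ m V e) j) *
                ∏ j ∈ idxY M m, alpha m V Ω j ^ e j)
            ≤ volume.real Ω ^ bigN e q ∧
          K⁻¹ * σ ^ C * ∏ j, alpha m V Ω j ^ e j
            ≤ (∏ j ∈ Finset.range (numLevels (bigQ m V e)),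
                  beta (bigQ m V e) Ω j ^
                    auxExp (bigQ m V e) j) *
                ∏ j ∈ idxY M m, alpha m V Ω j ^ e j ∧
          volume.real Ω
            ≤ K * σ ^ (-C) * ∏ j, piSize m V j Ω ^ (1 / (p j : ℝ))) ∧
      (∀ A : ℕ, 3 ≤ A → ∃ c : ℝ, 0 < c ∧
        ∀ (σ ε : ℝ) (Ω : Set (Heis n)), 0 < σ → σ < 1 → 0 < ε → ε ≤ σ →
          IsSemiregular (bigQ m V e) σ Ω →
          IsQuasiextremal m V p ε Ω →
          ∃ (Ωs : ℕ → Set (Heis n)) (z₀ : Heis n),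
            IsRefinedFlowScheme m V e Ω A c Ωs z₀ ∧
            ∀ s ∈ flowSet Ωs z₀ 1,
              ∃ E : Set (Vec n),
                IsAdaptedEllipsoid
                  (fun j : {j // j ∈ idxY M m} => V j) E ∧
                flowFiber Ωs z₀ 1 s ⊆ E ∧
                volume.real E ≤ K * ε ^ (-C) * volume.real (flowFiber Ωs z₀ 1 s)) := by
  have had := isAdmissible hn hq he hpq hA hB hC
  obtain ⟨D₁, K₁, hD₁, hK₁, hbounds⟩ := exists_semiregular_bounds had hpq
  obtain ⟨D₂, K₂, hK₂, hflow⟩ := exists_refinedFlowScheme had hpq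
  have hK0 : 0 < K₁ + K₂ := by linarith
  have hinv : ∀ x : ℝ, 0 < x → x ^ (-((D₁ + D₂ : ℕ) : ℝ)) = x⁻¹ ^ (D₁ + D₂) := fun x hx => by
    rw [Real.rpow_neg hx.le, Real.rpow_natCast, inv_pow]
  have hmono : ∀ (x y : ℝ) (d : ℕ) (K' : ℝ), 0 < x → x < 1 → 0 ≤ y → d ≤ D₁ + D₂ → 0 ≤ K' →
      K' ≤ K₁ + K₂ → K' * x⁻¹ ^ d * y ≤ (K₁ + K₂) * x⁻¹ ^ (D₁ + D₂) * y := by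
    intro x y d K' hx hx1 hy hd hK' hKle
    have h1 : 1 ≤ x⁻¹ := (one_le_inv₀ hx).2 hx1.le
    gcongr
  refine ⟨((D₁ + D₂ : ℕ) : ℝ), K₁ + K₂, by positivity, hK0, fun σ Ω hσ hσ1 hΩ => ?_,
    fun A hA3 => ?_⟩
  · obtain ⟨h1, h2, h3⟩ := hbounds σ Ω hσ hσ1 hΩ
    have hb := hΩ.bounded
    have hmeas := hΩ.measurable
    have h0 := hΩ.pos
    refine ⟨inv_mul_rpow_mul_le hK0 hσ (h1.trans ?_), inv_mul_rpow_mul_le hK0 hσ (h2.trans ?_), ?_⟩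
    · exact hmono σ _ D₁ K₁ hσ hσ1 (pow_nonneg measureReal_nonneg _) (by omega) (by linarith)
        (by linarith)
    · exact hmono σ _ D₁ K₁ hσ hσ1
        (mul_nonneg (Finset.prod_nonneg fun j _ => pow_nonneg (beta_pos hb hmeas h0 _ j).le _)
          (Finset.prod_nonneg fun j _ => pow_nonneg (alpha_pos hb hmeas h0 j).le _))
        (by omega) (by linarith) (by linarith)
    · rw [hinv σ hσ]
      exact h3.trans (hmono σ _ D₁ K₁ hσ hσ1
        (Finset.prod_nonneg fun j _ => Real.rpow_nonneg (piSize_pos hb hmeas h0 j).le _)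
        (by omega) (by linarith) (by linarith))
  · obtain ⟨c, hc, hscheme⟩ := hflow A hA3
    refine ⟨c, hc, fun σ ε Ω hσ hσ1 hε hεσ hΩ hΩε => ?_⟩
    obtain ⟨Ωs, z₀, hΩs, hfib⟩ := hscheme σ ε Ω hσ hσ1 hε hεσ hΩ hΩε
    refine ⟨Ωs, z₀, hΩs, fun s hs => ?_⟩
    obtain ⟨E, hE, hsub, hvol⟩ := hfib s hs
    refine ⟨E, hE, hsub, hvol.trans ?_⟩
    rw [hinv ε hε]
    exact hmono ε _ D₂ K₂ hε (by linarith) measureReal_nonneg (by omega) (by linarith)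
      (by linarith)
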